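/- **Setting.** Let $\mathbb M=\mathbb R^{d}$, $d=s+1\ge 2$, be Minkowski space, $m\ge 0$ a mass ($m>0$ if $d=2$), $\mathcal E=C^\infty(\mathbb M,\mathbb R)$ with its Fréchet topology. A functional $F:\mathcal E\to\mathbb C$ is *smooth* if all iterated directional derivatives $F^{(n)}(\varphi)[\psi_1,\dots,\psi_n]$ exist and are jointly continuous; $\mathrm{supp}\,F$ is the set of $x$ such that for every neighbourhood $U$ of $x$ there are $\varphi,\psi$ with $\mathrm{supp}\,\psi\subset U$, $F(\varphi+\psi)\ne F(\varphi)$. $\mathcal F$ is the space of microcausal functionals (smooth, compactly supported, the wave front sets of all $F^{(n)}(\varphi)$ not meeting $\mathbb M^n\times(\overline V_+^n\cup\overline V_-^n)$). $\mathcal F_{\rm loc}\subset\mathcal F$ consists of the local functionals: $F(\varphi+\psi+\chi)=F(\varphi+\psi)-F(\psi)+F(\psi+\chi)$ if $\mathrm{supp}\,\varphi\cap\mathrm{supp}\,\chi=\emptyset$, and the wave front sets of the $F^{(n)}(\varphi)$ are perpendicular to the thin diagonal, i.e. covectors satisfy $\sum_i k_i=0$. *Formal maps.* A formal map $Z:\mathcal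 F_{\rm loc}[[\hbar]]\to\mathcal Y[[\hbar]]$ ($\mathcal Y=\mathcal F_{\rm loc}$ or $\mathcal F$) is a formal power series $\sum_n\frac1{n!}Z^{(n)}$ with symmetric $n$-linear maps $Z^{(n)}=\sum_L\hbar^L Z^{(n)}_L$, $Z^{(n)}_L:\mathcal F_{\rm loc}^{\otimes n}\to\mathcal Y$. Composition is defined by $(S\circ Z)^{(n)}=\sum_{P\in\mathrm{Part}\{1,\dots,n\}}S^{(|P|)}\bigl(\bigotimes_{I\in P}Z^{(|I|)}\bigr)$. Fix a group $\mathcal G$ of proper orthochronous Poincaré transformations containing all translations; $g\in\mathcal G$ acts by $(gF)(\varphi)=F(\varphi\circ g)$. Consider the following properties of a formal map $Z$: - *field independence*: $\langle\frac{\delta}{\delta\varphi}Z^{(n)}(F_1,\dots,F_n),\psi\rangle=\sum_k Z^{(n)}(F_1,\dots,\langle\frac{\delta F_k}{\delta\varphi},\psi\rangle,\dots,F_n)$; - *$\varphi$-locality*: $Z^{(n)}_L$ is a functional differential operator of total order at most $2L$, i.e. $Z^{(n)}_L(F_1,\dots,F_n)(\varphi)=0$ whenever $F_i^{(k)}(\varphi)=0$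 for all $i$ and $k<v_i$, with $\sum_i v_i>2L$; - *covariance*: $Z^{(n)}(gF_1,\dots,gF_n)=g\,Z^{(n)}(F_1,\dots,F_n)$ for $g\in\mathcal G$. The Stückelberg–Petermann group $\mathscr R$ consists of the formal maps $Z=\mathrm{id}+\hbar V$, with values in $\mathcal F_{\rm loc}[[\hbar]]$, with $V(0)=0$, $V^{(1)}(0)=0$, that have these three properties and are *local*: $Z(F+G+H)=Z(F+G)-Z(G)+Z(G+H)$ in every degree $n$ if $\mathrm{supp}\,F\cap\mathrm{supp}\,H=\emptyset$. A formal map $S$ with values in $\mathcal F[[\hbar]]$ satisfies the *Epstein–Glaser axioms* if $S^{(0)}=1$, $S^{(1)}=\mathrm{id}$ (starting element), if it has the three properties above, and if it is causal: $S^{(k+l)}(F_1,\dots,F_k,G_1,\dots,G_l)=S^{(k)}(F_1,\dots,F_k)\star S^{(l)}(G_1,\dots,G_l)$ whenever no $\mathrm{supp}\,F_i$ meets the causal past $\mathrm{supp}\,G_j+\overline V_-$. Here $A\star B(\varphi)=\sum_r\frac{\hbar^r}{r!}\langle A^{(r)}(\varphi),\Delta_+^{\otimes r}B^{(r)}(\varphi)\rangle$,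 with $\Delta_+$ the Wightman two-point function of mass $m$. A family $\Lambda\mapsto H^\Lambda\in\mathcal F_{\rm loc}$ is called *meromorphic* (*regular*) at $\Lambda_0$ if every $\varphi_0\in\mathcal E$ has a neighbourhood on which, for $\Lambda\neq\Lambda_0$ close to $\Lambda_0$ (for all $\Lambda$ close to $\Lambda_0$, including $\Lambda_0$), $H^\Lambda$ is a finite sum $\sum_i c_i(\Lambda)G_i$ with fixed $G_i\in\mathcal F_{\rm loc}$ and scalar functions $c_i$ meromorphic (analytic) at $\Lambda_0$. A family of formal maps with values in $\mathcal F_{\rm loc}[[\hbar]]$ is meromorphic (regular) at $\Lambda_0$ if all families $Z^{\Lambda(n)}_L(F_1,\dots,F_n)$ are. The principal part $\mathrm{pp}f$ of a scalar function $f$ meromorphic at $\Lambda_0$ is the polynomial without constant term in $(\Lambda-\Lambda_0)^{-1}$ such that $f-\mathrm{pp}f$ is regular at $\Lambda_0$; for families of formal maps, limits and principal parts are taken at fixed arguments $F_i$, fixed order in $\hbar$ and fixed $\varphi$. **Theorem (Birkhoff decomposition).** Let $U\subset\mathbb C$ be open, $\Lambda_0\in U$, and let $(Z^\Lambda)$ be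 a family of formal maps, meromorphic at $\Lambda_0$, with $Z^\Lambda\in\mathscr R$ for $\Lambda\in U\setminus\{\Lambda_0\}$. Then there are families $Z_{\rm MS}^\Lambda$ and $Z_f^\Lambda$ of formal maps such that: 1. for $\Lambda\in U\setminus\{\Lambda_0\}$: $Z_{\rm MS}^\Lambda\in\mathscr R$ and $Z^\Lambda=Z^\Lambda_{\rm MS}\circ Z^\Lambda_f$; for all $\Lambda\in U$ (including $\Lambda_0$): $Z_f^\Lambda\in\mathscr R$, and $Z_f^\Lambda$ has an inverse under composition in $\mathscr R$; 2. $Z_f^\Lambda$ is regular at $\Lambda_0$, and $Z_{\rm MS}^\Lambda$ is meromorphic at $\Lambda_0$; 3. for $n\ge2$, $\displaystyle (Z^\Lambda_{\rm MS})^{(n)}=\mathrm{pp}\Bigl[(Z^\Lambda)^{(n)}-\sum_{1<|P|<n}(Z_{\rm MS}^\Lambda)^{(|P|)}\bigl(\textstyle\bigotimes_{I\in P}(Z_f^\Lambda)^{(|I|)}\bigr)\Bigr]$, the sum running over partitions $P$ of $\{1,\dots,n\}$. Moreover, let $S$ satisfy the Epstein–Glaser axioms, and let $S^\Lambda$ be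 a family of formal maps with values in $\mathcal F[[\hbar]]$ (such as the regularized S-matrix $1+\mathrm{id}+\sum_{n\ge2}\frac1{n!}m_n\circ\exp\sum_{i<j}D^\Lambda_{ij}$), such that for $\Lambda\in U\setminus\{\Lambda_0\}$ $S^{\Lambda(0)}=1$, $S^{\Lambda(1)}=\mathrm{id}$ and $S^\Lambda$ is $\varphi$-local, all $S^{\Lambda(n)}_L(F_1,\dots,F_n)(\varphi)$ are meromorphic at $\Lambda_0$, and $S=\lim_{\Lambda\to\Lambda_0}S^\Lambda\circ Z^\Lambda$. Then: 4. $S^\Lambda_{\rm MS}:=S^\Lambda\circ Z^\Lambda\circ(Z_f^\Lambda)^{-1}=S^\Lambda\circ Z^\Lambda_{\rm MS}$ for $\Lambda\in U\setminus\{\Lambda_0\}$, the limit $S_{\rm MS}=\lim_{\Lambda\to\Lambda_0}S^\Lambda_{\rm MS}$ exists, $S_{\rm MS}=S\circ Z_f^{-1}$ with $Z_f:=Z_f^{\Lambda_0}$, and $S_{\rm MS}$ satisfies the Epstein–Glaser axioms; 5. $(Z_{\rm MS}^\Lambda)^{(1)}=\mathrm{id}$ for $\Lambda\in U\setminus\{\Lambda_0\}$,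 and for $n\ge2$ $$(Z_{\rm MS}^\Lambda)^{(n)}=-\,\mathrm{pp}\sum_{|P|>1}S^{\Lambda(|P|)}\Bigl(\bigotimes_{I\in P}(Z_{\rm MS}^\Lambda)^{(|I|)}\Bigr).$$ -/

import Mathlib

open Filter Topology Set
open scoped ContDiff

noncomputable section

namespace PAQFT

/-! ## Minkowski space and field configurations -/

/-- Minkowski space of dimension `s + 1`: a time coordinate and `s` space coordinates. -/
abbrev Mink (s : ℕ) : Type := ℝ × EuclideanSpace ℝ (Fin s)

/-- The Minkowski bilinear form, of signature `(+, -, …, -)`. -/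
def mink {s : ℕ} (k x : Mink s) : ℝ := k.1 * x.1 - inner ℝ k.2 x.2

/-- The closed forward light cone. -/
def forwardCone (s : ℕ) : Set (Mink s) := {k | ‖k.2‖ ≤ k.1}

/-- The closed backward light cone. -/
def backwardCone (s : ℕ) : Set (Mink s) := {k | ‖k.2‖ ≤ -k.1}

/-- The real vector space of smooth functions on Minkowski space. -/
def smoothFunctions (s : ℕ) : Submodule ℝ (Mink s → ℝ) where
  carrier := {f | ContDiff ℝ ∞ f}
  add_mem' {f g} hf hg := by
    have hf' : ContDiff ℝ ∞ f := hf
    have hg' : ContDiff ℝ ∞ g := hg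
    exact hf'.add hg'
  zero_mem' := by
    have h : ContDiff ℝ ∞ (fun _ : Mink s => (0 : ℝ)) := contDiff_const
    exact h
  smul_mem' c f hf := by
    have hf' : ContDiff ℝ ∞ f := hf
    exact hf'.const_smul c

/-- The space of field configurations: smooth real functions on Minkowski space. -/
def Config (s : ℕ) : Type := smoothFunctions s

instance (s : ℕ) : AddCommGroup (Config s) := inferInstanceAs (AddCommGroup (smoothFunctions s))

instance (s : ℕ) : Module ℝ (Config s) := inferInstanceAs (Module ℝ (smoothFunctions s))

instance (s : ℕ) : CoeFun (Config s) (fun _ => Mink s → ℝ) := ⟨fun φ => φ.1⟩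

/-- A smooth function, as a field configuration. -/
def Config.mk {s : ℕ} (f : Mink s → ℝ) (hf : ContDiff ℝ ∞ f) : Config s := ⟨f, hf⟩

theorem Config.contDiff {s : ℕ} (φ : Config s) : ContDiff ℝ ∞ φ := φ.2

/-- The `k`-th total derivative of a field configuration, as a continuous map. -/
def Config.jet {s : ℕ} (k : ℕ) (φ : Config s) : C(Mink s, Mink s [×k]→L[ℝ] ℝ) :=
  ⟨iteratedFDeriv ℝ k φ, φ.contDiff.continuous_iteratedFDeriv (by exact_mod_cast le_top)⟩

/-- The Fréchet topology of `C^∞`: uniform convergence of all derivatives on compact sets. -/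
instance (s : ℕ) : TopologicalSpace (Config s) :=
  ⨅ k : ℕ, TopologicalSpace.induced (Config.jet k) ContinuousMap.compactOpen

/-! ## Functionals and their derivatives -/

/-- The iterated directional (Gateaux) derivatives
`F^{(n)}(φ)(ψ_1, …, ψ_n)`, the last direction being differentiated last. -/
def funcDeriv {s : ℕ} (F : Config s → ℂ) : (n : ℕ) → Config s → (Fin n → Config s) → ℂ
  | 0, φ, _ => F φ
  | n + 1, φ, ψ =>
      deriv (fun t : ℝ => funcDeriv F n (φ + t • ψ (Fin.last n)) (Fin.init ψ)) 0

/-- Smoothness of a functional in the sense of infinite dimensional (Bastiani, Michal) calculus: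
all iterated directional derivatives exist and are jointly continuous. -/
def SmoothFunctional {s : ℕ} (F : Config s → ℂ) : Prop :=
  ∀ n : ℕ,
    Continuous (fun p : Config s × (Fin n → Config s) => funcDeriv F n p.1 p.2) ∧
    ∀ (φ ψ : Config s) (v : Fin n → Config s),
      DifferentiableAt ℝ (fun t : ℝ => funcDeriv F n (φ + t • ψ) v) 0

/-- The spacetime support of a functional. -/
def spaceSupport {s : ℕ} (F : Config s → ℂ) : Set (Mink s) :=
  {x | ∀ U ∈ 𝓝 x, ∃ φ ψ : Config s, tsupport (ψ : Mink s → ℝ) ⊆ U ∧ F (φ + ψ) ≠ F φ}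

/-- The additivity property that characterizes local functionals. -/
def AdditiveFunctional {s : ℕ} (F : Config s → ℂ) : Prop :=
  ∀ φ ψ χ : Config s, Disjoint (tsupport (φ : Mink s → ℝ)) (tsupport (χ : Mink s → ℝ)) →
    F (φ + ψ + χ) = F (φ + ψ) - F ψ + F (ψ + χ)

/-! ## Wave front sets -/

/-- The value at `(f_1 + i g_1, …, f_n + i g_n)` of the complex multilinear extension
of a real multilinear form `u`. -/
def complexExt {s n : ℕ} (u : (Fin n → Config s) → ℂ) (f g : Fin n → Config s) : ℂ :=
  ∑ A : Finset (Fin n), Complex.I ^ A.card * u (fun i => if i ∈ A then g i else f i)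

theorem contDiff_mink {s : ℕ} (k : Mink s) : ContDiff ℝ ∞ (mink k) := by
  unfold mink
  exact (contDiff_const.mul contDiff_fst).sub (contDiff_const.inner ℝ contDiff_snd)

/-- The function `x ↦ χ(x) cos(k·x)`, the real part of `χ(x) e^{-i k·x}`. -/
def cosWave {s : ℕ} (χ : Config s) (k : Mink s) : Config s :=
  Config.mk (fun x => χ x * Real.cos (mink k x))
    (χ.contDiff.mul (Real.contDiff_cos.comp (contDiff_mink k)))

/-- The function `x ↦ -χ(x) sin(k·x)`, the imaginary part of `χ(x) e^{-i k·x}`. -/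
def sinWave {s : ℕ} (χ : Config s) (k : Mink s) : Config s :=
  Config.mk (fun x => -(χ x * Real.sin (mink k x)))
    (χ.contDiff.mul (Real.contDiff_sin.comp (contDiff_mink k))).neg

/-- The Fourier transform `⟨u, ∏_i χ_i(x_i) e^{-i k_i·x_i}⟩` of the product of the distribution `u`
with the cut-off function `χ_1 ⊗ … ⊗ χ_n`. -/
def localFourier {s n : ℕ} (u : (Fin n → Config s) → ℂ) (χ : Fin n → Config s)
    (k : Fin n → Mink s) : ℂ :=
  complexExt u (fun i => cosWave (χ i) (k i)) (fun i => sinWave (χ i) (k i))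

/-- `(x, k)` is a regular direction of the distribution `u` in `n` spacetime variables
(given through its values on products of functions of one variable): there are a neighbourhood
`U_1 × … × U_n` of `x` and a conic neighbourhood `Γ` of `k` such that, after localization
in the former, the Fourier transform decays rapidly in the latter. Covectors are identified
with vectors by means of the Minkowski form. -/
def RegularDirection {s n : ℕ} (u : (Fin n → Config s) → ℂ) (x k : Fin n → Mink s) : Prop :=
  ∃ (U : Fin n → Set (Mink s)) (Γ : Set (Fin n → Mink s)),
    (∀ i, IsOpen (U i) ∧ x i ∈ U i) ∧ IsOpen Γ ∧ k ∈ Γ ∧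
    (∀ ξ ∈ Γ, ∀ t : ℝ, 0 < t → t • ξ ∈ Γ) ∧
    ∀ χ : Fin n → Config s,
      (∀ i, HasCompactSupport (χ i : Mink s → ℝ) ∧ tsupport (χ i : Mink s → ℝ) ⊆ U i) →
      ∀ N : ℕ, ∃ C : ℝ, ∀ ξ ∈ Γ, (1 + ‖ξ‖) ^ N * ‖localFourier u χ ξ‖ ≤ C

/-- The wave front set of a distribution in `n` spacetime variables. -/
def waveFrontSet {s n : ℕ} (u : (Fin n → Config s) → ℂ) :
    Set ((Fin n → Mink s) × (Fin n → Mink s)) :=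
  {p | p.2 ≠ 0 ∧ ¬ RegularDirection u p.1 p.2}

/-- The wave front sets of all derivatives of `F` avoid the points all of whose covectors lie in
the forward light cone, and those all of whose covectors lie in the backward one. -/
def MicrocausalWF {s : ℕ} (F : Config s → ℂ) : Prop :=
  ∀ (n : ℕ) (φ : Config s), ∀ p ∈ waveFrontSet (funcDeriv F n φ),
    ¬ (∀ i, p.2 i ∈ forwardCone s) ∧ ¬ (∀ i, p.2 i ∈ backwardCone s)

/-- The wave front sets of all derivatives of `F` are perpendicular to the tangent bundle of the
thin diagonal `{(x, …, x)}`. -/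
def PerpendicularWF {s : ℕ} (F : Config s → ℂ) : Prop :=
  ∀ (n : ℕ) (φ : Config s), ∀ p ∈ waveFrontSet (funcDeriv F n φ), ∑ i, p.2 i = 0

/-! ### Closure properties needed for the spaces of functionals -/

theorem funcDeriv_zero {s : ℕ} (n : ℕ) (φ : Config s) (v : Fin n → Config s) :
    funcDeriv (0 : Config s → ℂ) n φ v = 0 := by
  induction n generalizing φ with
  | zero => rfl
  | succ n ih => simp [funcDeriv, ih]

theorem funcDeriv_add {s : ℕ} {F G : Config s → ℂ} (hF : SmoothFunctional F)
    (hG : SmoothFunctional G) (n : ℕ) (φ : Config s) (v : Fin n → Config s) :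
    funcDeriv (F + G) n φ v = funcDeriv F n φ v + funcDeriv G n φ v := by
  induction n generalizing φ with
  | zero => rfl
  | succ n ih =>
    simp only [funcDeriv, ih]
    exact deriv_fun_add ((hF n).2 _ _ _) ((hG n).2 _ _ _)

theorem funcDeriv_smul {s : ℕ} {F : Config s → ℂ} (hF : SmoothFunctional F) (c : ℂ) (n : ℕ)
    (φ : Config s) (v : Fin n → Config s) :
    funcDeriv (c • F) n φ v = c * funcDeriv F n φ v := by
  induction n generalizing φ with
  | zero => rfl
  | succ n ih =>
    simp only [funcDeriv, ih]
    exact deriv_const_mul c ((hF n).2 _ _ _)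

theorem SmoothFunctional.zero {s : ℕ} : SmoothFunctional (0 : Config s → ℂ) := by
  intro n
  simp only [funcDeriv_zero]
  exact ⟨continuous_const, fun _ _ _ => differentiableAt_const _⟩

theorem SmoothFunctional.add {s : ℕ} {F G : Config s → ℂ} (hF : SmoothFunctional F)
    (hG : SmoothFunctional G) : SmoothFunctional (F + G) := by
  intro n
  simp only [funcDeriv_add hF hG]
  exact ⟨(hF n).1.add (hG n).1, fun φ ψ v => ((hF n).2 φ ψ v).add ((hG n).2 φ ψ v)⟩

theorem SmoothFunctional.smul {s : ℕ} {F : Config s → ℂ} (hF : SmoothFunctional F) (c : ℂ) :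
    SmoothFunctional (c • F) := by
  intro n
  simp only [funcDeriv_smul hF]
  exact ⟨continuous_const.mul (hF n).1, fun φ ψ v => ((hF n).2 φ ψ v).const_mul c⟩

theorem isClosed_spaceSupport {s : ℕ} (F : Config s → ℂ) : IsClosed (spaceSupport F) := by
  rw [← isOpen_compl_iff, isOpen_iff_mem_nhds]
  intro x hx
  simp only [spaceSupport, mem_compl_iff, mem_ofPred_eq, not_forall, not_exists] at hx
  obtain ⟨U, hU, h⟩ := hx
  filter_upwards [eventually_mem_nhds_iff.2 hU] with y hy hy'
  obtain ⟨φ, ψ, h1, h2⟩ := hy' U hy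
  exact h φ ψ ⟨h1, h2⟩

theorem spaceSupport_zero {s : ℕ} : spaceSupport (0 : Config s → ℂ) = ∅ := by
  ext x
  simp only [spaceSupport, mem_ofPred_eq, mem_empty_iff_false, iff_false]
  intro h
  obtain ⟨φ, ψ, -, h2⟩ := h univ univ_mem
  exact h2 rfl

theorem spaceSupport_add {s : ℕ} (F G : Config s → ℂ) :
    spaceSupport (F + G) ⊆ spaceSupport F ∪ spaceSupport G := by
  intro x hx
  by_contra hcon
  rw [mem_union, not_or] at hcon
  obtain ⟨h1, h2⟩ := hcon
  simp only [spaceSupport, mem_ofPred_eq, not_forall, not_exists, not_and, not_not] at h1 h2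
  obtain ⟨U, hU, hF⟩ := h1
  obtain ⟨V, hV, hG⟩ := h2
  obtain ⟨φ, ψ, h3, h4⟩ := hx (U ∩ V) (inter_mem hU hV)
  apply h4
  simp only [Pi.add_apply]
  rw [hF φ ψ (h3.trans inter_subset_left), hG φ ψ (h3.trans inter_subset_right)]

theorem spaceSupport_smul {s : ℕ} (c : ℂ) (F : Config s → ℂ) :
    spaceSupport (c • F) ⊆ spaceSupport F := by
  intro x hx U hU
  obtain ⟨φ, ψ, h1, h2⟩ := hx U hU
  refine ⟨φ, ψ, h1, fun h => h2 ?_⟩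
  simp [h]

theorem localFourier_zero {s n : ℕ} (χ : Fin n → Config s) (k : Fin n → Mink s) :
    localFourier (fun _ : Fin n → Config s => (0 : ℂ)) χ k = 0 := by
  simp [localFourier, complexExt]

theorem localFourier_add {s n : ℕ} (u w : (Fin n → Config s) → ℂ) (χ : Fin n → Config s)
    (k : Fin n → Mink s) :
    localFourier (fun v => u v + w v) χ k = localFourier u χ k + localFourier w χ k := by
  simp [localFourier, complexExt, mul_add, Finset.sum_add_distrib]

theorem localFourier_smul {s n : ℕ} (c : ℂ) (u : (Fin n → Config s) → ℂ) (χ : Fin n → Config s)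
    (k : Fin n → Mink s) :
    localFourier (fun v => c * u v) χ k = c * localFourier u χ k := by
  simp only [localFourier, complexExt, Finset.mul_sum]
  exact Finset.sum_congr rfl fun A _ => by ring

theorem RegularDirection.zero {s n : ℕ} (x k : Fin n → Mink s) :
    RegularDirection (fun _ : Fin n → Config s => (0 : ℂ)) x k :=
  ⟨fun _ => univ, univ, fun _ => ⟨isOpen_univ, trivial⟩, isOpen_univ, trivial,
    fun _ _ _ _ => trivial, fun _ _ _ => ⟨0, fun _ _ => by simp [localFourier_zero]⟩⟩

theorem RegularDirection.add {s n : ℕ} {u w : (Fin n → Config s) → ℂ} {x k : Fin n → Mink s}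
    (hu : RegularDirection u x k) (hw : RegularDirection w x k) :
    RegularDirection (fun v => u v + w v) x k := by
  obtain ⟨U, Γ, hU, hΓ, hk, hcone, h⟩ := hu
  obtain ⟨U', Γ', hU', hΓ', hk', hcone', h'⟩ := hw
  refine ⟨fun i => U i ∩ U' i, Γ ∩ Γ', fun i => ⟨(hU i).1.inter (hU' i).1, (hU i).2, (hU' i).2⟩,
    hΓ.inter hΓ', ⟨hk, hk'⟩, fun ξ hξ t ht => ⟨hcone ξ hξ.1 t ht, hcone' ξ hξ.2 t ht⟩, ?_⟩
  intro χ hχ N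
  obtain ⟨C, hC⟩ := h χ (fun i => ⟨(hχ i).1, (hχ i).2.trans inter_subset_left⟩) N
  obtain ⟨C', hC'⟩ := h' χ (fun i => ⟨(hχ i).1, (hχ i).2.trans inter_subset_right⟩) N
  refine ⟨C + C', fun ξ hξ => ?_⟩
  rw [localFourier_add]
  calc (1 + ‖ξ‖) ^ N * ‖localFourier u χ ξ + localFourier w χ ξ‖
      ≤ (1 + ‖ξ‖) ^ N * (‖localFourier u χ ξ‖ + ‖localFourier w χ ξ‖) := by
        gcongr
        exact norm_add_le _ _
    _ ≤ C + C' := by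
        rw [mul_add]
        exact add_le_add (hC ξ hξ.1) (hC' ξ hξ.2)

theorem RegularDirection.smul {s n : ℕ} {u : (Fin n → Config s) → ℂ} {x k : Fin n → Mink s}
    (hu : RegularDirection u x k) (c : ℂ) : RegularDirection (fun v => c * u v) x k := by
  obtain ⟨U, Γ, hU, hΓ, hk, hcone, h⟩ := hu
  refine ⟨U, Γ, hU, hΓ, hk, hcone, fun χ hχ N => ?_⟩
  obtain ⟨C, hC⟩ := h χ hχ N
  refine ⟨‖c‖ * C, fun ξ hξ => ?_⟩
  rw [localFourier_smul, norm_mul, mul_left_comm]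
  exact mul_le_mul_of_nonneg_left (hC ξ hξ) (norm_nonneg c)

theorem waveFrontSet_zero {s n : ℕ} :
    waveFrontSet (fun _ : Fin n → Config s => (0 : ℂ)) = ∅ := by
  ext p
  simp [waveFrontSet, RegularDirection.zero]

theorem waveFrontSet_add {s n : ℕ} (u w : (Fin n → Config s) → ℂ) :
    waveFrontSet (fun v => u v + w v) ⊆ waveFrontSet u ∪ waveFrontSet w := by
  rintro p ⟨h0, h1⟩
  by_contra hcon
  simp only [waveFrontSet, mem_union, mem_ofPred_eq, not_or, not_and, not_not] at hcon
  exact h1 ((hcon.1 h0).add (hcon.2 h0))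

theorem waveFrontSet_smul {s n : ℕ} (c : ℂ) (u : (Fin n → Config s) → ℂ) :
    waveFrontSet (fun v => c * u v) ⊆ waveFrontSet u :=
  fun _ hp => ⟨hp.1, fun h => hp.2 (h.smul c)⟩

/-- The complex vector space of microcausal functionals. -/
def Microcausal (s : ℕ) : Submodule ℂ (Config s → ℂ) where
  carrier := {F | SmoothFunctional F ∧ IsCompact (spaceSupport F) ∧ MicrocausalWF F}
  zero_mem' := by
    refine ⟨SmoothFunctional.zero, by simp [spaceSupport_zero], fun n φ p hp => ?_⟩
    rw [show funcDeriv (0 : Config s → ℂ) n φ = fun _ => 0 from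
      funext fun v => funcDeriv_zero n φ v, waveFrontSet_zero] at hp
    exact hp.elim
  add_mem' := by
    rintro F G ⟨h1, h2, h3⟩ ⟨k1, k2, k3⟩
    refine ⟨h1.add k1, (h2.union k2).of_isClosed_subset (isClosed_spaceSupport _)
      (spaceSupport_add F G), fun n φ p hp => ?_⟩
    rw [show funcDeriv (F + G) n φ = fun v => funcDeriv F n φ v + funcDeriv G n φ v from
      funext fun v => funcDeriv_add h1 k1 n φ v] at hp
    exact (waveFrontSet_add _ _ hp).elim (h3 n φ p) (k3 n φ p)
  smul_mem' := by
    rintro c F ⟨h1, h2, h3⟩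
    refine ⟨h1.smul c, h2.of_isClosed_subset (isClosed_spaceSupport _)
      (spaceSupport_smul c F), fun n φ p hp => ?_⟩
    rw [show funcDeriv (c • F) n φ = fun v => c * funcDeriv F n φ v from
      funext fun v => funcDeriv_smul h1 c n φ v] at hp
    exact h3 n φ p (waveFrontSet_smul c _ hp)

/-- The complex vector space of local functionals. -/
def Local (s : ℕ) : Submodule ℂ (Config s → ℂ) where
  carrier := {F | F ∈ Microcausal s ∧ AdditiveFunctional F ∧ PerpendicularWF F}
  zero_mem' := by
    refine ⟨Submodule.zero_mem _, fun φ ψ χ _ => by simp, fun n φ p hp => ?_⟩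
    rw [show funcDeriv (0 : Config s → ℂ) n φ = fun _ => 0 from
      funext fun v => funcDeriv_zero n φ v, waveFrontSet_zero] at hp
    exact hp.elim
  add_mem' := by
    rintro F G ⟨h1, h2, h3⟩ ⟨k1, k2, k3⟩
    refine ⟨Submodule.add_mem _ h1 k1, fun φ ψ χ h => ?_, fun n φ p hp => ?_⟩
    · simp only [Pi.add_apply, h2 φ ψ χ h, k2 φ ψ χ h]
      ring
    · rw [show funcDeriv (F + G) n φ = fun v => funcDeriv F n φ v + funcDeriv G n φ v from
        funext fun v => funcDeriv_add h1.1 k1.1 n φ v] at hp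
      exact (waveFrontSet_add _ _ hp).elim (h3 n φ p) (k3 n φ p)
  smul_mem' := by
    rintro c F ⟨h1, h2, h3⟩
    refine ⟨Submodule.smul_mem _ c h1, fun φ ψ χ h => ?_, fun n φ p hp => ?_⟩
    · simp only [Pi.smul_apply, smul_eq_mul, h2 φ ψ χ h]
      ring
    · rw [show funcDeriv (c • F) n φ = fun v => c * funcDeriv F n φ v from
        funext fun v => funcDeriv_smul h1.1 c n φ v] at hp
      exact h3 n φ p (waveFrontSet_smul c _ hp)

/-! ## Formal maps and their composition -/

/-- A formal power series `∑_n (1/n!) Z^{(n)}` on local functionals, with values in a space `Y`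
of functionals. The derivative `Z^{(n)}` at `0` is a symmetric `n`-linear map with values in
`Y[[ħ]]`; its coefficient at `ħ^L` is `coeff n L`. Such maps are the same as `ℂ[[ħ]]`-linear
ones on the formal power series in `ħ` with coefficients in the local functionals. -/
structure FormalMap (s : ℕ) (Y : Submodule ℂ (Config s → ℂ)) where
  coeff : (n L : ℕ) → MultilinearMap ℂ (fun _ : Fin n => Local s) Y
  symm : ∀ (n L : ℕ) (σ : Equiv.Perm (Fin n)) (F : Fin n → Local s),
    coeff n L (fun i => F (σ i)) = coeff n L F

/-- The coefficient at `ħ^L` of `S^{(|P|)} (⊗_{I ∈ P} Z^{(|I|)}) (F_1, …, F_n)`, for a partition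
`P` of the index set `Fin n`. -/
def partTerm {s : ℕ} {Y : Submodule ℂ (Config s → ℂ)} (S : FormalMap s Y)
    (Z : FormalMap s (Local s)) {n : ℕ} (P : OrderedFinpartition n) (L : ℕ)
    (F : Fin n → Local s) : Y :=
  ∑ a ∈ Finset.HasAntidiagonal.antidiagonal L,
    ∑ l ∈ Finset.piAntidiag (Finset.univ : Finset (Fin P.length)) a.2,
      S.coeff P.length a.1 (fun I => Z.coeff (P.partSize I) (l I) (fun i => F (P.emb I i)))

/-- The coefficient at `ħ^L` of `(S ∘ Z)^{(n)} (F_1, …, F_n)` (formula of Faà di Bruno, the sum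
runs over all partitions of the index set). -/
def compCoeff {s : ℕ} {Y : Submodule ℂ (Config s → ℂ)} (S : FormalMap s Y)
    (Z : FormalMap s (Local s)) (n L : ℕ) (F : Fin n → Local s) : Y :=
  ∑ P : OrderedFinpartition n, partTerm S Z P L F

/-- `T = S ∘ Z` as formal maps. -/
def IsComp {s : ℕ} {Y : Submodule ℂ (Config s → ℂ)} (T S : FormalMap s Y)
    (Z : FormalMap s (Local s)) : Prop :=
  ∀ (n L : ℕ) (F : Fin n → Local s), T.coeff n L F = compCoeff S Z n L F

/-- `T` is the identity map. -/
def IsIdentity {s : ℕ} (T : (n L : ℕ) → (Fin n → Local s) → Local s) : Prop :=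
  ∀ (n L : ℕ) (F : Fin n → Local s),
    T n L F = if h : n = 1 ∧ L = 0 then F ⟨0, by omega⟩ else 0

/-- `W` is the inverse of `Z` with respect to composition. -/
def IsInverse {s : ℕ} (W Z : FormalMap s (Local s)) : Prop :=
  IsIdentity (compCoeff W Z) ∧ IsIdentity (compCoeff Z W)

/-! ## Properties of formal maps -/

/-- `Z^{(1)} = id`. -/
def FirstIsId {s : ℕ} {Y : Submodule ℂ (Config s → ℂ)} (Z : FormalMap s Y) : Prop :=
  ∀ (L : ℕ) (F : Fin 1 → Local s) (φ : Config s),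
    (Z.coeff 1 L F).1 φ = if L = 0 then (F 0).1 φ else 0

/-- Field independence: `⟨δ/δφ Z^{(n)}(F_1, …, F_n), ψ⟩ =
∑_k Z^{(n)}(F_1, …, ⟨δF_k/δφ, ψ⟩, …, F_n)`. -/
def FieldIndependent {s : ℕ} {Y : Submodule ℂ (Config s → ℂ)} (Z : FormalMap s Y) : Prop :=
  ∀ (n L : ℕ) (F F' : Fin n → Local s) (ψ : Config s),
    (∀ k φ, (F' k).1 φ = funcDeriv (F k).1 1 φ (fun _ => ψ)) →
    ∀ φ, funcDeriv (Z.coeff n L F).1 1 φ (fun _ => ψ) =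
      ∑ k, (Z.coeff n L (Function.update F k (F' k))).1 φ

/-- `φ`-locality: in order `ħ^L` each `Z^{(n)}` is a functional differential operator of total
order at most `2L`. That is, its value at `φ` vanishes on `F_1 ⊗ … ⊗ F_n` whenever each `F_i`
vanishes at `φ` together with its derivatives of order less than `v_i`, with
`v_1 + … + v_n > 2L`. -/
def PhiLocal {s : ℕ} {Y : Submodule ℂ (Config s → ℂ)} (Z : FormalMap s Y) : Prop :=
  ∀ (n L : ℕ) (F : Fin n → Local s) (φ : Config s) (v : Fin n → ℕ),
    (∀ i, ∀ k < v i, ∀ ψ : Fin k → Config s, funcDeriv (F i).1 k φ ψ = 0) →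
    2 * L < ∑ i, v i → (Z.coeff n L F).1 φ = 0

/-- A proper orthochronous Poincaré transformation. -/
def IsPoincare {s : ℕ} (g : Mink s ≃ᵃ[ℝ] Mink s) : Prop :=
  (∀ x y, mink (g.linear x) (g.linear y) = mink x y) ∧
  0 < (g.linear ((1, 0) : Mink s)).1 ∧
  LinearMap.det (g.linear : Mink s →ₗ[ℝ] Mink s) = 1

theorem contDiff_affineEquiv {s : ℕ} (g : Mink s ≃ᵃ[ℝ] Mink s) : ContDiff ℝ ∞ g :=
  (ContinuousAffineEquiv.mk g g.continuous_of_finiteDimensional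
    g.symm.continuous_of_finiteDimensional : Mink s ≃ᴬ[ℝ] Mink s).toContinuousAffineMap.contDiff

/-- The field configuration `φ ∘ g`. -/
def Config.pullback {s : ℕ} (φ : Config s) (g : Mink s ≃ᵃ[ℝ] Mink s) : Config s :=
  Config.mk (fun x => φ (g x)) (φ.contDiff.comp (contDiff_affineEquiv g))

/-- Covariance under a group of spacetime transformations, which act on functionals by
`(g F)(φ) = F (φ ∘ g)`. -/
def Covariant {s : ℕ} {Y : Submodule ℂ (Config s → ℂ)}
    (𝒢 : Subgroup (Mink s ≃ᵃ[ℝ] Mink s)) (Z : FormalMap s Y) : Prop :=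
  ∀ g ∈ 𝒢, ∀ (n L : ℕ) (F F' : Fin n → Local s),
    (∀ k φ, (F' k).1 φ = (F k).1 (φ.pullback g)) →
    ∀ φ, (Z.coeff n L F').1 φ = (Z.coeff n L F).1 (φ.pullback g)

/-- Locality of a formal map:
`Z(F + G + H) = Z(F + G) - Z(G) + Z(G + H)` if the supports of `F` and `H` are disjoint,
as an identity of formal power series, that is, in each degree `n`. -/
def LocalMap {s : ℕ} (Z : FormalMap s (Local s)) : Prop :=
  ∀ (n L : ℕ) (F G H : Local s), Disjoint (spaceSupport F.1) (spaceSupport H.1) →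
    Z.coeff n L (fun _ => F + G + H) =
      Z.coeff n L (fun _ => F + G) - Z.coeff n L (fun _ => G) + Z.coeff n L (fun _ => G + H)

/-- The Stückelberg–Petermann renormalization group: maps `Z = id + ħ V` with `V(0) = 0`,
`V^{(1)}(0) = 0`, which are local, field independent, `φ`-local, and covariant. -/
structure RenormGroup {s : ℕ} (𝒢 : Subgroup (Mink s ≃ᵃ[ℝ] Mink s))
    (Z : FormalMap s (Local s)) : Prop where
  map_zero : ∀ L F, Z.coeff 0 L F = 0
  first_order : FirstIsId Z
  tangent_id : ∀ n, 2 ≤ n → ∀ F, Z.coeff n 0 F = 0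
  isLocal : LocalMap Z
  field_independent : FieldIndependent Z
  phi_local : PhiLocal Z
  covariant : Covariant 𝒢 Z

/-! ## The star product and the Epstein-Glaser axioms -/

/-- The energy on the mass shell. -/
def energy {s : ℕ} (m : ℝ) (p : EuclideanSpace ℝ (Fin s)) : ℝ := √(‖p‖ ^ 2 + m ^ 2)

/-- The constant field configuration `1`. -/
def Config.one (s : ℕ) : Config s := Config.mk (fun _ => 1) contDiff_const

/-- The integrand of `⟨u, Δ_+^{⊗ r} w⟩`, where
`Δ_+(x) = ∫ d^s p / ((2π)^s 2 ω(p)) e^{-i (ω(p) x^0 - p·x)}` is the Wightman two-point function of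
mass `m` (`ω(p)` the energy) and `u`, `w` are compactly supported distributions in `r` variables:
`∏_i 1/((2π)^s 2 ω(p_i))` times the values of `u` at `∏_i e^{-i p_i·x_i}` and of `w` at
`∏_i e^{i p_i·x_i}`, with the `p_i` on the mass shell. -/
def wightmanIntegrand {s r : ℕ} (m : ℝ) (u w : (Fin r → Config s) → ℂ)
    (p : Fin r → EuclideanSpace ℝ (Fin s)) : ℂ :=
  ((∏ i, ((2 * Real.pi) ^ s * (2 * energy m (p i)))⁻¹ : ℝ) : ℂ) *
    localFourier u (fun _ => Config.one s) (fun i => (energy m (p i), p i)) *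
    localFourier w (fun _ => Config.one s) (fun i => -(energy m (p i), p i))

/-- `C` is the coefficient at `ħ^L` of the star product `A ⋆ B` at the configuration `φ`, where
`A = ∑ A_a ħ^a`, `B = ∑ B_b ħ^b` and
`A ⋆ B = ∑_r (ħ^r / r!) ⟨A^{(r)}(φ), Δ_+^{⊗ r} B^{(r)}(φ)⟩`, all integrals being absolutely
convergent. -/
def IsStarCoeff {s : ℕ} (m : ℝ) (A B : ℕ → Config s → ℂ) (L : ℕ) (φ : Config s) (C : ℂ) : Prop :=
  (∀ r a b : ℕ, r + (a + b) = L → MeasureTheory.Integrable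
    (wightmanIntegrand (r := r) m (funcDeriv (A a) r φ) (funcDeriv (B b) r φ))) ∧
  C = ∑ i ∈ Finset.HasAntidiagonal.antidiagonal L, ∑ j ∈ Finset.HasAntidiagonal.antidiagonal i.2,
    ((i.1.factorial : ℂ))⁻¹ *
      ∫ p, wightmanIntegrand (r := i.1) m (funcDeriv (A j.1) i.1 φ) (funcDeriv (B j.2) i.1 φ) p

/-- The set `K` is later than the set `K'`: it does not meet the causal past of `K'`. -/
def Later {s : ℕ} (K K' : Set (Mink s)) : Prop :=
  ∀ x ∈ K, ∀ y ∈ K', y - x ∉ forwardCone s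

/-- Causal factorization: `S^{(k+l)}(F_1, …, F_k, G_1, …, G_l) =
S^{(k)}(F_1, …, F_k) ⋆ S^{(l)}(G_1, …, G_l)` if the supports of the `F_i` are later than the
supports of the `G_j`. -/
def Causal {s : ℕ} (m : ℝ) (S : FormalMap s (Microcausal s)) : Prop :=
  ∀ (k l : ℕ) (F : Fin k → Local s) (G : Fin l → Local s),
    (∀ i j, Later (spaceSupport (F i).1) (spaceSupport (G j).1)) →
    ∀ (L : ℕ) (φ : Config s),
      IsStarCoeff m (fun a => (S.coeff k a F).1) (fun b => (S.coeff l b G).1) L φ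
        ((S.coeff (k + l) L (Fin.append F G)).1 φ)

/-- `S = 1 + id + (terms of order at least two)`. -/
def StartingElement {s : ℕ} (S : FormalMap s (Microcausal s)) : Prop :=
  (∀ (L : ℕ) (F : Fin 0 → Local s) (φ : Config s),
    (S.coeff 0 L F).1 φ = if L = 0 then 1 else 0) ∧ FirstIsId S

/-- The Epstein-Glaser axioms for a formal S-matrix (the generating functional of the
time-ordered products) of a real scalar field of mass `m`. -/
structure EpsteinGlaser {s : ℕ} (m : ℝ) (𝒢 : Subgroup (Mink s ≃ᵃ[ℝ] Mink s))
    (S : FormalMap s (Microcausal s)) : Prop where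
  starting_element : StartingElement S
  causal : Causal m S
  phi_local : PhiLocal S
  field_independent : FieldIndependent S
  covariant : Covariant 𝒢 S

/-! ## Meromorphic families -/

/-- A family of local functionals is meromorphic at `Λ₀`: locally in the field configuration it is
a finite combination of fixed local functionals whose coefficients are meromorphic at `Λ₀`. -/
def MeromorphicFamilyAt {s : ℕ} (H : ℂ → Local s) (Λ₀ : ℂ) : Prop :=
  ∀ φ₀ : Config s, ∃ W ∈ 𝓝 φ₀, ∃ (r : ℕ) (c : Fin r → ℂ → ℂ) (G : Fin r → Local s),
    (∀ i, MeromorphicAt (c i) Λ₀) ∧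
    ∀ᶠ Λ in 𝓝[≠] Λ₀, ∀ φ ∈ W, (H Λ).1 φ = ∑ i, c i Λ * (G i).1 φ

/-- A family of local functionals is regular at `Λ₀` (including its value there): locally in the
field configuration it is a finite combination of fixed local functionals whose coefficients are
analytic at `Λ₀`. -/
def RegularFamilyAt {s : ℕ} (H : ℂ → Local s) (Λ₀ : ℂ) : Prop :=
  ∀ φ₀ : Config s, ∃ W ∈ 𝓝 φ₀, ∃ (r : ℕ) (c : Fin r → ℂ → ℂ) (G : Fin r → Local s),
    (∀ i, AnalyticAt ℂ (c i) Λ₀) ∧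
    ∀ᶠ Λ in 𝓝 Λ₀, ∀ φ ∈ W, (H Λ).1 φ = ∑ i, c i Λ * (G i).1 φ

/-- `p` is the principal part at `Λ₀` of the (meromorphic) function `f`: a polynomial without
constant term in `1/(Λ - Λ₀)` such that `f - p` is regular at `Λ₀`. -/
def IsPrincipalPart (Λ₀ : ℂ) (f p : ℂ → ℂ) : Prop :=
  (∃ (N : ℕ) (a : Fin N → ℂ), ∀ Λ, Λ ≠ Λ₀ → p Λ = ∑ j, a j * ((Λ - Λ₀)⁻¹) ^ ((j : ℕ) + 1)) ∧
  ∃ g : ℂ → ℂ, AnalyticAt ℂ g Λ₀ ∧ ∀ᶠ Λ in 𝓝[≠] Λ₀, f Λ = p Λ + g Λ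

end PAQFT

end

/-!
The decomposition is built by induction on the degree `n`. Since `A^{(1)} = B^{(1)} = id`, the
partition into one block and the one into singletons contribute `B^{(n)} + A^{(n)}` to
`(A ∘ B)^{(n)}`, and all other partitions involve terms of lower degree only. So
`Z = Z_MS ∘ Z_f` requires that `Z_MS^{(n)} + Z_f^{(n)}` be a quantity `C^{(n)}` which is already
known, and minimal subtraction assigns the principal part of `C^{(n)}` to `Z_MS` and its regular
part to `Z_f` (`BirkhoffStage.exists_next`, `exists_birkhoff`). The inverse of `Z_f` is found by
the same induction (`exists_left_inverse`); by associativity of composition the left inverse is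
two-sided (`exists_inverse`).

*Composition.* Sums over partitions are encoded by polynomials: `partPoly s` is the sum of the
monomials `∏_{B ∈ P} X_B` over the partitions `P` of `s`. It is obtained from `1` by inserting the
points of `s` one after the other, multiplying by `X_{i}` or applying the derivation
`X_B ↦ X_{i, B}`, and composition of formal maps is a linear functional of it
(`hcomp_eq_monLin`). Associativity (`FormalMap.comp_assoc`) becomes the identity
`partThenSplit_partPoly` on partitions of partitions.

*Stability of the renormalization group.* Locality of `Z` is equivalent, by polarization, to
vanishing of `Z^{(n)}(F_1, …, F_n)` if two of the arguments have disjoint supports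
(`LocalMap.offDiagonal`, `OffDiagonal.localMap`). Together with field independence it implies that
the values of `Z` are supported in the intersection of the supports of the arguments
(`Tame.spaceSupport_subset`), so that this property passes to compositions (`Tame.comp`). For
`φ`-locality of compositions one needs that `Z_L` lowers the order of vanishing at `φ` by at most
`2L`, which again follows from field independence (`Equivariant.vanishesTo`); here it is essential
that the functional derivatives of local functionals are local (`dirDeriv_mem_local`).

*Principal parts.* Taking the principal part and evaluating it at `Λ`, or taking the value at `Λ₀`
of the regular part, are linear functionals `ℓ` on germs of meromorphic functions. As a meromorphic
family is locally, on the space of field configurations, a finite combination of local functionals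
with meromorphic coefficients, `ℓ` maps it to a functional which agrees locally with local
functionals and is additive, hence is local (`mem_local_of_locally`, `GermFunctional.onLocal`).
Being linear, `ℓ` preserves field independence, `φ`-locality, covariance and vanishing off the
diagonal (`GermFunctional.tame_onMap`).

*Families.* A `φ`-local map may be evaluated at `φ` by replacing its arguments by functionals which
agree with them close to `φ`, hence by finite combinations with coefficients which depend on `Λ`
(`exists_expansion`). So compositions of meromorphic or regular families are of the same type, and
limits can be taken in each factor (`ExpandsAt.comp`, `meromorphicAt_comp`, `tendsto_comp`).

*S-matrices.* From `S^Λ ∘ Z_MS^Λ = (S^Λ ∘ Z^Λ) ∘ (Z_f^Λ)⁻¹` the limit `S ∘ Z_f⁻¹` exists. It is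
causal, since in `S ∘ Z` the partitions with a block which contains arguments from both groups do
not contribute, and the sum over the remaining ones factorizes (`map_partPoly_add`,
`Causal.comp`). Finally, `Z_MS^{(n)}` has no regular part and its sum with the terms of
`S^Λ ∘ Z_MS^Λ` with more than one block is regular, which is the recursion for `Z_MS`
(`isPrincipalPart_neg`).
-/


noncomputable section

namespace PAQFT

/-! ### Partition polynomials -/

section

open MvPolynomial

/-- The monomial `∏_{v ∈ s} X_v`. -/
def mon {σ : Type*} (s : Multiset σ) : MvPolynomial σ ℂ := (s.map X).prod

/-- The linear map on polynomials whose value at the monomial `∏_{v ∈ s} X_v` is `Φ s`. -/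
def monLin {σ E : Type*} [AddCommGroup E] [Module ℂ E] (Φ : Multiset σ → E) :
    MvPolynomial σ ℂ →ₗ[ℂ] E :=
  (MvPolynomial.basisMonomials σ ℂ).constr ℂ (fun e => Φ (Finsupp.toMultiset e))

theorem mon_toMultiset {σ : Type*} (e : σ →₀ ℕ) :
    mon (Finsupp.toMultiset e) = (monomial e 1 : MvPolynomial σ ℂ) := by
  rw [mon, Finsupp.toMultiset_map, Finsupp.prod_toMultiset, monomial_eq, C_1, one_mul]
  rw [Finsupp.prod_mapDomain_index]
  · exact fun _ => pow_zero _
  · exact fun _ _ _ => pow_add _ _ _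

theorem monLin_mon {σ E : Type*} [AddCommGroup E] [Module ℂ E] (Φ : Multiset σ → E)
    (s : Multiset σ) : monLin Φ (mon s) = Φ s := by
  classical
  obtain ⟨e, rfl⟩ : ∃ e : σ →₀ ℕ, Finsupp.toMultiset e = s :=
    ⟨Multiset.toFinsupp s, Multiset.toFinsupp_toMultiset s⟩
  rw [mon_toMultiset]
  have := (MvPolynomial.basisMonomials σ ℂ).constr_basis ℂ
    (fun e => Φ (Finsupp.toMultiset e)) e
  rwa [coe_basisMonomials] at this

theorem mon_zero {σ : Type*} : mon (0 : Multiset σ) = 1 := by simp [mon]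

theorem mon_cons {σ : Type*} (v : σ) (s : Multiset σ) : mon (v ::ₘ s) = X v * mon s := by
  simp [mon]

theorem mon_add {σ : Type*} (s t : Multiset σ) : mon (s + t) = mon s * mon t := by
  simp [mon]

theorem monLin_ext {σ E : Type*} [AddCommGroup E] [Module ℂ E]
    {f g : MvPolynomial σ ℂ →ₗ[ℂ] E} (h : ∀ s, f (mon s) = g (mon s)) : f = g := by
  refine (MvPolynomial.basisMonomials σ ℂ).ext fun e => ?_
  rw [coe_basisMonomials]
  show f (monomial e 1) = g (monomial e 1)
  rw [← mon_toMultiset]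
  exact h _

theorem rename_mon {σ τ : Type*} (f : σ → τ) (s : Multiset σ) :
    rename f (mon s : MvPolynomial σ ℂ) = mon (s.map f) := by
  simp only [mon, map_multiset_prod, Multiset.map_map, Function.comp_def, rename_X]

/-- The derivation that inserts the point `i` into a block, `X_B ↦ X_{i, B}`. -/
def blockDer {ι : Type*} (i : ι) :
    Derivation ℂ (MvPolynomial (Multiset ι) ℂ) (MvPolynomial (Multiset ι) ℂ) :=
  mkDerivation ℂ (fun B => X (i ::ₘ B))

theorem blockDer_X {ι : Type*} (i : ι) (B : Multiset ι) :
    blockDer i (X B) = X (i ::ₘ B) := mkDerivation_X ..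

/-- Insertion of the point `i` in all possible ways, as a block of its own or into one
of the blocks. -/
def insertPt {ι : Type*} (i : ι) :
    MvPolynomial (Multiset ι) ℂ →ₗ[ℂ] MvPolynomial (Multiset ι) ℂ :=
  LinearMap.mulLeft ℂ (X {i}) + (blockDer i).toLinearMap

theorem insertPt_apply {ι : Type*} (i : ι) (p : MvPolynomial (Multiset ι) ℂ) :
    insertPt i p = X {i} * p + blockDer i p := rfl

theorem blockDer_comm {ι : Type*} (i j : ι) (p : MvPolynomial (Multiset ι) ℂ) :
    blockDer i (blockDer j p) = blockDer j (blockDer i p) := by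
  have h : ⁅blockDer i, blockDer j⁆ = 0 := by
    refine derivation_ext fun B => ?_
    simp only [Derivation.commutator_apply, blockDer_X, Derivation.zero_apply]
    rw [Multiset.cons_swap, sub_self]
  have h2 := congrArg (fun D => D p) h
  simpa [Derivation.commutator_apply, sub_eq_zero] using h2

theorem insertPt_comm {ι : Type*} (i j : ι) (p : MvPolynomial (Multiset ι) ℂ) :
    insertPt i (insertPt j p) = insertPt j (insertPt i p) := by
  simp only [insertPt_apply, map_add, Derivation.leibniz, smul_eq_mul, blockDer_comm i j,
    ← Multiset.cons_zero, blockDer_X, Multiset.cons_swap i j]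
  ring

instance {ι : Type*} : LeftCommutative
    (fun (i : ι) (p : MvPolynomial (Multiset ι) ℂ) => insertPt i p) :=
  ⟨insertPt_comm⟩

/-- The sum of the monomials `∏_{B ∈ P} X_B` over all partitions `P` of `s` into blocks. -/
def partPoly {ι : Type*} (s : Multiset ι) : MvPolynomial (Multiset ι) ℂ :=
  s.foldr (fun i p => insertPt i p) 1

theorem partPoly_zero {ι : Type*} : partPoly (0 : Multiset ι) = 1 := rfl

theorem partPoly_cons {ι : Type*} (i : ι) (s : Multiset ι) :
    partPoly (i ::ₘ s) = insertPt i (partPoly s) :=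
  Multiset.foldr_cons _ _ _ _

theorem rename_insertPt {ι κ : Type*} (f : ι → κ) (i : ι) (p : MvPolynomial (Multiset ι) ℂ) :
    rename (Multiset.map f) (insertPt i p) = insertPt (f i) (rename (Multiset.map f) p) := by
  suffices h : rename (Multiset.map f) (blockDer i p) =
      blockDer (f i) (rename (Multiset.map f) p) by
    simp [insertPt_apply, h]
  induction p using MvPolynomial.induction_on with
  | C a => simp [← algebraMap_eq]
  | add p q hp hq => simp [hp, hq]
  | mul_X p B hp => simp [hp, Derivation.leibniz, blockDer_X]

theorem partPoly_map {ι κ : Type*} (f : ι → κ) (s : Multiset ι) :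
    partPoly (s.map f) = rename (Multiset.map f) (partPoly s) := by
  induction s using Multiset.induction with
  | empty => simp [partPoly_zero]
  | cons i s ih => rw [Multiset.map_cons, partPoly_cons, partPoly_cons, rename_insertPt, ih]

/-- The values of a family, as a multiset. -/
abbrev famVal {α : Type*} {n : ℕ} (x : Fin n → α) : Multiset α := (List.ofFn x : Multiset α)

theorem famVal_succ {α : Type*} {n : ℕ} (x : Fin (n + 1) → α) :
    famVal x = x 0 ::ₘ famVal (fun i => x i.succ) := by
  simp [famVal, List.ofFn_succ]

theorem famVal_map {α β : Type*} {n : ℕ} (f : α → β) (x : Fin n → α) :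
    (famVal x).map f = famVal (fun i => f (x i)) := by
  simp [famVal, Function.comp_def]

theorem mon_famVal {σ : Type*} {n : ℕ} (x : Fin n → σ) :
    mon (famVal x) = ∏ i, X (x i) := by
  rw [mon, famVal_map, famVal, Multiset.prod_coe, List.prod_ofFn]

theorem famVal_cast {α : Type*} {n m : ℕ} (h : n = m) (x : Fin m → α) :
    famVal (fun i => x (Fin.cast h i)) = famVal x := by
  subst h; rfl

/-- The block `I` of the partition `P`, with its points labelled by `x`. -/
def blockVal {α : Type*} {n : ℕ} (P : OrderedFinpartition n) (x : Fin n → α)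
    (I : Fin P.length) : Multiset α := famVal (fun i => x (P.emb I i))

theorem blockDer_prod_X {ι κ : Type*} [DecidableEq κ] (i : ι) (B : κ → Multiset ι)
    (s : Finset κ) :
    blockDer i (∏ I ∈ s, X (B I)) =
      ∑ k ∈ s, ∏ I ∈ s, X (Function.update B k (i ::ₘ B k) I) := by
  induction s using Finset.induction_on with
  | empty => simp
  | insert a s ha ih =>
    have h1 : ∀ k ∈ s, (∏ I ∈ insert a s, X (Function.update B k (i ::ₘ B k) I) :
        MvPolynomial (Multiset ι) ℂ) =
        X (B a) * ∏ I ∈ s, X (Function.update B k (i ::ₘ B k) I) := by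
      intro k hk
      rw [Finset.prod_insert ha, Function.update_of_ne (by rintro rfl; exact ha hk)]
    have h2 : (∏ I ∈ s, X (Function.update B a (i ::ₘ B a) I) : MvPolynomial (Multiset ι) ℂ) =
        ∏ I ∈ s, X (B I) := by
      refine Finset.prod_congr rfl fun I hI => ?_
      rw [Function.update_of_ne (by rintro rfl; exact ha hI)]
    rw [Finset.prod_insert ha, Finset.sum_insert ha, Finset.prod_insert ha, h2,
      Finset.sum_congr rfl h1, ← Finset.mul_sum, ← ih, Derivation.leibniz, blockDer_X,
      Function.update_self]
    simp only [smul_eq_mul]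
    ring

theorem blockVal_extendMiddle {ι : Type*} {n : ℕ} (c : OrderedFinpartition n)
    (x : Fin (n + 1) → ι) (k I : Fin c.length) :
    blockVal (c.extendMiddle k) x I =
      Function.update (blockVal c fun i => x i.succ) k
        (x 0 ::ₘ blockVal c (fun i => x i.succ) k) I := by
  rcases eq_or_ne I k with rfl | h
  · rw [Function.update_self]
    have h1 : (c.extendMiddle I).partSize I = c.partSize I + 1 := by simp
    have h2 : (fun i => x ((c.extendMiddle I).emb I i)) = fun i =>
        (fun j : Fin (c.partSize I + 1) => x (Fin.cases 0 (Fin.succ ∘ c.emb I) j))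
          (Fin.cast h1 i) := by
      funext i
      simp [OrderedFinpartition.extendMiddle]
      rfl
    exact (congrArg famVal h2).trans ((famVal_cast h1
      (fun j : Fin (c.partSize I + 1) => x (Fin.cases 0 (Fin.succ ∘ c.emb I) j))).trans
        (famVal_succ _))
  · rw [Function.update_of_ne h]
    have h1 : (c.extendMiddle k).partSize I = c.partSize I := by simp [h]
    have h2 : (fun i => x ((c.extendMiddle k).emb I i)) = fun i =>
        (fun j : Fin (c.partSize I) => x (c.emb I j).succ) (Fin.cast h1 i) := by
      funext i
      simp [OrderedFinpartition.extendMiddle, h]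
      rfl
    exact (congrArg famVal h2).trans (famVal_cast h1
      (fun j : Fin (c.partSize I) => x (c.emb I j).succ))

theorem famVal_blockVal_extendLeft {ι : Type*} {n : ℕ} (c : OrderedFinpartition n)
    (x : Fin (n + 1) → ι) :
    famVal (blockVal c.extendLeft x) =
      {x 0} ::ₘ famVal (blockVal c fun i => x i.succ) := by
  have h := famVal_succ (n := c.length) (blockVal c.extendLeft x)
  refine h.trans ?_
  congr 1

/-- Mathlib's ordered partitions of `Fin n` enumerate the monomials of the partition
polynomial. -/
theorem partPoly_famVal {ι : Type*} {n : ℕ} (x : Fin n → ι) :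
    partPoly (famVal x) =
      ∑ P : OrderedFinpartition n, mon (famVal (blockVal P x)) := by
  induction n with
  | zero =>
    rw [Fintype.sum_unique]
    have : (default : OrderedFinpartition 0).length = 0 := rfl
    simp [famVal, partPoly_zero, mon_zero]
  | succ n ih =>
    rw [famVal_succ, partPoly_cons, ih, map_sum, ← (OrderedFinpartition.extendEquiv n).sum_comp,
      Fintype.sum_sigma]
    refine Finset.sum_congr rfl fun c _ => ?_
    rw [Fintype.sum_option, insertPt_apply]
    congr 1
    · show _ = mon (famVal (blockVal c.extendLeft x))
      rw [famVal_blockVal_extendLeft, mon_cons]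
    · rw [mon_famVal, blockDer_prod_X]
      refine Finset.sum_congr rfl fun k _ => ?_
      refine Eq.trans ?_ (mon_famVal (blockVal (c.extendMiddle k) x)).symm
      exact Finset.prod_congr rfl fun I _ => congrArg X (blockVal_extendMiddle c x k I).symm

/-! ### Partitions of partitions -/

/-- On blocks of blocks: insertion of `i` into one of the points (which are blocks) of one of
the blocks. -/
def innerDer {ι : Type*} (i : ι) :
    Derivation ℂ (MvPolynomial (Multiset (Multiset ι)) ℂ)
      (MvPolynomial (Multiset (Multiset ι)) ℂ) :=
  mkDerivation ℂ (fun β => monLin (fun γ => X γ) (blockDer i (mon β)))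

/-- A polynomial in blocks, as a linear combination of blocks of blocks. -/
def toBlocks {ι : Type*} :
    MvPolynomial (Multiset ι) ℂ →ₗ[ℂ] MvPolynomial (Multiset (Multiset ι)) ℂ :=
  monLin (fun γ => X γ)

theorem toBlocks_mon {ι : Type*} (γ : Multiset (Multiset ι)) : toBlocks (mon γ) = X γ :=
  monLin_mon _ _

theorem innerDer_X {ι : Type*} (i : ι) (β : Multiset (Multiset ι)) :
    innerDer i (X β) = toBlocks (blockDer i (mon β)) := mkDerivation_X ..

theorem toBlocks_X_mul {ι : Type*} (B : Multiset ι) (p : MvPolynomial (Multiset ι) ℂ) :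
    toBlocks (X B * p) = blockDer B (toBlocks p) := by
  have : toBlocks ∘ₗ LinearMap.mulLeft ℂ (X B) = (blockDer B).toLinearMap ∘ₗ toBlocks := by
    refine monLin_ext fun s => ?_
    simp only [LinearMap.comp_apply, LinearMap.mulLeft_apply, ← mon_cons, toBlocks_mon]
    exact (blockDer_X _ _).symm
  exact congrArg (fun f => f p) this

theorem toBlocks_blockDer {ι : Type*} (i : ι) (p : MvPolynomial (Multiset ι) ℂ) :
    toBlocks (blockDer i p) = innerDer i (toBlocks p) := by
  have : toBlocks ∘ₗ (blockDer i).toLinearMap = (innerDer i).toLinearMap ∘ₗ toBlocks := by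
    refine monLin_ext fun s => ?_
    simp only [LinearMap.comp_apply, toBlocks_mon]
    exact (innerDer_X _ _).symm
  exact congrArg (fun f => f p) this

/-- On blocks of blocks, inserting the block `B` and then the point `i` either leaves them apart
or puts `i` into `B`. -/
theorem innerDer_blockDer {ι : Type*} (i : ι) (B : Multiset ι)
    (p : MvPolynomial (Multiset (Multiset ι)) ℂ) :
    innerDer i (blockDer B p) = blockDer B (innerDer i p) + blockDer (i ::ₘ B) p := by
  have h : ⁅innerDer i, blockDer B⁆ = blockDer (i ::ₘ B) := by
    refine derivation_ext fun β => ?_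
    simp only [Derivation.commutator_apply, blockDer_X, innerDer_X, mon_cons,
      Derivation.leibniz, map_add, smul_eq_mul, toBlocks_X_mul]
    rw [mul_comm, toBlocks_X_mul, toBlocks_mon, blockDer_X]
    ring
  have h2 := congrArg (fun D => D p) h
  simp only [Derivation.commutator_apply] at h2
  rw [← h2]; ring

/-- First group `s` into blocks, then the blocks into blocks of blocks. -/
def partThenGroup {ι : Type*} :
    MvPolynomial (Multiset ι) ℂ →ₗ[ℂ] MvPolynomial (Multiset (Multiset ι)) ℂ :=
  monLin partPoly

/-- First group `s` into blocks, then split each of the blocks. -/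
def partThenSplit {ι : Type*} :
    MvPolynomial (Multiset ι) ℂ →ₐ[ℂ] MvPolynomial (Multiset (Multiset ι)) ℂ :=
  aeval (fun B => toBlocks (partPoly B))

theorem partThenGroup_X_mul {ι : Type*} (B : Multiset ι) (p : MvPolynomial (Multiset ι) ℂ) :
    partThenGroup (X B * p) = insertPt B (partThenGroup p) := by
  have : partThenGroup ∘ₗ LinearMap.mulLeft ℂ (X B) = insertPt B ∘ₗ partThenGroup := by
    refine monLin_ext fun s => ?_
    simp only [LinearMap.comp_apply, LinearMap.mulLeft_apply, ← mon_cons, partThenGroup,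
      monLin_mon, partPoly_cons]
  exact congrArg (fun f => f p) this

theorem innerDer_insertPt {ι : Type*} (i : ι) (B : Multiset ι)
    (p : MvPolynomial (Multiset (Multiset ι)) ℂ) :
    innerDer i (insertPt B p) = insertPt B (innerDer i p) + insertPt (i ::ₘ B) p := by
  have h : innerDer i (X {B}) = X {i ::ₘ B} := by
    have : ({B} : Multiset (Multiset ι)) = B ::ₘ 0 := rfl
    rw [innerDer_X, this, mon_cons, mon_zero, mul_one, blockDer_X]
    have := toBlocks_mon ({i ::ₘ B} : Multiset (Multiset ι))
    rwa [show mon ({i ::ₘ B} : Multiset (Multiset ι)) = X (i ::ₘ B) by simp [mon]] at this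
  simp only [insertPt_apply, map_add, Derivation.leibniz, smul_eq_mul, h, innerDer_blockDer]
  ring

theorem partThenGroup_blockDer {ι : Type*} (i : ι) (p : MvPolynomial (Multiset ι) ℂ) :
    partThenGroup (blockDer i p) = innerDer i (partThenGroup p) := by
  have : partThenGroup ∘ₗ (blockDer i).toLinearMap = (innerDer i).toLinearMap ∘ₗ
      partThenGroup := by
    refine monLin_ext fun s => ?_
    show partThenGroup (blockDer i (mon s)) = innerDer i (partThenGroup (mon s))
    induction s using Multiset.induction with
    | empty =>
      rw [mon_zero, Derivation.map_one_eq_zero, map_zero, ← mon_zero, partThenGroup, monLin_mon,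
        partPoly_zero, Derivation.map_one_eq_zero]
    | cons B s ih =>
      rw [mon_cons, Derivation.leibniz, blockDer_X, smul_eq_mul, smul_eq_mul, map_add,
        partThenGroup_X_mul, mul_comm (mon s), partThenGroup_X_mul, partThenGroup_X_mul, ih,
        innerDer_insertPt]
  exact congrArg (fun f => f p) this

theorem partThenSplit_blockDer {ι : Type*} (i : ι) (p : MvPolynomial (Multiset ι) ℂ) :
    partThenSplit (blockDer i p) =
      blockDer {i} (partThenSplit p) + innerDer i (partThenSplit p) := by
  have hX : ∀ B : Multiset ι, partThenSplit (X B) = toBlocks (partPoly B) :=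
    fun B => aeval_X ..
  induction p using MvPolynomial.induction_on with
  | C a => simp [← algebraMap_eq]
  | add p q hp hq => simp only [map_add, hp, hq]; ring
  | mul_X p B hp =>
    simp only [Derivation.leibniz, map_add, map_mul, smul_eq_mul, hp, blockDer_X, hX,
      partPoly_cons, insertPt_apply, toBlocks_X_mul, toBlocks_blockDer]
    ring

/-- Grouping the blocks of a partition and splitting the blocks of a partition are two ways to
enumerate the same pairs of nested partitions. -/
theorem partThenSplit_partPoly {ι : Type*} (s : Multiset ι) :
    partThenSplit (partPoly s) = partThenGroup (partPoly s) := by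
  induction s using Multiset.induction with
  | empty =>
    have h : partThenGroup (mon (0 : Multiset (Multiset ι))) = 1 :=
      (monLin_mon _ _).trans partPoly_zero
    rw [partPoly_zero, map_one, ← h, mon_zero]
  | cons i s ih =>
    have h : partThenSplit (X {i} : MvPolynomial (Multiset ι) ℂ) = X {{i}} := by
      have : toBlocks (X {i} : MvPolynomial (Multiset ι) ℂ) = X {{i}} := by
        rw [← toBlocks_mon]; simp [mon]
      rw [partThenSplit, aeval_X, ← Multiset.cons_zero, partPoly_cons, partPoly_zero,
        insertPt_apply, Derivation.map_one_eq_zero, mul_one, add_zero, Multiset.cons_zero, this]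
    rw [partPoly_cons, insertPt_apply, map_add, map_add, map_mul, h, partThenSplit_blockDer,
      partThenGroup_X_mul, partThenGroup_blockDer, insertPt_apply, ih]
    ring

end

/-! ### Formal maps on formal power series in `ħ` -/

section

open MvPolynomial

theorem exists_equiv_of_famVal_eq {α : Type*} {n m : ℕ} {x : Fin n → α} {y : Fin m → α}
    (h : famVal x = famVal y) : ∃ σ : Fin n ≃ Fin m, ∀ i, y (σ i) = x i := by
  classical
  have hc : ∀ {k : ℕ} (z : Fin k → α) (a : α),
      Fintype.card {i // z i = a} = (famVal z).count a := by
    intro k z a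
    rw [Fintype.card_subtype, famVal, ← Fin.univ_val_map, Multiset.count_map]
    simp only [eq_comm]
    rfl
  have e : ∀ a, Nonempty ({i // x i = a} ≃ {j // y j = a}) := fun a =>
    Fintype.card_eq.1 (by rw [hc, hc, h])
  refine ⟨Equiv.ofFiberEquiv (f := x) (g := y) (fun a => (e a).some), fun i => ?_⟩
  exact Equiv.ofFiberEquiv_map _ _

theorem famVal_comp_perm {α : Type*} {n : ℕ} (x : Fin n → α) (σ : Equiv.Perm (Fin n)) :
    famVal (fun i => x (σ i)) = famVal x :=
  Quot.sound (Equiv.Perm.ofFn_comp_perm σ x)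

theorem famVal_surj {α : Type*} (s : Multiset α) : ∃ (n : ℕ) (x : Fin n → α), famVal x = s := by
  refine ⟨s.toList.length, s.toList.get, ?_⟩
  rw [famVal, List.ofFn_get, Multiset.coe_toList]

/-- Multiplication of a formal power series by `ħ`. -/
def hShift {E : Type*} [Zero E] (x : ℕ → E) : ℕ → E
  | 0 => 0
  | L + 1 => x L

/-- The constant formal power series. -/
def hConst {E : Type*} [Zero E] (f : E) : ℕ → E := Pi.single 0 f

theorem hConst_zero {E : Type*} [Zero E] (f : E) : hConst f 0 = f := by simp [hConst]

theorem hConst_succ {E : Type*} [Zero E] (f : E) (l : ℕ) : hConst f (l + 1) = 0 := by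
  simp [hConst]

theorem hConst_add_hShift {E : Type*} [AddCommGroup E] (x : ℕ → E) :
    hConst (x 0) + hShift (fun l => x (l + 1)) = x := by
  funext l
  cases l <;> simp [hConst, hShift]

/-- To prove a statement about the order `ħ^L` of an expression in `n` formal power series, it
suffices to consider constant series, sums, and multiplication of one of the series by `ħ`. The
coefficients of the series may be restricted to sets `C i` containing zero. -/
theorem hbar_induction {E : Type*} [AddCommGroup E] {n : ℕ} (C : Fin n → Set E)
    (hC : ∀ i, 0 ∈ C i) (P : ℕ → (Fin n → ℕ → E) → Prop)
    (const : ∀ L (F : Fin n → E), (∀ i, F i ∈ C i) → P L (fun i => hConst (F i)))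
    (add : ∀ L x i u v, P L (Function.update x i u) → P L (Function.update x i v) →
      P L (Function.update x i (u + v)))
    (shift_zero : ∀ x i u, P 0 (Function.update x i (hShift u)))
    (shift : ∀ L x i u, P L (Function.update x i u) →
      P (L + 1) (Function.update x i (hShift u)))
    (L : ℕ) (x : Fin n → ℕ → E) (hx : ∀ i l, x i l ∈ C i) : P L x := by
  classical
  induction L using Nat.strong_induction_on generalizing x with
  | _ L ihL =>
  suffices h : ∀ (t : Finset (Fin n)) (x : Fin n → ℕ → E), (∀ i l, x i l ∈ C i) →
      (∀ i ∉ t, x i = hConst (x i 0)) → P L x from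
    h Finset.univ x hx (fun i hi => absurd (Finset.mem_univ i) hi)
  intro t
  induction t using Finset.induction_on with
  | empty =>
    intro x hx h
    rw [show x = fun i => hConst (x i 0) from funext fun i => h i (Finset.notMem_empty i)]
    exact const L _ fun i => hx i 0
  | insert i t hi ih =>
    intro x hx h
    have hx' : x = Function.update x i (hConst (x i 0) + hShift (fun l => x i (l + 1))) := by
      rw [hConst_add_hShift, Function.update_eq_self]
    have mem : ∀ u : ℕ → E, (∀ l, u l ∈ C i) → ∀ j l, Function.update x i u j l ∈ C j := by
      intro u hu j l
      rcases eq_or_ne j i with rfl | hj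
      · rw [Function.update_self]; exact hu l
      · rw [Function.update_of_ne hj]; exact hx j l
    rw [hx']
    refine add L x i _ _ (ih _ (mem _ ?_) ?_) ?_
    · intro l
      cases l with
      | zero => rw [hConst_zero]; exact hx i 0
      | succ l => rw [hConst_succ]; exact hC i
    · intro j hj
      rcases eq_or_ne j i with rfl | hji
      · rw [Function.update_self, hConst_zero]
      · rw [Function.update_of_ne hji]
        exact h j (by simp [hji, hj])
    · cases L with
      | zero => exact shift_zero x i _
      | succ L => exact shift L x i _ (ihL L (Nat.lt_succ_self L) _ (mem _ fun l => hx i (l + 1)))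

variable {s : ℕ} {Y : Submodule ℂ (Config s → ℂ)}

/-- The ways to distribute the order `L` in `ħ` over a formal map and its `n` arguments. -/
def hIndex (n L : ℕ) : Finset (ℕ × (Fin n → ℕ)) :=
  (Finset.range (L + 1) ×ˢ Fintype.piFinset fun _ => Finset.range (L + 1)).filter
    fun p => p.1 + ∑ i, p.2 i = L

theorem mem_hIndex {n L : ℕ} {p : ℕ × (Fin n → ℕ)} :
    p ∈ hIndex n L ↔ p.1 + ∑ i, p.2 i = L := by
  simp only [hIndex, Finset.mem_filter, Finset.mem_product, Finset.mem_range,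
    Fintype.mem_piFinset, and_iff_right_iff_imp]
  intro h
  refine ⟨by omega, fun i => ?_⟩
  have := Finset.single_le_sum (f := p.2) (fun _ _ => Nat.zero_le _) (Finset.mem_univ i)
  omega

theorem sum_hIndex {M : Type*} [AddCommMonoid M] (n L : ℕ) (f : ℕ → (Fin n → ℕ) → M) :
    ∑ a ∈ Finset.HasAntidiagonal.antidiagonal L,
      ∑ l ∈ Finset.piAntidiag (Finset.univ : Finset (Fin n)) a.2, f a.1 l =
    ∑ p ∈ hIndex n L, f p.1 p.2 := by
  rw [Finset.sum_sigma']
  refine Finset.sum_bij' (fun q _ => (q.1.1, q.2))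
    (fun p _ => ⟨(p.1, ∑ i, p.2 i), p.2⟩) ?_ ?_ ?_ ?_ ?_
  · rintro ⟨⟨a, b⟩, l⟩ h
    simp only [Finset.mem_sigma, Finset.HasAntidiagonal.mem_antidiagonal,
      Finset.mem_piAntidiag] at h
    rw [mem_hIndex]
    rw [← h.1, ← h.2.1]
  · rintro ⟨a, l⟩ h
    rw [mem_hIndex] at h
    simp only [Finset.mem_sigma, Finset.HasAntidiagonal.mem_antidiagonal,
      Finset.mem_piAntidiag]
    exact ⟨h, by simp⟩
  · rintro ⟨⟨a, b⟩, l⟩ h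
    simp only [Finset.mem_sigma, Finset.HasAntidiagonal.mem_antidiagonal,
      Finset.mem_piAntidiag] at h
    simp only [← h.2.1]
  · rintro ⟨a, l⟩ h
    rfl
  · rintro ⟨⟨a, b⟩, l⟩ h
    rfl

/-- The extension of a formal map to arguments which are formal power series in `ħ`. -/
def FormalMap.ext (Z : FormalMap s Y) (n : ℕ) (x : Fin n → ℕ → Local s) (L : ℕ) : Y :=
  ∑ p ∈ hIndex n L, Z.coeff n p.1 (fun i => x i (p.2 i))

theorem update_apply_apply {n : ℕ} {E : Type*} (x : Fin n → ℕ → E) (i : Fin n) (u : ℕ → E)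
    (l : Fin n → ℕ) :
    (fun j => Function.update x i u j (l j)) =
      Function.update (fun j => x j (l j)) i (u (l i)) := by
  funext j
  rcases eq_or_ne j i with rfl | hj
  · simp
  · simp [hj]

theorem FormalMap.ext_update_add (Z : FormalMap s Y) {n : ℕ} (x : Fin n → ℕ → Local s)
    (i : Fin n) (u v : ℕ → Local s) :
    Z.ext n (Function.update x i (u + v)) =
      Z.ext n (Function.update x i u) + Z.ext n (Function.update x i v) := by
  funext L
  simp only [FormalMap.ext, update_apply_apply, Pi.add_apply, MultilinearMap.map_update_add,
    Finset.sum_add_distrib]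

theorem FormalMap.ext_update_smul (Z : FormalMap s Y) {n : ℕ} (x : Fin n → ℕ → Local s)
    (i : Fin n) (c : ℂ) (u : ℕ → Local s) :
    Z.ext n (Function.update x i (c • u)) = c • Z.ext n (Function.update x i u) := by
  funext L
  simp only [FormalMap.ext, update_apply_apply, Pi.smul_apply, MultilinearMap.map_update_smul,
    Finset.smul_sum]

theorem FormalMap.ext_update_hShift (Z : FormalMap s Y) {n : ℕ} (x : Fin n → ℕ → Local s)
    (i : Fin n) (u : ℕ → Local s) :
    Z.ext n (Function.update x i (hShift u)) = hShift (Z.ext n (Function.update x i u)) := by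
  funext L
  simp only [FormalMap.ext, update_apply_apply]
  cases L with
  | zero =>
    refine Finset.sum_eq_zero fun p hp => ?_
    rw [mem_hIndex] at hp
    have := Finset.single_le_sum (f := p.2) (fun _ _ => Nat.zero_le _) (Finset.mem_univ i)
    rw [show p.2 i = 0 by omega]
    exact MultilinearMap.map_update_zero _ _ _
  | succ L =>
    show _ = ∑ p ∈ hIndex n L, _
    symm
    refine Finset.sum_of_injOn (fun p => (p.1, p.2 + Pi.single i 1)) ?_ ?_ ?_ ?_
    · rintro ⟨a, l⟩ - ⟨b, l'⟩ - h
      simp only [Prod.mk.injEq, add_left_inj] at h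
      rw [h.1, h.2]
    · rintro ⟨a, l⟩ h
      rw [Finset.mem_coe, mem_hIndex] at h ⊢
      simp only [Pi.add_apply, Finset.sum_add_distrib, Finset.sum_pi_single', Finset.mem_univ,
        if_true]
      simp only at h
      omega
    · rintro ⟨a, l⟩ h hl
      rw [mem_hIndex] at h
      have : l i = 0 := by
        by_contra h0
        refine hl ⟨(a, l - Pi.single i 1), ?_, ?_⟩
        · rw [Finset.mem_coe, mem_hIndex]
          have h1 : l = (l - Pi.single i 1) + Pi.single i 1 := by
            funext j
            rcases eq_or_ne j i with rfl | hj
            · simp; omega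
            · simp [hj]
          have h2 : ∑ j, l j = ∑ j, (l - Pi.single i 1 : Fin n → ℕ) j + 1 := by
            conv_lhs => rw [h1]
            simp only [Pi.add_apply, Finset.sum_add_distrib, Finset.sum_pi_single',
              Finset.mem_univ, if_true]
          simp only at h ⊢
          omega
        · ext j
          · rfl
          rcases eq_or_ne j i with rfl | hj
          · simp; omega
          · simp [hj]
      simp only [this]
      exact MultilinearMap.map_update_zero _ _ _
    · rintro ⟨a, l⟩ -
      simp only
      congr 1
      funext j
      rcases eq_or_ne j i with rfl | hj
      · simp [hShift]
      · simp [hj]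

theorem FormalMap.ext_perm (Z : FormalMap s Y) {n : ℕ} (x : Fin n → ℕ → Local s)
    (σ : Equiv.Perm (Fin n)) : Z.ext n (fun i => x (σ i)) = Z.ext n x := by
  funext L
  simp only [FormalMap.ext]
  refine Finset.sum_bij' (fun p _ => (p.1, fun i => p.2 (σ.symm i)))
    (fun p _ => (p.1, fun i => p.2 (σ i))) ?_ ?_ ?_ ?_ ?_
  · rintro ⟨a, l⟩ h
    rw [mem_hIndex] at h ⊢
    rw [← h]
    simp only
    rw [Equiv.sum_comp σ.symm l]
  · rintro ⟨a, l⟩ h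
    rw [mem_hIndex] at h ⊢
    rw [← h]
    simp only
    rw [Equiv.sum_comp σ l]
  · rintro ⟨a, l⟩ h
    simp
  · rintro ⟨a, l⟩ h
    simp
  · rintro ⟨a, l⟩ h
    simp only
    rw [← Z.symm n a σ (fun i => x i (l (σ.symm i)))]
    simp

theorem FormalMap.ext_hConst (Z : FormalMap s Y) {n : ℕ} (F : Fin n → Local s) (L : ℕ) :
    Z.ext n (fun i => hConst (F i)) L = Z.coeff n L F := by
  rw [FormalMap.ext, Finset.sum_eq_single (L, 0)]
  · simp only [Pi.zero_apply, hConst_zero]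
  · rintro ⟨a, l⟩ h h0
    rw [mem_hIndex] at h
    obtain ⟨i, hi⟩ : ∃ i, l i ≠ 0 := by
      by_contra hcon
      push Not at hcon
      apply h0
      have : l = 0 := funext hcon
      subst this
      simpa using h
    refine MultilinearMap.map_coord_zero _ i ?_
    obtain ⟨k, hk⟩ := Nat.exists_eq_succ_of_ne_zero hi
    simp only [hk, Nat.succ_eq_add_one, hConst_succ]
  · intro h
    simp [mem_hIndex] at h

theorem FormalMap.ext_congr_famVal (Z : FormalMap s Y) {n m : ℕ} {x : Fin n → ℕ → Local s}
    {y : Fin m → ℕ → Local s} (h : famVal x = famVal y) : Z.ext n x = Z.ext m y := by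
  obtain ⟨σ, hσ⟩ := exists_equiv_of_famVal_eq h
  have hnm : n = m := by simpa using Fintype.card_congr σ
  subst hnm
  rw [← Z.ext_perm y σ]
  congr 1
  exact funext fun i => (hσ i).symm

/-- A formal map as a function of the multiset of its arguments. -/
def FormalMap.onMultiset (Z : FormalMap s Y) (t : Multiset (ℕ → Local s)) : ℕ → Y :=
  Z.ext t.toList.length t.toList.get

theorem FormalMap.onMultiset_famVal (Z : FormalMap s Y) {n : ℕ} (x : Fin n → ℕ → Local s) :
    Z.onMultiset (famVal x) = Z.ext n x :=
  Z.ext_congr_famVal (by rw [famVal, List.ofFn_get, Multiset.coe_toList])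

theorem FormalMap.onMultiset_cons (Z : FormalMap s Y) {n : ℕ} (u : ℕ → Local s)
    (x : Fin n → ℕ → Local s) :
    Z.onMultiset (u ::ₘ famVal x) =
      Z.ext (n + 1) (Function.update (Fin.cons (0 : ℕ → Local s) x) 0 u) := by
  rw [← Z.onMultiset_famVal, famVal_succ]
  congr 2

/-- A formal map as a linear function of one of its arguments. -/
def FormalMap.consLin (Z : FormalMap s Y) (t : Multiset (ℕ → Local s)) :
    (ℕ → Local s) →ₗ[ℂ] (ℕ → Y) where
  toFun u := Z.onMultiset (u ::ₘ t)
  map_add' u v := by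
    obtain ⟨n, x, rfl⟩ := famVal_surj t
    simp only [Z.onMultiset_cons, Z.ext_update_add]
  map_smul' c u := by
    obtain ⟨n, x, rfl⟩ := famVal_surj t
    simp only [Z.onMultiset_cons, Z.ext_update_smul, RingHom.id_apply]

/-! ### Composition -/

theorem update_emb {α : Type*} {n : ℕ} (P : OrderedFinpartition n) (x : Fin n → α) (i : Fin n)
    (u : α) (I : Fin P.length) (h : I ≠ P.index i) :
    (fun j => Function.update x i u (P.emb I j)) = fun j => x (P.emb I j) := by
  funext j
  refine Function.update_of_ne ?_ _ _
  conv_rhs => rw [← P.emb_invEmbedding i]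
  exact P.emb_ne_emb_of_ne h

theorem update_emb_index {α : Type*} {n : ℕ} (P : OrderedFinpartition n) (x : Fin n → α)
    (i : Fin n) (u : α) :
    (fun j => Function.update x i u (P.emb (P.index i) j)) =
      Function.update (fun j => x (P.emb (P.index i) j)) (P.invEmbedding i) u := by
  funext j
  rcases eq_or_ne j (P.invEmbedding i) with rfl | h
  · simp
  · rw [Function.update_of_ne h, Function.update_of_ne]
    intro h'
    apply h
    apply (P.emb_strictMono (P.index i)).injective
    rw [h', P.emb_invEmbedding]

/-- The values of a function of blocks, when one of the points is changed. -/
theorem blockFun_update {α β : Type*} {n : ℕ} (P : OrderedFinpartition n)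
    (f : (I : Fin P.length) → (Fin (P.partSize I) → α) → β) (x : Fin n → α) (i : Fin n)
    (u : α) :
    (fun I => f I (fun j => Function.update x i u (P.emb I j))) =
      Function.update (fun I => f I (fun j => x (P.emb I j))) (P.index i)
        (f (P.index i) (Function.update (fun j => x (P.emb (P.index i) j))
          (P.invEmbedding i) u)) := by
  funext I
  rcases eq_or_ne I (P.index i) with rfl | h
  · rw [Function.update_self, update_emb_index]
  · rw [Function.update_of_ne h, update_emb P x i u I h]

/-- The contribution of one partition to a composition, on formal power series in `ħ`. -/
def hpart (S : FormalMap s Y) (Z : FormalMap s (Local s)) {n : ℕ} (P : OrderedFinpartition n)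
    (x : Fin n → ℕ → Local s) : ℕ → Y :=
  S.ext P.length (fun I => Z.ext (P.partSize I) (fun j => x (P.emb I j)))

/-- Composition of formal maps, on formal power series in `ħ`. -/
def hcomp (S : FormalMap s Y) (Z : FormalMap s (Local s)) {n : ℕ}
    (x : Fin n → ℕ → Local s) : ℕ → Y :=
  ∑ P : OrderedFinpartition n, hpart S Z P x

theorem partTerm_eq_hpart (S : FormalMap s Y) (Z : FormalMap s (Local s)) {n : ℕ}
    (P : OrderedFinpartition n) (L : ℕ) (F : Fin n → Local s) :
    partTerm S Z P L F = hpart S Z P (fun i => hConst (F i)) L := by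
  simp only [hpart, FormalMap.ext, partTerm]
  rw [sum_hIndex P.length L (fun a l => S.coeff P.length a
    (fun I => Z.coeff (P.partSize I) (l I) (fun i => F (P.emb I i))))]
  refine Finset.sum_congr rfl fun p _ => ?_
  congr 1
  funext I
  exact (Z.ext_hConst _ _).symm

theorem compCoeff_eq_hcomp (S : FormalMap s Y) (Z : FormalMap s (Local s)) (n L : ℕ)
    (F : Fin n → Local s) : compCoeff S Z n L F = hcomp S Z (fun i => hConst (F i)) L := by
  simp only [compCoeff, hcomp, Finset.sum_apply, partTerm_eq_hpart]

theorem hpart_update_add (S : FormalMap s Y) (Z : FormalMap s (Local s)) {n : ℕ}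
    (P : OrderedFinpartition n) (x : Fin n → ℕ → Local s) (i : Fin n) (u v : ℕ → Local s) :
    hpart S Z P (Function.update x i (u + v)) =
      hpart S Z P (Function.update x i u) + hpart S Z P (Function.update x i v) := by
  simp only [hpart, blockFun_update P (fun I y => Z.ext (P.partSize I) y), Z.ext_update_add,
    S.ext_update_add]

theorem hpart_update_smul (S : FormalMap s Y) (Z : FormalMap s (Local s)) {n : ℕ}
    (P : OrderedFinpartition n) (x : Fin n → ℕ → Local s) (i : Fin n) (c : ℂ)
    (u : ℕ → Local s) :
    hpart S Z P (Function.update x i (c • u)) = c • hpart S Z P (Function.update x i u) := by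
  simp only [hpart, blockFun_update P (fun I y => Z.ext (P.partSize I) y), Z.ext_update_smul,
    S.ext_update_smul]

theorem hpart_update_hShift (S : FormalMap s Y) (Z : FormalMap s (Local s)) {n : ℕ}
    (P : OrderedFinpartition n) (x : Fin n → ℕ → Local s) (i : Fin n) (u : ℕ → Local s) :
    hpart S Z P (Function.update x i (hShift u)) =
      hShift (hpart S Z P (Function.update x i u)) := by
  simp only [hpart, blockFun_update P (fun I y => Z.ext (P.partSize I) y), Z.ext_update_hShift,
    S.ext_update_hShift]

theorem hcomp_update_add (S : FormalMap s Y) (Z : FormalMap s (Local s)) {n : ℕ}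
    (x : Fin n → ℕ → Local s) (i : Fin n) (u v : ℕ → Local s) :
    hcomp S Z (Function.update x i (u + v)) =
      hcomp S Z (Function.update x i u) + hcomp S Z (Function.update x i v) := by
  simp only [hcomp, hpart_update_add, Finset.sum_add_distrib]

theorem hcomp_update_smul (S : FormalMap s Y) (Z : FormalMap s (Local s)) {n : ℕ}
    (x : Fin n → ℕ → Local s) (i : Fin n) (c : ℂ) (u : ℕ → Local s) :
    hcomp S Z (Function.update x i (c • u)) = c • hcomp S Z (Function.update x i u) := by
  simp only [hcomp, hpart_update_smul, Finset.smul_sum]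

theorem hShift_apply_sum {E ι : Type*} [AddCommMonoid E] (t : Finset ι) (f : ι → ℕ → E) :
    hShift (∑ i ∈ t, f i) = ∑ i ∈ t, hShift (f i) := by
  funext L
  cases L <;> simp [hShift, Finset.sum_apply]

theorem hcomp_update_hShift (S : FormalMap s Y) (Z : FormalMap s (Local s)) {n : ℕ}
    (x : Fin n → ℕ → Local s) (i : Fin n) (u : ℕ → Local s) :
    hcomp S Z (Function.update x i (hShift u)) =
      hShift (hcomp S Z (Function.update x i u)) := by
  simp only [hcomp, hpart_update_hShift, hShift_apply_sum]

/-- Composition as a linear functional of the partition polynomial of the arguments. -/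
theorem hcomp_eq_monLin (S : FormalMap s Y) (Z : FormalMap s (Local s)) {n : ℕ}
    (x : Fin n → ℕ → Local s) :
    hcomp S Z x = monLin (fun β => S.onMultiset (β.map Z.onMultiset)) (partPoly (famVal x)) := by
  rw [partPoly_famVal, map_sum]
  refine Finset.sum_congr rfl fun P _ => ?_
  rw [monLin_mon, famVal_map, S.onMultiset_famVal]
  simp only [blockVal, Z.onMultiset_famVal]
  rfl

theorem hConst_update_add {E : Type*} [AddCommGroup E] {n : ℕ} (F : Fin n → E) (i : Fin n)
    (u v : E) : (fun j => hConst (Function.update F i (u + v) j)) =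
      Function.update (fun j => hConst (F j)) i (hConst u + hConst v) := by
  funext j
  rcases eq_or_ne j i with rfl | h
  · simp [hConst, Pi.single_add]
  · simp [h]

theorem hConst_update {E : Type*} [Zero E] {n : ℕ} (F : Fin n → E) (i : Fin n)
    (u : E) : (fun j => hConst (Function.update F i u j)) =
      Function.update (fun j => hConst (F j)) i (hConst u) := by
  funext j
  rcases eq_or_ne j i with rfl | h
  · simp
  · simp [h]

/-- The composition `S ∘ Z`. -/
def FormalMap.comp (S : FormalMap s Y) (Z : FormalMap s (Local s)) : FormalMap s Y where
  coeff n L :=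
    { toFun := fun F => compCoeff S Z n L F
      map_update_add' := by
        intro inst F i u v
        obtain rfl : inst = instDecidableEqFin n := Subsingleton.elim _ _
        simp only [compCoeff_eq_hcomp, hConst_update_add, hcomp_update_add, Pi.add_apply,
          hConst_update]
      map_update_smul' := by
        intro inst F i c u
        obtain rfl : inst = instDecidableEqFin n := Subsingleton.elim _ _
        have : hConst (c • u) = c • hConst u := by
          funext l; cases l <;> simp [hConst]
        simp only [compCoeff_eq_hcomp, this, hcomp_update_smul, Pi.smul_apply,
          hConst_update] }
  symm n L σ F := by
    show compCoeff S Z n L _ = compCoeff S Z n L F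
    simp only [compCoeff_eq_hcomp, hcomp_eq_monLin]
    rw [famVal_comp_perm (fun i => hConst (F i)) σ]

theorem FormalMap.comp_coeff (S : FormalMap s Y) (Z : FormalMap s (Local s)) (n L : ℕ)
    (F : Fin n → Local s) : (S.comp Z).coeff n L F = compCoeff S Z n L F := rfl

theorem FormalMap.comp_ext (S : FormalMap s Y) (Z : FormalMap s (Local s)) {n : ℕ}
    (x : Fin n → ℕ → Local s) : (S.comp Z).ext n x = hcomp S Z x := by
  funext L
  refine hbar_induction (fun _ => Set.univ) (fun _ => trivial)
    (fun L x => (S.comp Z).ext n x L = hcomp S Z x L) ?_ ?_ ?_ ?_ L x (fun _ _ => trivial)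
  · intro L F _
    rw [FormalMap.ext_hConst, FormalMap.comp_coeff, compCoeff_eq_hcomp]
  · intro L x i u v hu hv
    simp only [FormalMap.ext_update_add, hcomp_update_add, Pi.add_apply, hu, hv]
  · intro x i u
    simp only [FormalMap.ext_update_hShift, hcomp_update_hShift]
    rfl
  · intro L x i u h
    simp only [FormalMap.ext_update_hShift, hcomp_update_hShift]
    exact h

theorem FormalMap.comp_onMultiset (S : FormalMap s Y) (Z : FormalMap s (Local s))
    (t : Multiset (ℕ → Local s)) :
    (S.comp Z).onMultiset t =
      monLin (fun β => S.onMultiset (β.map Z.onMultiset)) (partPoly t) := by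
  obtain ⟨n, x, rfl⟩ := famVal_surj t
  rw [FormalMap.onMultiset_famVal, FormalMap.comp_ext, hcomp_eq_monLin]

/-- Multilinearity of `S`, for arguments which are linear combinations given by polynomials `p`:
`monLin ζ p` replaces each monomial of `p` by the value of `ζ`, and on the other side the monomials
of `p` are turned into blocks, which are multiplied out. -/
theorem monLin_prod_toBlocks {ι : Type*} (S : FormalMap s Y)
    (ζ : Multiset ι → ℕ → Local s) (ps : Multiset (MvPolynomial ι ℂ))
    (β : Multiset (Multiset ι)) :
    monLin (fun γ => S.onMultiset (γ.map ζ))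
        (mon β * (ps.map (monLin (fun γ => X γ))).prod) =
      S.onMultiset (β.map ζ + ps.map (monLin ζ)) := by
  induction ps using Multiset.induction generalizing β with
  | empty => simp [monLin_mon]
  | cons p ps ih =>
    have key : (monLin (fun γ => S.onMultiset (γ.map ζ))) ∘ₗ
          LinearMap.mulLeft ℂ (mon β * (ps.map (monLin (fun γ => X γ))).prod) ∘ₗ
          (monLin (fun γ => X γ) : MvPolynomial ι ℂ →ₗ[ℂ] _) =
        S.consLin (β.map ζ + ps.map (monLin ζ)) ∘ₗ monLin ζ := by
      refine monLin_ext fun γ => ?_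
      simp only [LinearMap.comp_apply, LinearMap.mulLeft_apply, monLin_mon]
      rw [mul_right_comm, mul_comm (mon β), ← mon_cons, ih, Multiset.map_cons,
        Multiset.cons_add]
      rfl
    have := congrArg (fun f => f p) key
    simp only [LinearMap.comp_apply, LinearMap.mulLeft_apply] at this
    rw [Multiset.map_cons, Multiset.prod_cons, Multiset.map_cons, Multiset.add_cons,
      mul_comm (monLin _ p), ← mul_assoc, this]
    rfl

/-- Composition of formal maps is associative. -/
theorem FormalMap.comp_assoc (S : FormalMap s Y) (Z W : FormalMap s (Local s)) (n L : ℕ)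
    (F : Fin n → Local s) :
    compCoeff (S.comp Z) W n L F = compCoeff S (Z.comp W) n L F := by
  rw [compCoeff_eq_hcomp, compCoeff_eq_hcomp, hcomp_eq_monLin, hcomp_eq_monLin]
  generalize famVal (fun i => hConst (F i)) = t
  set Ψ : MvPolynomial (Multiset (Multiset (ℕ → Local s))) ℂ →ₗ[ℂ] (ℕ → Y) :=
    monLin (fun γ => S.onMultiset (γ.map fun B => Z.onMultiset (B.map W.onMultiset))) with hΨ
  have h1 : monLin (fun β => (S.comp Z).onMultiset (β.map W.onMultiset)) =
      Ψ ∘ₗ partThenGroup := by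
    refine monLin_ext fun β => ?_
    rw [monLin_mon, LinearMap.comp_apply, partThenGroup, monLin_mon, FormalMap.comp_onMultiset,
      partPoly_map]
    have : (monLin fun β => S.onMultiset (β.map Z.onMultiset)) ∘ₗ
        (rename (Multiset.map W.onMultiset)).toLinearMap = Ψ := by
      refine monLin_ext fun γ => ?_
      rw [hΨ, monLin_mon, LinearMap.comp_apply, AlgHom.toLinearMap_apply, rename_mon, monLin_mon,
        Multiset.map_map]
      rfl
    rw [← this]
    rfl
  have h2 : monLin (fun β => S.onMultiset (β.map (Z.comp W).onMultiset)) =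
      Ψ ∘ₗ partThenSplit.toLinearMap := by
    refine monLin_ext fun β => ?_
    rw [monLin_mon, LinearMap.comp_apply, AlgHom.toLinearMap_apply]
    have h3 := monLin_prod_toBlocks S (fun B => Z.onMultiset (B.map W.onMultiset))
      (β.map partPoly) 0
    rw [mon_zero, one_mul, Multiset.map_zero, zero_add, Multiset.map_map, Multiset.map_map] at h3
    have h4 : partThenSplit (mon β) = (β.map (monLin (fun γ => X γ) ∘ partPoly)).prod := by
      simp only [mon, map_multiset_prod, Multiset.map_map, partThenSplit]
      congr 1
      refine Multiset.map_congr rfl fun B _ => ?_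
      exact aeval_X ..
    rw [h4, hΨ, h3]
    congr 1
    refine Multiset.map_congr rfl fun B _ => ?_
    exact FormalMap.comp_onMultiset Z W B
  rw [h1, h2, LinearMap.comp_apply, LinearMap.comp_apply, ← partThenSplit_partPoly]
  rfl

end

/-! ### The extreme partitions and the unit laws -/

section

open MvPolynomial

/-- The partition of `Fin n` with a single block. -/
def singleBlock {n : ℕ} (hn : 0 < n) : OrderedFinpartition n where
  length := 1
  partSize _ := n
  partSize_pos _ := hn
  emb _ i := i
  emb_strictMono _ := strictMono_id
  parts_strictMono := Subsingleton.strictMono _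
  disjoint i _ j _ h := absurd (Subsingleton.elim i j) h
  cover x := ⟨0, x, rfl⟩

theorem sum_partSize {n : ℕ} (P : OrderedFinpartition n) : ∑ I, P.partSize I = n := by
  have := Fintype.card_congr P.equivSigma
  simpa using this

theorem exists_one_lt_partSize {n : ℕ} (P : OrderedFinpartition n) (h : P.length < n) :
    ∃ I, 1 < P.partSize I := by
  by_contra hcon
  push Not at hcon
  have : ∑ I, P.partSize I ≤ ∑ _I : Fin P.length, 1 := Finset.sum_le_sum fun I _ => hcon I
  rw [sum_partSize] at this
  simp at this
  omega

theorem partSize_lt {n : ℕ} (P : OrderedFinpartition n) (h : 1 < P.length)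
    (I : Fin P.length) : P.partSize I < n := by
  have : Nontrivial (Fin P.length) := Fin.nontrivial_iff_two_le.2 h
  obtain ⟨J, hJ⟩ := exists_ne I
  have h1 := sum_partSize P
  rw [← Finset.add_sum_erase _ _ (Finset.mem_univ I)] at h1
  have h2 := Finset.single_le_sum (f := P.partSize) (fun _ _ => Nat.zero_le _)
    (Finset.mem_erase.2 ⟨hJ, Finset.mem_univ J⟩)
  have := P.partSize_pos J
  omega

theorem strictMono_fin_eq_id {n : ℕ} {f : Fin n → Fin n} (hf : StrictMono f) : f = id := by
  have := Subsingleton.elim (OrderIso.ofSurjective (OrderEmbedding.ofStrictMono f hf)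
    (Finite.surjective_of_injective hf.injective)) (OrderIso.refl (Fin n))
  funext i
  exact congrArg (fun e : Fin n ≃o Fin n => e i) this

theorem eq_singleBlock {n : ℕ} (hn : 0 < n) (P : OrderedFinpartition n) (h : P.length = 1) :
    P = singleBlock hn := by
  have hs := sum_partSize P
  rcases P with ⟨length, partSize, hpos, emb, hemb, hparts, hdis, hcov⟩
  dsimp only at h hs
  subst h
  obtain rfl : partSize = fun _ => n := by
    funext i
    rw [Fin.eq_zero i]
    simpa using hs
  have : ∀ i, emb i = id := fun i => strictMono_fin_eq_id (hemb i)
  obtain rfl : emb = fun _ i => i := funext this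
  rfl

/-- The partition of `Fin n` into singletons is the only one with `n` blocks. -/
theorem eq_atomic {n : ℕ} (P : OrderedFinpartition n) (h : P.length = n) :
    P = OrderedFinpartition.atomic n := by
  have hs := sum_partSize P
  rcases P with ⟨length, partSize, hpos, emb, hemb, hparts, hdis, hcov⟩
  dsimp only at h hs
  subst h
  obtain rfl : partSize = fun _ => 1 := by
    have h1 : ∑ i : Fin length, 1 = ∑ i, partSize i := by simp [hs]
    have h2 := (Finset.sum_eq_sum_iff_of_le (fun i _ => hpos i)).1 h1
    funext i
    exact (h2 i (Finset.mem_univ i)).symm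
  have h1 := strictMono_fin_eq_id hparts
  obtain rfl : emb = fun m _ => m := by
    funext m j
    rw [Subsingleton.elim j ⟨0, Nat.one_pos⟩]
    exact congrFun h1 m
  rfl

variable {s : ℕ} {Y : Submodule ℂ (Config s → ℂ)}

theorem partTerm_eq_zero_of_left (S : FormalMap s Y) (Z : FormalMap s (Local s)) {n : ℕ}
    (P : OrderedFinpartition n) (h : ∀ L F, S.coeff P.length L F = 0) (L : ℕ)
    (F : Fin n → Local s) : partTerm S Z P L F = 0 := by
  simp only [partTerm, h, Finset.sum_const_zero]

theorem partTerm_eq_zero_of_right (S : FormalMap s Y) (Z : FormalMap s (Local s)) {n : ℕ}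
    (P : OrderedFinpartition n) (I : Fin P.length) (h : ∀ L F, Z.coeff (P.partSize I) L F = 0)
    (L : ℕ) (F : Fin n → Local s) : partTerm S Z P L F = 0 := by
  simp only [partTerm]
  refine Finset.sum_eq_zero fun a _ => Finset.sum_eq_zero fun l _ => ?_
  exact MultilinearMap.map_coord_zero _ I (h _ _)

theorem FirstIsId.coeff_eq {Z : FormalMap s (Local s)} (hZ : FirstIsId Z) (L : ℕ)
    (F : Fin 1 → Local s) : Z.coeff 1 L F = if L = 0 then F 0 else 0 := by
  refine Subtype.ext (funext fun φ => ?_)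
  rw [hZ]
  split_ifs <;> rfl

theorem partTerm_atomic (S : FormalMap s Y) {Z : FormalMap s (Local s)} (hZ : FirstIsId Z)
    {n : ℕ} (L : ℕ) (F : Fin n → Local s) :
    partTerm S Z (OrderedFinpartition.atomic n) L F = S.coeff n L F := by
  rw [partTerm_eq_hpart, ← S.ext_hConst]
  show S.ext n _ L = _
  congr 1
  funext I l
  show Z.ext 1 (fun j => hConst ((fun _ : Fin 1 => F I) j)) l = _
  rw [Z.ext_hConst, hZ.coeff_eq]
  cases l <;> simp [hConst]

theorem partTerm_singleBlock {S : FormalMap s Y} (hS : FirstIsId S) (Z : FormalMap s (Local s))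
    {n : ℕ} (hn : 0 < n) (L : ℕ) (F : Fin n → Local s) (φ : Config s) :
    (partTerm S Z (singleBlock hn) L F).1 φ = (Z.coeff n L F).1 φ := by
  rw [partTerm_eq_hpart]
  show ((S.ext 1 (fun _ => Z.ext n (fun j => hConst (F j))) L).1 φ) = _
  rw [FormalMap.ext, Finset.sum_eq_single (0, fun _ => L)]
  · rw [hS, if_pos rfl, Z.ext_hConst]
  · rintro ⟨a, l⟩ h h0
    rw [mem_hIndex] at h
    have : a ≠ 0 := by
      rintro rfl
      apply h0
      simp only [Finset.univ_unique, Fin.default_eq_zero, Fin.isValue, Finset.sum_singleton,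
        zero_add] at h
      ext j
      · rfl
      · rw [Fin.eq_zero j]; exact h
    refine Subtype.ext (funext fun φ => ?_)
    rw [hS, if_neg this]
    rfl
  · intro h
    simp [mem_hIndex] at h

theorem partTerm_singleBlock' {S : FormalMap s (Local s)} (hS : FirstIsId S)
    (Z : FormalMap s (Local s)) {n : ℕ} (hn : 0 < n) (L : ℕ) (F : Fin n → Local s) :
    partTerm S Z (singleBlock hn) L F = Z.coeff n L F :=
  Subtype.ext (funext fun φ => partTerm_singleBlock hS Z hn L F φ)

/-- Separation of the partition into one block. -/
theorem compCoeff_eq_single_add (S : FormalMap s Y) (Z : FormalMap s (Local s)) {n : ℕ}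
    (hn : 0 < n) (L : ℕ) (F : Fin n → Local s) :
    compCoeff S Z n L F = partTerm S Z (singleBlock hn) L F +
      ∑ P : OrderedFinpartition n with 1 < P.length, partTerm S Z P L F := by
  classical
  rw [compCoeff, ← Finset.sum_filter_add_sum_filter_not Finset.univ (fun P => 1 < P.length),
    add_comm]
  congr 1
  rw [Finset.sum_eq_single_of_mem (singleBlock hn)]
  · simp [singleBlock]
  · intro P hP hne
    rw [Finset.mem_filter] at hP
    have := P.length_pos hn
    exact absurd (eq_singleBlock hn P (by omega)) hne

/-- Separation of the two extreme partitions. -/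
theorem compCoeff_eq_single_add_atomic (S : FormalMap s Y) (Z : FormalMap s (Local s)) {n : ℕ}
    (hn : 2 ≤ n) (L : ℕ) (F : Fin n → Local s) :
    compCoeff S Z n L F = partTerm S Z (singleBlock (by omega)) L F +
      (partTerm S Z (OrderedFinpartition.atomic n) L F +
      ∑ P : OrderedFinpartition n with 1 < P.length ∧ P.length < n, partTerm S Z P L F) := by
  classical
  rw [compCoeff_eq_single_add S Z (by omega : 0 < n)]
  congr 1
  rw [← Finset.add_sum_erase _ _ (a := OrderedFinpartition.atomic n)]
  · congr 1
    refine Finset.sum_congr (Finset.ext fun P => ?_) fun _ _ => rfl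
    simp only [Finset.mem_erase, Finset.mem_filter, Finset.mem_univ, true_and]
    constructor
    · rintro ⟨h1, h2⟩
      refine ⟨h2, lt_of_le_of_ne P.length_le fun h => h1 (eq_atomic P h)⟩
    · rintro ⟨h1, h2⟩
      refine ⟨?_, h1⟩
      rintro rfl
      simp at h2
  · simp only [Finset.mem_filter, Finset.mem_univ, true_and, OrderedFinpartition.atomic_length]
    omega

theorem compCoeff_zero (S : FormalMap s Y) (Z : FormalMap s (Local s)) (L : ℕ)
    (F : Fin 0 → Local s) : compCoeff S Z 0 L F = S.coeff 0 L F := by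
  rw [compCoeff_eq_hcomp, hcomp, Fintype.sum_unique, ← S.ext_hConst]
  show S.ext 0 _ L = _
  congr 1
  exact Subsingleton.elim _ _

theorem compCoeff_one (S : FormalMap s Y) {Z : FormalMap s (Local s)} (hZ : FirstIsId Z) (L : ℕ)
    (F : Fin 1 → Local s) : compCoeff S Z 1 L F = S.coeff 1 L F := by
  rw [compCoeff, Fintype.sum_unique]
  exact partTerm_atomic S hZ L F

/-- The identity, as a formal map. -/
def FormalMap.one (s : ℕ) : FormalMap s (Local s) where
  coeff n L :=
    { toFun := fun F => if h : n = 1 ∧ L = 0 then F ⟨0, by omega⟩ else 0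
      map_update_add' := by
        intro inst F i u v
        split_ifs with h
        · obtain ⟨rfl, -⟩ := h
          rw [Subsingleton.elim i ⟨0, Nat.one_pos⟩]
          simp
        · simp
      map_update_smul' := by
        intro inst F i c u
        split_ifs with h
        · obtain ⟨rfl, -⟩ := h
          rw [Subsingleton.elim i ⟨0, Nat.one_pos⟩]
          simp
        · simp }
  symm n L σ F := by
    show (if h : n = 1 ∧ L = 0 then F (σ ⟨0, by omega⟩) else 0) =
      (if h : n = 1 ∧ L = 0 then F ⟨0, by omega⟩ else 0)
    split_ifs with h
    · obtain ⟨rfl, -⟩ := h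
      rw [Subsingleton.elim (σ _)]
    · rfl

theorem FormalMap.one_coeff (n L : ℕ) (F : Fin n → Local s) :
    (FormalMap.one s).coeff n L F = if h : n = 1 ∧ L = 0 then F ⟨0, by omega⟩ else 0 := rfl

theorem FormalMap.one_firstIsId : FirstIsId (FormalMap.one s) := by
  intro L F φ
  rw [FormalMap.one_coeff]
  by_cases h : L = 0 <;> simp [h]

theorem FormalMap.one_coeff_of_ne {n : ℕ} (h : n ≠ 1) (L : ℕ) (F : Fin n → Local s) :
    (FormalMap.one s).coeff n L F = 0 := by
  rw [FormalMap.one_coeff, dif_neg (by tauto)]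

theorem FormalMap.comp_one (S : FormalMap s Y) (n L : ℕ) (F : Fin n → Local s) :
    compCoeff S (FormalMap.one s) n L F = S.coeff n L F := by
  rcases Nat.lt_or_ge n 2 with hn | hn
  · interval_cases n
    · exact compCoeff_zero S _ L F
    · exact compCoeff_one S FormalMap.one_firstIsId L F
  · have h : ∀ P : OrderedFinpartition n, P.length < n →
        partTerm S (FormalMap.one s) P L F = 0 := by
      intro P hP
      obtain ⟨I, hI⟩ := exists_one_lt_partSize P hP
      exact partTerm_eq_zero_of_right _ _ P I
        (fun L F => FormalMap.one_coeff_of_ne hI.ne' L F) L F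
    rw [compCoeff_eq_single_add_atomic S _ hn, partTerm_atomic S FormalMap.one_firstIsId,
      h _ (by simp only [singleBlock]; omega), zero_add, Finset.sum_eq_zero, add_zero]
    intro P hP
    exact h P (Finset.mem_filter.1 hP).2.2

theorem FormalMap.one_comp {Z : FormalMap s (Local s)} (hZ : ∀ L F, Z.coeff 0 L F = 0)
    (n L : ℕ) (F : Fin n → Local s) :
    compCoeff (FormalMap.one s) Z n L F = Z.coeff n L F := by
  rcases Nat.eq_zero_or_pos n with rfl | hn
  · rw [compCoeff_zero, hZ, FormalMap.one_coeff_of_ne (by omega)]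
  · rw [compCoeff_eq_single_add _ Z hn, partTerm_singleBlock' FormalMap.one_firstIsId,
      Finset.sum_eq_zero, add_zero]
    intro P hP
    exact partTerm_eq_zero_of_left _ _ P
      (fun L F => FormalMap.one_coeff_of_ne (Finset.mem_filter.1 hP).2.ne' L F) L F

/-! ### Partitions without mixed blocks -/

/-- The ideal generated by the blocks which contain both points with the property `p` and points
without. -/
def mixedIdeal {ι : Type*} (p : ι → Prop) : Ideal (MvPolynomial (Multiset ι) ℂ) :=
  Ideal.span {q | ∃ B : Multiset ι, (∃ i ∈ B, p i) ∧ (∃ j ∈ B, ¬ p j) ∧ q = X B}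

theorem X_mem_mixedIdeal {ι : Type*} {p : ι → Prop} {B : Multiset ι} (h : ∃ i ∈ B, p i)
    (h' : ∃ j ∈ B, ¬ p j) : X B ∈ mixedIdeal p :=
  Ideal.subset_span ⟨B, h, h', rfl⟩

theorem blockDer_mem_mixedIdeal {ι : Type*} {p : ι → Prop} (i : ι)
    {q : MvPolynomial (Multiset ι) ℂ} (hq : q ∈ mixedIdeal p) : blockDer i q ∈ mixedIdeal p := by
  refine Submodule.span_induction (p := fun q _ => blockDer i q ∈ mixedIdeal p) ?_ ?_ ?_ ?_ hq
  · rintro _ ⟨B, ⟨a, ha, ha'⟩, ⟨b, hb, hb'⟩, rfl⟩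
    rw [blockDer_X]
    exact X_mem_mixedIdeal ⟨a, Multiset.mem_cons_of_mem ha, ha'⟩
      ⟨b, Multiset.mem_cons_of_mem hb, hb'⟩
  · simp
  · intro x y _ _ hx hy
    rw [map_add]
    exact add_mem hx hy
  · intro a x hx hx'
    rw [smul_eq_mul, Derivation.leibniz]
    exact add_mem (Ideal.mul_mem_left _ _ hx') (Ideal.mul_mem_right _ _ hx)

theorem insertPt_mem_mixedIdeal {ι : Type*} {p : ι → Prop} (i : ι)
    {q : MvPolynomial (Multiset ι) ℂ} (hq : q ∈ mixedIdeal p) : insertPt i q ∈ mixedIdeal p :=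
  add_mem (Ideal.mul_mem_left _ _ hq) (blockDer_mem_mixedIdeal i hq)

/-- The polynomials in blocks which are not empty and consist of points without `p`. -/
def pureBlocks {ι : Type*} (p : ι → Prop) : Subalgebra ℂ (MvPolynomial (Multiset ι) ℂ) :=
  Algebra.adjoin ℂ {q | ∃ B : Multiset ι, (∃ j ∈ B, ¬ p j) ∧ (∀ j ∈ B, ¬ p j) ∧ q = X B}

theorem blockDer_mem_pureBlocks {ι : Type*} {p : ι → Prop} {i : ι} (hi : ¬ p i)
    {q : MvPolynomial (Multiset ι) ℂ} (hq : q ∈ pureBlocks p) : blockDer i q ∈ pureBlocks p := by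
  refine Algebra.adjoin_induction (p := fun q _ => blockDer i q ∈ pureBlocks p) ?_ ?_ ?_ ?_ hq
  · rintro _ ⟨B, -, hB, rfl⟩
    rw [blockDer_X]
    refine Algebra.subset_adjoin ⟨i ::ₘ B, ⟨i, Multiset.mem_cons_self _ _, hi⟩, ?_, rfl⟩
    intro j hj
    rcases Multiset.mem_cons.1 hj with rfl | hj
    exacts [hi, hB j hj]
  · intro r
    rw [Derivation.map_algebraMap]
    exact zero_mem _
  · intro x y _ _ hx hy
    rw [map_add]
    exact add_mem hx hy
  · intro x y hx hy hx' hy'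
    rw [Derivation.leibniz]
    exact add_mem (mul_mem hx hy') (mul_mem hy hx')

theorem partPoly_mem_pureBlocks {ι : Type*} {p : ι → Prop} (t : Multiset ι)
    (ht : ∀ j ∈ t, ¬ p j) : partPoly t ∈ pureBlocks p := by
  induction t using Multiset.induction with
  | empty => exact one_mem _
  | cons i t ih =>
    have hi := ht i (Multiset.mem_cons_self _ _)
    have ih := ih fun j hj => ht j (Multiset.mem_cons_of_mem hj)
    rw [partPoly_cons]
    refine add_mem (mul_mem (Algebra.subset_adjoin ⟨{i}, ?_, ?_, rfl⟩) ih)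
      (blockDer_mem_pureBlocks hi ih)
    · exact ⟨i, Multiset.mem_singleton_self i, hi⟩
    · intro j hj
      rwa [Multiset.mem_singleton.1 hj]

theorem blockDer_pureBlocks_mem_mixedIdeal {ι : Type*} {p : ι → Prop} {i : ι} (hi : p i)
    {q : MvPolynomial (Multiset ι) ℂ} (hq : q ∈ pureBlocks p) :
    blockDer i q ∈ mixedIdeal p := by
  refine Algebra.adjoin_induction (p := fun q _ => blockDer i q ∈ mixedIdeal p) ?_ ?_ ?_ ?_ hq
  · rintro _ ⟨B, ⟨j, hj, hj'⟩, -, rfl⟩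
    rw [blockDer_X]
    exact X_mem_mixedIdeal ⟨i, Multiset.mem_cons_self _ _, hi⟩
      ⟨j, Multiset.mem_cons_of_mem hj, hj'⟩
  · intro r
    rw [Derivation.map_algebraMap]
    exact zero_mem _
  · intro x y _ _ hx hy
    rw [map_add]
    exact add_mem hx hy
  · intro x y hx hy hx' hy'
    rw [Derivation.leibniz]
    exact add_mem (Ideal.mul_mem_left _ _ hy') (Ideal.mul_mem_left _ _ hx')

/-- Up to mixed blocks, a partition of a disjoint union consists of partitions of its parts. -/
theorem partPoly_add_sub_mem_mixedIdeal {ι : Type*} {p : ι → Prop} (t u : Multiset ι)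
    (ht : ∀ i ∈ t, p i) (hu : ∀ j ∈ u, ¬ p j) :
    partPoly (t + u) - partPoly t * partPoly u ∈ mixedIdeal p := by
  induction t using Multiset.induction with
  | empty => simp [partPoly_zero]
  | cons i t ih =>
    have hi := ht i (Multiset.mem_cons_self _ _)
    have ih := ih fun j hj => ht j (Multiset.mem_cons_of_mem hj)
    rw [Multiset.cons_add, partPoly_cons, partPoly_cons]
    have : insertPt i (partPoly (t + u)) - insertPt i (partPoly t) * partPoly u =
        insertPt i (partPoly (t + u) - partPoly t * partPoly u) +
          partPoly t * blockDer i (partPoly u) := by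
      simp only [map_sub, insertPt_apply, Derivation.leibniz, smul_eq_mul]
      ring
    rw [this]
    exact add_mem (insertPt_mem_mixedIdeal i ih) (Ideal.mul_mem_left _ _
      (blockDer_pureBlocks_mem_mixedIdeal hi (partPoly_mem_pureBlocks u hu)))

/-- A linear functional that vanishes on monomials with a mixed block factorizes the sum over
partitions of a disjoint union. -/
theorem map_partPoly_add {ι E : Type*} [AddCommGroup E] [Module ℂ E] {p : ι → Prop}
    (Φ : MvPolynomial (Multiset ι) ℂ →ₗ[ℂ] E)
    (hΦ : ∀ (B : Multiset ι) (β : Multiset (Multiset ι)), (∃ i ∈ B, p i) → (∃ j ∈ B, ¬ p j) →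
      Φ (mon (B ::ₘ β)) = 0)
    (t u : Multiset ι) (ht : ∀ i ∈ t, p i) (hu : ∀ j ∈ u, ¬ p j) :
    Φ (partPoly (t + u)) = Φ (partPoly t * partPoly u) := by
  have key : ∀ q ∈ mixedIdeal p, Φ q = 0 := by
    intro q hq
    have h1 : ∀ r, Φ (r * q) = 0 := by
      refine Submodule.span_induction (p := fun q _ => ∀ r, Φ (r * q) = 0) ?_ ?_ ?_ ?_ hq
      · rintro _ ⟨B, h, h', rfl⟩ r
        have : Φ ∘ₗ LinearMap.mulRight ℂ (X B) = 0 := by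
          refine monLin_ext fun β => ?_
          rw [LinearMap.comp_apply, LinearMap.mulRight_apply, mul_comm, ← mon_cons, hΦ B β h h']
          rfl
        exact congrArg (fun f => f r) this
      · simp
      · intro x y _ _ hx hy r
        rw [mul_add, map_add, hx, hy, add_zero]
      · intro a x _ hx r
        rw [smul_eq_mul, ← mul_assoc]
        exact hx _
    simpa using h1 1
  rw [← sub_eq_zero, ← map_sub]
  exact key _ (partPoly_add_sub_mem_mixedIdeal t u ht hu)

end

/-! ### The space of field configurations -/

section

variable {s : ℕ}

theorem Config.ext {φ ψ : Config s} (h : ∀ x, φ x = ψ x) : φ = ψ := Subtype.ext (funext h)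

@[simp] theorem Config.add_apply (φ ψ : Config s) (x : Mink s) : (φ + ψ) x = φ x + ψ x := rfl

@[simp] theorem Config.sub_apply (φ ψ : Config s) (x : Mink s) : (φ - ψ) x = φ x - ψ x := rfl

@[simp] theorem Config.smul_apply (c : ℝ) (φ : Config s) (x : Mink s) : (c • φ) x = c * φ x := rfl

@[simp] theorem Config.zero_apply (x : Mink s) : (0 : Config s) x = 0 := rfl

@[simp] theorem Config.mk_apply (f : Mink s → ℝ) (hf : ContDiff ℝ ∞ f) (x : Mink s) :
    (Config.mk f hf) x = f x := rfl

theorem Config.sum_apply {ι : Type*} (t : Finset ι) (ψ : ι → Config s) (x : Mink s) :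
    (∑ i ∈ t, ψ i : Config s) x = ∑ i ∈ t, ψ i x := by
  classical
  induction t using Finset.induction_on with
  | empty => rfl
  | insert a t ha ih => rw [Finset.sum_insert ha, Finset.sum_insert ha, Config.add_apply, ih]

/-- The `k`-th derivative, as a linear map. -/
def Config.jetLin (s k : ℕ) : Config s →ₗ[ℝ] C(Mink s, Mink s [×k]→L[ℝ] ℝ) where
  toFun := Config.jet k
  map_add' φ ψ := by
    ext1 x
    exact iteratedFDeriv_add_apply ((φ.contDiff.of_le (by exact_mod_cast le_top)).contDiffAt)
      ((ψ.contDiff.of_le (by exact_mod_cast le_top)).contDiffAt)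
  map_smul' c φ := by
    ext1 x
    exact iteratedFDeriv_const_smul_apply (φ.contDiff.of_le (by exact_mod_cast le_top)).contDiffAt

instance : IsTopologicalAddGroup (Config s) :=
  topologicalAddGroup_iInf fun k => topologicalAddGroup_induced (Config.jetLin s k)

instance : ContinuousSMul ℝ (Config s) :=
  continuousSMul_iInf fun k => continuousSMul_induced (Config.jetLin s k)

theorem Config.jet_eq_zero (k : ℕ) {ψ : Config s} {x : Mink s}
    (hx : x ∉ tsupport (ψ : Mink s → ℝ)) : Config.jet k ψ x = 0 := by
  have h : (ψ : Mink s → ℝ) =ᶠ[𝓝 x] fun _ => 0 := notMem_tsupport_iff_eventuallyEq.1 hx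
  show iteratedFDeriv ℝ k ψ x = 0
  rw [(Filter.EventuallyEq.iteratedFDeriv ℝ h k).eq_of_nhds]
  exact congrFun iteratedFDeriv_fun_zero x

/-- In the topology of uniform convergence on compact sets, configurations supported farther and
farther away converge to zero. -/
theorem Config.tendsto_zero_of_disjoint {ψ : ℕ → Config s}
    (h : ∀ n : ℕ, Disjoint (tsupport (ψ n : Mink s → ℝ)) (Metric.closedBall 0 (n : ℝ))) :
    Tendsto ψ atTop (𝓝 0) := by
  rw [nhds_iInf, tendsto_iInf]
  intro k
  rw [nhds_induced, tendsto_comap_iff,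
    ContinuousMap.tendsto_iff_forall_isCompact_tendstoUniformlyOn]
  intro K hK
  obtain ⟨R, hR⟩ := hK.isBounded.subset_closedBall (0 : Mink s)
  obtain ⟨N, hN⟩ := exists_nat_ge R
  intro u hu
  filter_upwards [eventually_ge_atTop N] with n hn x hx
  have h0 : x ∉ tsupport (ψ n : Mink s → ℝ) := by
    intro hx'
    refine (Set.disjoint_left.1 (h n)) hx' (Metric.closedBall_subset_closedBall ?_ (hR hx))
    exact hN.trans (by exact_mod_cast hn)
  have h1 : x ∉ tsupport ((0 : Config s) : Mink s → ℝ) := by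
    have : ((0 : Config s) : Mink s → ℝ) = 0 := rfl
    rw [this]; simp
  simp only [Function.comp_apply]
  rw [Config.jet_eq_zero k h0, Config.jet_eq_zero k h1]
  exact refl_mem_uniformity hu

/-- Neighbourhoods of `φ` put no constraint on variations supported far away from the origin. -/
theorem Config.exists_radius {φ : Config s} {W : Set (Config s)} (hW : W ∈ 𝓝 φ) :
    ∃ R : ℝ, ∀ ψ : Config s, Disjoint (tsupport (ψ : Mink s → ℝ)) (Metric.closedBall 0 R) →
      φ + ψ ∈ W := by
  by_contra hcon
  push Not at hcon
  choose ψ h1 h2 using fun n : ℕ => hcon n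
  have h3 : Tendsto (fun n => φ + ψ n) atTop (𝓝 φ) := by
    simpa using (Config.tendsto_zero_of_disjoint h1).const_add φ
  obtain ⟨n, hn⟩ := (h3.eventually hW).exists
  exact h2 n hn

theorem Config.tendsto_line (φ ψ : Config s) :
    Tendsto (fun t : ℝ => φ + t • ψ) (𝓝 0) (𝓝 φ) := by
  have : Continuous (fun t : ℝ => φ + t • ψ) := by fun_prop
  simpa using this.tendsto 0

/-- The product of two configurations. -/
def Config.mul (χ ψ : Config s) : Config s :=
  Config.mk (fun x => χ x * ψ x) (χ.contDiff.mul ψ.contDiff)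

@[simp] theorem Config.mul_apply (χ ψ : Config s) (x : Mink s) : χ.mul ψ x = χ x * ψ x := rfl

theorem Config.tsupport_mul_left (χ ψ : Config s) :
    tsupport (χ.mul ψ : Mink s → ℝ) ⊆ tsupport (χ : Mink s → ℝ) :=
  closure_mono fun x hx => by
    intro h
    exact hx (by simp [h])

theorem Config.tsupport_mul_right (χ ψ : Config s) :
    tsupport (χ.mul ψ : Mink s → ℝ) ⊆ tsupport (ψ : Mink s → ℝ) :=
  closure_mono fun x hx => by
    intro h
    exact hx (by simp [h])

/-- A smooth partition of unity for a finite open cover of a closed set. -/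
theorem exists_partition_of_unity {ι : Type*} [Fintype ι] {K : Set (Mink s)} (hK : IsClosed K)
    (U : ι → Set (Mink s)) (hU : ∀ i, IsOpen (U i)) (hKU : K ⊆ ⋃ i, U i) :
    ∃ χ : ι → Config s, (∀ i, tsupport (χ i : Mink s → ℝ) ⊆ U i) ∧
      ∀ x ∈ K, ∑ i, χ i x = 1 := by
  obtain ⟨f, hf⟩ := SmoothPartitionOfUnity.exists_isSubordinate
    (modelWithCornersSelf ℝ (Mink s)) hK U hU hKU
  refine ⟨fun i => Config.mk (f i) (contMDiff_iff_contDiff.1 (f i).contMDiff), hf, ?_⟩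
  intro x hx
  have := f.sum_eq_one hx
  rwa [finsum_eq_sum_of_fintype] at this

/-- A smooth function which is `1` on a large ball, with compact support. -/
theorem exists_cutoff (R : ℝ) : ∃ χ : Config s, HasCompactSupport (χ : Mink s → ℝ) ∧
    ∀ x ∈ Metric.closedBall (0 : Mink s) R, χ x = 1 := by
  have hR : (0 : ℝ) < |R| + 1 := by positivity
  let f : ContDiffBump (0 : Mink s) := ⟨|R| + 1, |R| + 2, hR, by linarith⟩
  refine ⟨Config.mk f f.contDiff, f.hasCompactSupport, fun x hx => ?_⟩
  refine f.one_of_mem_closedBall (Metric.closedBall_subset_closedBall ?_ hx)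
  have := le_abs_self R
  show R ≤ |R| + 1
  linarith

/-- A smooth function supported in a given neighbourhood of `K` which is `1` close to `K`, so that
multiplication by it does not change configurations close to `K`. -/
theorem exists_cutoff_nhds {K V : Set (Mink s)} (hK : IsClosed K) (hV : IsOpen V) (hKV : K ⊆ V) :
    ∃ χ : Config s, tsupport (χ : Mink s → ℝ) ⊆ V ∧
      ∀ ψ : Config s, Disjoint (tsupport (ψ - χ.mul ψ : Config s)) K := by
  obtain ⟨V₁, hV₁, hK1, hV1⟩ := normal_exists_closure_subset hK hV hKV
  obtain ⟨χ, hχ, hχ1⟩ := exists_partition_of_unity (ι := Unit) isClosed_closure (fun _ => V)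
    (fun _ => hV) (fun x hx => Set.mem_iUnion.2 ⟨(), hV1 hx⟩)
  refine ⟨χ (), hχ (), fun ψ => ?_⟩
  rw [Set.disjoint_right]
  intro x hx
  rw [notMem_tsupport_iff_eventuallyEq]
  filter_upwards [hV₁.mem_nhds (hK1 hx)] with y hy
  have := hχ1 y (subset_closure hy)
  rw [Fintype.sum_unique] at this
  rw [Config.sub_apply, Config.mul_apply]
  erw [this]
  simp

/-! ### Calculus of functionals -/

/-- The functional `⟨δF/δφ, ψ⟩`. -/
def dirDeriv (F : Config s → ℂ) (ψ : Config s) : Config s → ℂ :=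
  fun φ => funcDeriv F 1 φ (fun _ => ψ)

theorem dirDeriv_eq_deriv (F : Config s → ℂ) (ψ φ : Config s) :
    dirDeriv F ψ φ = deriv (fun t : ℝ => F (φ + t • ψ)) 0 := rfl

/-- The iterated derivative, with the first direction differentiated first. -/
theorem funcDeriv_succ_eq (F : Config s → ℂ) (n : ℕ) (φ : Config s) (v : Fin (n + 1) → Config s) :
    funcDeriv F (n + 1) φ v = funcDeriv (dirDeriv F (v 0)) n φ (Fin.tail v) := by
  induction n generalizing φ with
  | zero =>
    show funcDeriv F 1 φ v = funcDeriv F 1 φ (fun _ => v 0)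
    congr 1
    funext i
    rw [Fin.eq_zero i]
  | succ n ih =>
    rw [funcDeriv]
    simp only [ih]
    rfl

theorem funcDeriv_dirDeriv (F : Config s → ℂ) (ψ : Config s) (n : ℕ) (φ : Config s)
    (v : Fin n → Config s) :
    funcDeriv (dirDeriv F ψ) n φ v =
      funcDeriv F (n + 1) φ (Fin.cons (α := fun _ => Config s) ψ v) := by
  rw [funcDeriv_succ_eq]
  rfl

theorem SmoothFunctional.continuous {F : Config s → ℂ} (hF : SmoothFunctional F) :
    Continuous F :=
  (hF 0).1.comp (Continuous.prodMk continuous_id (continuous_const (y := Fin.elim0)))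

theorem SmoothFunctional.dirDeriv {F : Config s → ℂ} (hF : SmoothFunctional F) (ψ : Config s) :
    SmoothFunctional (dirDeriv F ψ) := by
  intro n
  simp only [funcDeriv_dirDeriv]
  refine ⟨?_, fun φ χ v => (hF (n + 1)).2 φ χ _⟩
  refine (hF (n + 1)).1.comp (Continuous.prodMk continuous_fst ?_)
  refine continuous_pi fun i => ?_
  refine Fin.cases ?_ (fun j => ?_) i
  · simpa using continuous_const
  · simp only [Fin.cons_succ]
    fun_prop

theorem SmoothFunctional.hasDerivAt {F : Config s → ℂ} (hF : SmoothFunctional F)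
    (φ ψ : Config s) (t : ℝ) :
    HasDerivAt (fun t : ℝ => F (φ + t • ψ)) (PAQFT.dirDeriv F ψ (φ + t • ψ)) t := by
  have h := ((hF 0).2 (φ + t • ψ) ψ Fin.elim0).hasDerivAt
  have h2 : HasDerivAt (fun u : ℝ => F (φ + t • ψ + (u - t) • ψ))
      (PAQFT.dirDeriv F ψ (φ + t • ψ)) t := by
    have h3 := HasDerivAt.comp_sub_const (f := fun u : ℝ => F (φ + t • ψ + u • ψ)) t t
      (f' := PAQFT.dirDeriv F ψ (φ + t • ψ)) (by rw [sub_self]; exact h)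
    exact h3
  refine h2.congr_of_eventuallyEq (Eventually.of_forall fun u => ?_)
  show F (φ + u • ψ) = F (φ + t • ψ + (u - t) • ψ)
  congr 1
  rw [sub_smul]; abel

theorem SmoothFunctional.eq_of_dirDeriv_eq_zero {F : Config s → ℂ} (hF : SmoothFunctional F)
    (φ ψ : Config s) (h : ∀ φ', PAQFT.dirDeriv F ψ φ' = 0) : F (φ + ψ) = F φ := by
  have := is_const_of_deriv_eq_zero (f := fun t : ℝ => F (φ + t • ψ))
    (fun t => (hF.hasDerivAt φ ψ t).differentiableAt)
    (fun t => by rw [(hF.hasDerivAt φ ψ t).deriv, h]) 1 0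
  simpa using this

/-- The derivative of a smooth functional is additive in the direction: joint continuity of the
derivatives makes `(a, b) ↦ F(φ + aψ + bχ)` differentiable at the origin. -/
theorem SmoothFunctional.dirDeriv_add {F : Config s → ℂ} (hF : SmoothFunctional F)
    (ψ χ : Config s) :
    PAQFT.dirDeriv F (ψ + χ) = PAQFT.dirDeriv F ψ + PAQFT.dirDeriv F χ := by
  funext φ
  let f : ℝ → ℝ → ℂ := fun a b => F (φ + a • ψ + b • χ)
  let f₁ : ℝ → ℝ → ℝ →L[ℝ] ℂ := fun a b =>
    ContinuousLinearMap.toSpanSingleton ℝ (PAQFT.dirDeriv F ψ (φ + a • ψ + b • χ))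
  let f₂ : ℝ → ℝ → ℝ →L[ℝ] ℂ := fun a b =>
    ContinuousLinearMap.toSpanSingleton ℝ (PAQFT.dirDeriv F χ (φ + a • ψ + b • χ))
  have cont : ∀ η, Continuous (fun p : ℝ × ℝ =>
      ContinuousLinearMap.toSpanSingleton ℝ (PAQFT.dirDeriv F η (φ + p.1 • ψ + p.2 • χ))) := by
    intro η
    have h1 : Continuous (fun p : ℝ × ℝ => PAQFT.dirDeriv F η (φ + p.1 • ψ + p.2 • χ)) :=
      (hF.dirDeriv η).continuous.comp (by fun_prop)
    exact (ContinuousLinearMap.toSpanSingletonCLE (𝕜 := ℝ) (E := ℂ)).continuous.comp h1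
  have h := hasStrictFDerivAt_uncurry_coprod (𝕜 := ℝ) (u := ((0 : ℝ), (0 : ℝ))) (f := f)
    (f₁ := f₁) (f₂ := f₂) ?_ ?_ (cont ψ).continuousAt (cont χ).continuousAt
  · have h2 : HasDerivAt (fun t : ℝ => (t, t)) ((1 : ℝ), (1 : ℝ)) 0 :=
      (hasDerivAt_id 0).prodMk (hasDerivAt_id 0)
    have h3 := HasFDerivAt.comp_hasDerivAt (f := fun t : ℝ => (t, t)) (0 : ℝ) h.hasFDerivAt h2
    have h4 := hF.hasDerivAt φ (ψ + χ) 0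
    have h5 : HasDerivAt (fun t : ℝ => F (φ + t • (ψ + χ)))
        (PAQFT.dirDeriv F ψ φ + PAQFT.dirDeriv F χ φ) 0 := by
      have e1 : (fun t : ℝ => F (φ + t • (ψ + χ))) = (↿f ∘ fun t : ℝ => (t, t)) := by
        funext t
        simp [f, Function.HasUncurry.uncurry, add_assoc]
      have e2 : PAQFT.dirDeriv F ψ φ + PAQFT.dirDeriv F χ φ =
          ((↿f₁ ((0 : ℝ), (0 : ℝ))).coprod (↿f₂ ((0 : ℝ), (0 : ℝ)))) ((1 : ℝ), (1 : ℝ)) := by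
        simp [f₁, f₂, Function.HasUncurry.uncurry]
      rw [e1, e2]
      exact h3
    have := h4.unique h5
    simpa using this
  · refine Eventually.of_forall fun v => ?_
    have := hF.hasDerivAt (φ + v.2 • χ) ψ v.1
    have h2 : HasDerivAt (fun a : ℝ => f a v.2) (PAQFT.dirDeriv F ψ (φ + v.1 • ψ + v.2 • χ))
        v.1 := by
      convert this using 1
      · funext a; simp only [f]; congr 1; abel
      · congr 1; abel
    exact h2.hasFDerivAt
  · refine Eventually.of_forall fun v => ?_
    exact (hF.hasDerivAt (φ + v.1 • ψ) χ v.2).hasFDerivAt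

theorem SmoothFunctional.dirDeriv_sum {ι : Type*} {F : Config s → ℂ} (hF : SmoothFunctional F)
    (t : Finset ι) (ψ : ι → Config s) :
    PAQFT.dirDeriv F (∑ i ∈ t, ψ i) = ∑ i ∈ t, PAQFT.dirDeriv F (ψ i) := by
  classical
  induction t using Finset.induction_on with
  | empty =>
    have h := hF.dirDeriv_add (0 : Config s) 0
    rw [add_zero] at h
    simpa using h
  | insert a t ha ih => rw [Finset.sum_insert ha, Finset.sum_insert ha, hF.dirDeriv_add, ih]

/-- Sums of smooth functionals are smooth and can be differentiated termwise. -/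
theorem SmoothFunctional.sum {ι : Type*} (t : Finset ι) {F : ι → Config s → ℂ}
    (hF : ∀ i ∈ t, SmoothFunctional (F i)) : SmoothFunctional (∑ i ∈ t, F i) ∧
      ∀ n φ v, funcDeriv (∑ i ∈ t, F i) n φ v = ∑ i ∈ t, funcDeriv (F i) n φ v := by
  classical
  induction t using Finset.induction_on with
  | empty => exact ⟨SmoothFunctional.zero, fun n φ v => funcDeriv_zero n φ v⟩
  | insert a t ha ih =>
    obtain ⟨h1, h2⟩ := ih fun i hi => hF i (Finset.mem_insert_of_mem hi)
    have h3 := hF a (Finset.mem_insert_self a t)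
    rw [Finset.sum_insert ha]
    refine ⟨h3.add h1, fun n φ v => ?_⟩
    rw [funcDeriv_add h3 h1, h2, Finset.sum_insert ha]

/-- A functional does not change under variations of its argument outside of its support. -/
theorem eq_of_disjoint_spaceSupport {F : Config s → ℂ} (hF : Continuous F) {ψ : Config s}
    (h : Disjoint (tsupport (ψ : Mink s → ℝ)) (spaceSupport F)) (φ : Config s) :
    F (φ + ψ) = F φ := by
  -- for compactly supported `ψ`, a partition of unity reduces to small supports
  have compact_case : ∀ ψ : Config s, HasCompactSupport (ψ : Mink s → ℝ) →
      Disjoint (tsupport (ψ : Mink s → ℝ)) (spaceSupport F) → ∀ φ, F (φ + ψ) = F φ := by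
    intro ψ hψ h φ
    have h1 : ∀ x ∈ tsupport (ψ : Mink s → ℝ), ∃ U ∈ 𝓝 x, ∀ φ χ : Config s,
        tsupport (χ : Mink s → ℝ) ⊆ U → F (φ + χ) = F φ := by
      intro x hx
      have := Set.disjoint_left.1 h hx
      simpa only [spaceSupport, mem_ofPred_eq, not_forall, not_exists, not_and, not_not,
        exists_prop] using this
    choose! U hU hFU using h1
    obtain ⟨t, ht, hcover⟩ := hψ.elim_nhds_subcover (fun x => interior (U x))
      (fun x hx => interior_mem_nhds.2 (hU x hx))
    obtain ⟨χ, hχ, hsum⟩ := exists_partition_of_unity (ι := t) (isClosed_tsupport ψ)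
      (fun x => interior (U x)) (fun _ => isOpen_interior)
      (fun x hx => by
        obtain ⟨y, hy, hxy⟩ := Set.mem_iUnion₂.1 (hcover hx)
        exact Set.mem_iUnion.2 ⟨⟨y, hy⟩, hxy⟩)
    have h2 : ψ = ∑ i, (χ i).mul ψ := by
      refine Config.ext fun x => ?_
      rw [Config.sum_apply]
      simp only [Config.mul_apply, ← Finset.sum_mul]
      by_cases hx : x ∈ tsupport (ψ : Mink s → ℝ)
      · rw [hsum x hx, one_mul]
      · rw [image_eq_zero_of_notMem_tsupport hx, mul_zero]
    have h3 : ∀ t' : Finset t, F (φ + ∑ i ∈ t', (χ i).mul ψ) = F φ := by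
      intro t'
      classical
      induction t' using Finset.induction_on with
      | empty => simp
      | insert a t' ha ih =>
        rw [Finset.sum_insert ha, add_comm ((χ a).mul ψ), ← add_assoc, hFU a (ht a a.2), ih]
        exact (Config.tsupport_mul_left _ _).trans ((hχ a).trans interior_subset)
    rw [h2]
    exact h3 Finset.univ
  -- in general, `ψ` is a limit of compactly supported functions
  choose χ hχ1 hχ2 using fun n : ℕ => exists_cutoff (s := s) ((n : ℝ) + 1)
  have h4 : ∀ n, F (φ + (χ n).mul ψ) = F φ := fun n =>
    compact_case _ ((hχ1 n).of_isClosed_subset (isClosed_tsupport _)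
      (Config.tsupport_mul_left _ _)) (h.mono_left (Config.tsupport_mul_right _ _)) φ
  have h5 : Tendsto (fun n => ψ - (χ n).mul ψ) atTop (𝓝 0) := by
    refine Config.tendsto_zero_of_disjoint fun n => ?_
    rw [Set.disjoint_right]
    intro x hx
    rw [notMem_tsupport_iff_eventuallyEq]
    have hx' : x ∈ Metric.ball (0 : Mink s) ((n : ℝ) + 1) := by
      rw [Metric.mem_closedBall] at hx
      rw [Metric.mem_ball]; linarith
    filter_upwards [Metric.isOpen_ball.mem_nhds hx'] with y hy
    have := hχ2 n y (Metric.ball_subset_closedBall hy)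
    simp [this]
  have h6 : Tendsto (fun n => φ + (χ n).mul ψ) atTop (𝓝 (φ + ψ)) := by
    have := (tendsto_const_nhds (x := φ + ψ) (f := atTop (α := ℕ))).sub h5
    rw [sub_zero] at this
    refine this.congr fun n => ?_
    abel
  have h7 := (hF.tendsto (φ + ψ)).comp h6
  refine tendsto_nhds_unique h7 ?_
  refine (tendsto_const_nhds (x := F φ)).congr fun n => (h4 n).symm

theorem dirDeriv_eq_zero_of_disjoint {F : Config s → ℂ} (hF : Continuous F) {ψ : Config s}
    (h : Disjoint (tsupport (ψ : Mink s → ℝ)) (spaceSupport F)) : dirDeriv F ψ = 0 := by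
  funext φ
  rw [dirDeriv_eq_deriv]
  have : (fun t : ℝ => F (φ + t • ψ)) = fun _ => F φ := by
    funext t
    refine eq_of_disjoint_spaceSupport hF (h.mono_left ?_) φ
    refine closure_mono fun x hx h => hx ?_
    simp [h]
  rw [this, deriv_const]
  rfl

theorem spaceSupport_dirDeriv_subset (F : Config s → ℂ) (ψ : Config s) :
    spaceSupport (dirDeriv F ψ) ⊆ spaceSupport F := by
  intro x hx
  by_contra hcon
  simp only [spaceSupport, mem_ofPred_eq, not_forall, not_exists, not_and, not_not] at hcon
  obtain ⟨U, hU, h⟩ := hcon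
  obtain ⟨φ, χ, h1, h2⟩ := hx U hU
  apply h2
  simp only [dirDeriv_eq_deriv]
  congr 1
  funext t
  rw [add_right_comm, h _ _ h1]

theorem spaceSupport_dirDeriv_subset_tsupport {F : Config s → ℂ} (hF : AdditiveFunctional F)
    (ψ : Config s) : spaceSupport (dirDeriv F ψ) ⊆ tsupport (ψ : Mink s → ℝ) := by
  intro x hx
  by_contra hcon
  obtain ⟨φ, χ, h1, h2⟩ := hx _ ((isClosed_tsupport (ψ : Mink s → ℝ)).isOpen_compl.mem_nhds hcon)
  apply h2
  simp only [dirDeriv_eq_deriv]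
  have h3 : (fun t : ℝ => F (φ + χ + t • ψ)) =
      fun t : ℝ => F (φ + t • ψ) + (F (φ + χ) - F φ) := by
    funext t
    have h4 : Disjoint (tsupport (χ : Mink s → ℝ)) (tsupport (t • ψ : Config s)) := by
      have h5 : tsupport (t • ψ : Config s) ⊆ tsupport (ψ : Mink s → ℝ) :=
        closure_mono fun x hx h => hx (by simp [h])
      exact Set.disjoint_left.2 fun y hy hy' => h1 hy (h5 hy')
    have := hF χ φ (t • ψ) h4
    rw [add_comm χ φ] at this
    rw [this]; ring
  rw [h3, deriv_add_const]

end

/-! ### Derivatives of local functionals are local -/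

section

variable {s : ℕ}

theorem sinWave_zero (χ : Config s) : sinWave χ 0 = 0 := by
  refine Config.ext fun x => ?_
  simp [sinWave, mink]

theorem cosWave_zero (χ : Config s) : cosWave χ 0 = χ := by
  refine Config.ext fun x => ?_
  simp [cosWave, mink]

/-- The Fourier transform of a distribution with one argument fixed is the one of the original
distribution at vanishing momentum of this argument: `sinWave` vanishes there, and `cosWave` is
the argument itself. -/
theorem localFourier_cons {n : ℕ} (u : (Fin (n + 1) → Config s) → ℂ)
    (hu : ∀ v, v 0 = 0 → u v = 0) (ψ : Config s) (χ : Fin n → Config s) (ξ : Fin n → Mink s) :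
    localFourier (fun v => u (Fin.cons (α := fun _ => Config s) ψ v)) χ ξ =
      localFourier u (Fin.cons (α := fun _ => Config s) ψ χ)
        (Fin.cons (α := fun _ => Mink s) 0 ξ) := by
  simp only [localFourier, complexExt]
  refine Finset.sum_of_injOn (fun B => B.map (Fin.succEmb n)) ?_ ?_ ?_ ?_
  · intro A _ B _ h
    exact Finset.map_injective _ h
  · intro A _
    simp
  · intro A _ hA
    have h0 : (0 : Fin (n + 1)) ∈ A := by
      by_contra h0
      refine hA ⟨A.preimage Fin.succ (Fin.succ_injective n).injOn, by simp, ?_⟩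
      ext i
      refine Fin.cases ?_ (fun j => ?_) i
      · simp [h0]
      · simp
    rw [hu _ (by simp [h0, sinWave_zero]), mul_zero]
  · intro A _
    simp only [Finset.card_map]
    congr 2
    funext i
    refine Fin.cases ?_ (fun j => ?_) i
    · simp [cosWave_zero]
    · simp

/-- Regularity of a distribution in the direction `(0, k)`, on a product neighbourhood which
contains the support of `ψ` in its first factor, is inherited by the distribution obtained by
fixing the first argument to be `ψ`. -/
theorem RegularDirection.fix_first {n : ℕ} {u : (Fin (n + 1) → Config s) → ℂ}
    (hu : ∀ v, v 0 = 0 → u v = 0) {x k : Fin n → Mink s}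
    {U : Fin (n + 1) → Set (Mink s)} {Γ : Set (Fin (n + 1) → Mink s)}
    (hU : ∀ i : Fin n, IsOpen (U i.succ) ∧ x i ∈ U i.succ) (hΓ : IsOpen Γ)
    (hk : Fin.cons (α := fun _ => Mink s) 0 k ∈ Γ) (hcone : ∀ ξ ∈ Γ, ∀ t : ℝ, 0 < t → t • ξ ∈ Γ)
    (h : ∀ χ : Fin (n + 1) → Config s,
      (∀ i, HasCompactSupport (χ i : Mink s → ℝ) ∧ tsupport (χ i : Mink s → ℝ) ⊆ U i) →
      ∀ N : ℕ, ∃ C : ℝ, ∀ ξ ∈ Γ, (1 + ‖ξ‖) ^ N * ‖localFourier u χ ξ‖ ≤ C)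
    {ψ : Config s} (hψ : HasCompactSupport (ψ : Mink s → ℝ))
    (hψU : tsupport (ψ : Mink s → ℝ) ⊆ U 0) :
    RegularDirection (fun v => u (Fin.cons (α := fun _ => Config s) ψ v)) x k := by
  refine ⟨fun i => U i.succ, {ξ | Fin.cons (α := fun _ => Mink s) 0 ξ ∈ Γ}, hU, ?_, hk, ?_, ?_⟩
  · have hc : Continuous fun ξ : Fin n → Mink s =>
        (Fin.cons (α := fun _ => Mink s) 0 ξ : Fin (n + 1) → Mink s) := by
      refine continuous_pi fun i => ?_
      refine Fin.cases ?_ (fun j => ?_) i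
      · simpa using (continuous_const : Continuous fun _ : Fin n → Mink s => (0 : Mink s))
      · simp only [Fin.cons_succ]
        fun_prop
    exact hΓ.preimage hc
  · intro ξ hξ t ht
    have := hcone _ hξ t ht
    have h2 : t • (Fin.cons (α := fun _ => Mink s) 0 ξ : Fin (n + 1) → Mink s) =
        Fin.cons (α := fun _ => Mink s) 0 (t • ξ) := by
      funext i
      refine Fin.cases ?_ (fun j => ?_) i <;> simp
    rw [h2] at this
    exact this
  · intro χ hχ N
    obtain ⟨C, hC⟩ := h (Fin.cons (α := fun _ => Config s) ψ χ)
      (fun i => Fin.cases ⟨hψ, hψU⟩ (fun j => hχ j) i) N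
    refine ⟨C, fun ξ hξ => le_trans ?_ (hC _ hξ)⟩
    rw [localFourier_cons u hu]
    gcongr
    refine (pi_norm_le_iff_of_nonneg (norm_nonneg _)).2 fun i => ?_
    simpa using norm_le_pi_norm (Fin.cons (α := fun _ => Mink s) 0 ξ : Fin (n + 1) → Mink s) i.succ

theorem RegularDirection.sum {n : ℕ} {ι : Type*} (t : Finset ι)
    {u : ι → (Fin n → Config s) → ℂ} {x k : Fin n → Mink s}
    (h : ∀ i ∈ t, RegularDirection (u i) x k) :
    RegularDirection (fun v => ∑ i ∈ t, u i v) x k := by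
  classical
  induction t using Finset.induction_on with
  | empty => simpa using RegularDirection.zero x k
  | insert a t ha ih =>
    simp only [Finset.sum_insert ha]
    exact (h a (Finset.mem_insert_self a t)).add
      (ih fun i hi => h i (Finset.mem_insert_of_mem hi))

theorem funcDeriv_eq_zero_of_first {F : Config s → ℂ} {n : ℕ} {φ : Config s}
    (v : Fin (n + 1) → Config s) (hv : v 0 = 0) : funcDeriv F (n + 1) φ v = 0 := by
  rw [funcDeriv_succ_eq, hv]
  have : dirDeriv F 0 = 0 := by
    funext φ
    simp [dirDeriv_eq_deriv]
  rw [this, funcDeriv_zero]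

/-- Integration of one variable of a compactly supported derivative of a functional against a
smooth function: only covectors which vanish in this variable contribute to the wave front set. -/
theorem regularDirection_dirDeriv {F : Config s → ℂ} (hF : SmoothFunctional F)
    (hK : IsCompact (spaceSupport F)) (ψ φ : Config s) {n : ℕ} (x k : Fin n → Mink s)
    (h : ∀ y, RegularDirection (funcDeriv F (n + 1) φ) (Fin.cons (α := fun _ => Mink s) y x)
      (Fin.cons (α := fun _ => Mink s) 0 k)) :
    RegularDirection (funcDeriv (dirDeriv F ψ) n φ) x k := by
  -- finitely many of the neighbourhoods of the points `(y, x)` cover the support of `F`,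
  -- and `ψ` is decomposed accordingly by a partition of unity
  choose U Γ hU hΓ hk hcone hdecay using h
  obtain ⟨R, hR⟩ := hK.isBounded.subset_ball (0 : Mink s)
  obtain ⟨t, ht⟩ := hK.elim_finite_subcover (fun y => U y 0 ∩ Metric.ball 0 R)
    (fun y => (hU y 0).1.inter Metric.isOpen_ball)
    (fun y hy => Set.mem_iUnion.2 ⟨y, (hU y 0).2, hR hy⟩)
  have hopen : IsOpen (⋃ y : t, U y 0 ∩ Metric.ball 0 R) :=
    isOpen_iUnion fun y => (hU y 0).1.inter Metric.isOpen_ball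
  have ht' : spaceSupport F ⊆ ⋃ y : t, U y 0 ∩ Metric.ball 0 R := by
    intro z hz
    obtain ⟨y, hy, hz'⟩ := Set.mem_iUnion₂.1 (ht hz)
    exact Set.mem_iUnion.2 ⟨⟨y, hy⟩, hz'⟩
  obtain ⟨V, hV, hKV, hVU⟩ := normal_exists_closure_subset (isClosed_spaceSupport F) hopen ht'
  obtain ⟨χ, hχ, hsum⟩ := exists_partition_of_unity (ι := t) isClosed_closure
    (fun y => U y 0 ∩ Metric.ball 0 R) (fun y => (hU y 0).1.inter Metric.isOpen_ball) hVU
  have hrest : dirDeriv F (ψ - ∑ y, (χ y).mul ψ) = 0 := by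
    refine dirDeriv_eq_zero_of_disjoint hF.continuous ?_
    rw [Set.disjoint_right]
    intro z hz
    rw [notMem_tsupport_iff_eventuallyEq]
    filter_upwards [hV.mem_nhds (hKV hz)] with y hy
    rw [Config.sub_apply, Config.sum_apply]
    simp only [Config.mul_apply]
    rw [← Finset.sum_mul, hsum y (subset_closure hy)]
    simp
  have hsplit : dirDeriv F ψ = ∑ y, dirDeriv F ((χ y).mul ψ) := by
    rw [← hF.dirDeriv_sum, ← add_zero (dirDeriv F (∑ y, (χ y).mul ψ)), ← hrest, ← hF.dirDeriv_add]
    congr 1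
    abel
  have heq : funcDeriv (dirDeriv F ψ) n φ = fun v => ∑ y : t,
      funcDeriv F (n + 1) φ (Fin.cons (α := fun _ => Config s) ((χ y).mul ψ) v) := by
    funext v
    rw [hsplit, (SmoothFunctional.sum Finset.univ fun y _ => hF.dirDeriv _).2]
    simp only [funcDeriv_dirDeriv]
  rw [heq]
  refine RegularDirection.sum _ fun y _ => ?_
  refine RegularDirection.fix_first (fun v hv => funcDeriv_eq_zero_of_first v hv)
    (U := U y) (Γ := Γ y) (fun i => hU y i.succ) (hΓ y) (hk y) (hcone y) (hdecay y) ?_ ?_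
  · refine Metric.isCompact_of_isClosed_isBounded (isClosed_tsupport _) ?_
    exact (Metric.isBounded_ball (x := (0 : Mink s)) (r := R)).subset
      ((Config.tsupport_mul_left _ _).trans ((hχ y).trans inter_subset_right))
  · exact (Config.tsupport_mul_left _ _).trans ((hχ y).trans inter_subset_left)

/-- The wave front set of the derivatives of `⟨δF/δφ, ψ⟩` consists of covectors which, completed
by a zero covector, belong to the wave front set of the derivatives of `F`. -/
theorem waveFrontSet_dirDeriv {F : Config s → ℂ} (hF : SmoothFunctional F)
    (hK : IsCompact (spaceSupport F)) (ψ φ : Config s) {n : ℕ}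
    {p : (Fin n → Mink s) × (Fin n → Mink s)}
    (hp : p ∈ waveFrontSet (funcDeriv (dirDeriv F ψ) n φ)) :
    ∃ y, (Fin.cons (α := fun _ => Mink s) y p.1, Fin.cons (α := fun _ => Mink s) 0 p.2) ∈
      waveFrontSet (funcDeriv F (n + 1) φ) := by
  by_contra hcon
  push Not at hcon
  refine hp.2 (regularDirection_dirDeriv hF hK ψ φ p.1 p.2 fun y => ?_)
  by_contra h
  refine hcon y ⟨fun h0 => hp.1 ?_, h⟩
  funext i
  have := congrFun h0 i.succ
  simpa using this

/-- The derivative of a local functional in a fixed direction is a local functional. -/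
theorem dirDeriv_mem_local {F : Config s → ℂ} (hF : F ∈ Local s) (ψ : Config s) :
    dirDeriv F ψ ∈ Local s := by
  obtain ⟨⟨h1, h2, h3⟩, h4, h5⟩ := hF
  refine ⟨⟨h1.dirDeriv ψ, h2.of_isClosed_subset (isClosed_spaceSupport _)
    (spaceSupport_dirDeriv_subset F ψ), ?_⟩, ?_, ?_⟩
  · intro n φ p hp
    obtain ⟨y, hy⟩ := waveFrontSet_dirDeriv h1 h2 ψ φ hp
    have := h3 (n + 1) φ _ hy
    refine ⟨fun h => this.1 fun i => ?_, fun h => this.2 fun i => ?_⟩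
    · refine Fin.cases ?_ (fun j => h j) i
      simp [forwardCone]
    · refine Fin.cases ?_ (fun j => h j) i
      simp [backwardCone]
  · intro φ χ η h
    simp only [dirDeriv_eq_deriv]
    have h6 : ∀ φ, DifferentiableAt ℝ (fun t : ℝ => F (φ + t • ψ)) 0 := fun φ =>
      (h1.hasDerivAt φ ψ 0).differentiableAt
    have h7 : (fun t : ℝ => F (φ + χ + η + t • ψ)) = fun t : ℝ =>
        F (φ + χ + t • ψ) - F (χ + t • ψ) + F (χ + η + t • ψ) := by
      funext t
      have := h4 φ (χ + t • ψ) η h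
      rw [show φ + χ + η + t • ψ = φ + (χ + t • ψ) + η by abel, this,
        show φ + (χ + t • ψ) = φ + χ + t • ψ by abel,
        show χ + t • ψ + η = χ + η + t • ψ by abel]
    rw [h7]
    exact (((h6 (φ + χ)).hasDerivAt.sub (h6 χ).hasDerivAt).add (h6 (χ + η)).hasDerivAt).deriv
  · intro n φ p hp
    obtain ⟨y, hy⟩ := waveFrontSet_dirDeriv h1 h2 ψ φ hp
    have := h5 (n + 1) φ _ hy
    simpa [Fin.sum_univ_succ] using this

/-- The derivative of a local functional in a fixed direction, as a local functional. -/
def localDeriv (F : Local s) (ψ : Config s) : Local s := ⟨dirDeriv F.1 ψ, dirDeriv_mem_local F.2 ψ⟩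

/-! ### Gluing of local functionals -/

theorem funcDeriv_congr_nhds {F G : Config s → ℂ} (n : ℕ) {φ : Config s} (h : F =ᶠ[𝓝 φ] G)
    (v : Fin n → Config s) : funcDeriv F n φ v = funcDeriv G n φ v := by
  induction n generalizing φ with
  | zero => exact h.eq_of_nhds
  | succ n ih =>
    rw [funcDeriv, funcDeriv]
    refine Filter.EventuallyEq.deriv_eq ?_
    filter_upwards [(Config.tendsto_line φ (v (Fin.last n))).eventually
      (eventually_eventually_nhds.2 h)] with t ht
    exact ih ht _

theorem smoothFunctional_of_locally {F : Config s → ℂ}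
    (h : ∀ φ₀, ∃ G, SmoothFunctional G ∧ F =ᶠ[𝓝 φ₀] G) : SmoothFunctional F := by
  intro n
  constructor
  · rw [continuous_iff_continuousAt]
    rintro ⟨φ, v⟩
    obtain ⟨G, hG, hFG⟩ := h φ
    refine ((hG n).1.continuousAt (x := (φ, v))).congr ?_
    filter_upwards [continuousAt_fst.eventually (eventually_eventually_nhds.2 hFG)] with p hp
    exact (funcDeriv_congr_nhds n hp p.2).symm
  · intro φ ψ v
    obtain ⟨G, hG, hFG⟩ := h φ
    refine ((hG n).2 φ ψ v).congr_of_eventuallyEq ?_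
    filter_upwards [(Config.tendsto_line φ ψ).eventually (eventually_eventually_nhds.2 hFG)]
      with t ht
    exact funcDeriv_congr_nhds n ht v

/-- An additive functional which agrees, in a neighbourhood of each configuration, with some local
functional is local. In particular it has compact support: by additivity, its variation at a point
`x` can be computed at configurations which vanish far away from `x`, hence belong to a fixed
neighbourhood of zero if `x` is far away from the origin. -/
theorem mem_local_of_locally {F : Config s → ℂ} (hadd : AdditiveFunctional F)
    (h : ∀ φ₀, ∃ G ∈ Local s, F =ᶠ[𝓝 φ₀] G) : F ∈ Local s := by
  refine ⟨⟨smoothFunctional_of_locally fun φ₀ => ?_, ?_, ?_⟩, hadd, ?_⟩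
  · obtain ⟨G, hG, hFG⟩ := h φ₀
    exact ⟨G, hG.1.1, hFG⟩
  · obtain ⟨G, hG, hFG⟩ := h 0
    obtain ⟨R, hR⟩ := Config.exists_radius hFG
    have hK : IsCompact (Metric.closedBall (0 : Mink s) R ∪ spaceSupport G) :=
      (isCompact_closedBall _ _).union hG.1.2.1
    refine hK.of_isClosed_subset (isClosed_spaceSupport _) fun x hx => ?_
    by_contra hxK
    -- `η φ` agrees with `φ` close to `x` and vanishes close to the ball of radius `R`
    obtain ⟨U, hU, hxU, hUK⟩ := normal_exists_closure_subset (isClosed_singleton (x := x))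
      hK.isClosed.isOpen_compl (Set.singleton_subset_iff.2 hxK)
    obtain ⟨η, hη, hrest⟩ := exists_cutoff_nhds isClosed_closure hK.isClosed.isOpen_compl hUK
    obtain ⟨φ, ψ, h1, h2⟩ := hx U (hU.mem_nhds (hxU rfl))
    apply h2
    have h3 : Disjoint (tsupport (ψ : Mink s → ℝ)) (tsupport (φ - η.mul φ : Config s)) :=
      ((hrest φ).mono_right (h1.trans subset_closure)).symm
    have h4 := hadd ψ (η.mul φ) (φ - η.mul φ) h3
    have h5 : tsupport (η.mul φ : Mink s → ℝ) ⊆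
        (Metric.closedBall (0 : Mink s) R ∪ spaceSupport G)ᶜ :=
      (Config.tsupport_mul_left _ _).trans hη
    have h6 : tsupport (ψ : Mink s → ℝ) ⊆
        (Metric.closedBall (0 : Mink s) R ∪ spaceSupport G)ᶜ :=
      h1.trans (subset_closure.trans hUK)
    have h7 : F (η.mul φ) = G (η.mul φ) := by
      have := hR (η.mul φ) (Set.disjoint_left.2 fun y hy hy' => h5 hy (Or.inl hy'))
      rw [zero_add] at this
      exact this
    have h8 : F (ψ + η.mul φ) = G (ψ + η.mul φ) := by
      have := hR (ψ + η.mul φ) (Set.disjoint_left.2 fun y hy hy' => by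
        rcases (tsupport_add (ψ : Mink s → ℝ) (η.mul φ : Mink s → ℝ)) hy with hy | hy
        exacts [h6 hy (Or.inl hy'), h5 hy (Or.inl hy')])
      rw [zero_add] at this
      exact this
    have h9 : G (ψ + η.mul φ) = G (η.mul φ) := by
      rw [add_comm]
      exact eq_of_disjoint_spaceSupport hG.1.1.continuous
        (Set.disjoint_left.2 fun y hy hy' => h6 hy (Or.inr hy')) _
    rw [h7, h8, h9, sub_self, zero_add] at h4
    rw [show φ + ψ = ψ + η.mul φ + (φ - η.mul φ) by abel, h4]
    congr 1
    abel
  · intro n φ p hp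
    obtain ⟨G, hG, hFG⟩ := h φ
    rw [show funcDeriv F n φ = funcDeriv G n φ from
      funext fun v => funcDeriv_congr_nhds n hFG v] at hp
    exact hG.1.2.2 n φ p hp
  · intro n φ p hp
    obtain ⟨G, hG, hFG⟩ := h φ
    rw [show funcDeriv F n φ = funcDeriv G n φ from
      funext fun v => funcDeriv_congr_nhds n hFG v] at hp
    exact hG.2.2 n φ p hp

end

/-! ### Locality and vanishing off the diagonal -/

section

variable {s : ℕ} {Y : Submodule ℂ (Config s → ℂ)}

/-- Vanishing off the diagonal: `Z^{(n)}(F_1, …, F_n) = 0` if two of the arguments have disjoint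
supports. -/
def OffDiagonal (Z : FormalMap s (Local s)) : Prop :=
  ∀ (n L : ℕ) (F : Fin n → Local s) (i j : Fin n), i ≠ j →
    Disjoint (spaceSupport (F i).1) (spaceSupport (F j).1) → Z.coeff n L F = 0

/-- A formal map which vanishes off the diagonal is local. -/
theorem OffDiagonal.localMap {Z : FormalMap s (Local s)} (hZ : OffDiagonal Z) : LocalMap Z := by
  classical
  intro n L F G H hFH
  set T := Z.coeff n L with hT
  -- a term which contains `F` at least once does not notice that `H` is added to `G`
  have key : ∀ A : Finset (Fin n), A.Nonempty →
      T (A.piecewise (fun _ => F) (fun _ => G + H)) =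
        T (A.piecewise (fun _ => F) (fun _ => G)) := by
    rintro A ⟨i, hi⟩
    have h1 : A.piecewise (fun _ => F) (fun _ => G + H) =
        A.piecewise (fun _ => F) (fun _ => G) + A.piecewise (fun _ => 0) (fun _ => H) := by
      funext j
      by_cases hj : j ∈ A <;> simp [hj]
    rw [h1, MultilinearMap.map_add_univ, Finset.sum_eq_single Finset.univ]
    · simp
    · intro B _ hB
      obtain ⟨j, hj⟩ : ∃ j, j ∉ B := by
        by_contra hcon
        push Not at hcon
        exact hB (Finset.eq_univ_iff_forall.2 hcon)
      by_cases hjA : j ∈ A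
      · exact T.map_coord_zero j (by simp [hj, hjA])
      · by_cases hiB : i ∈ B
        · refine hZ n L _ i j (by rintro rfl; exact hjA hi) ?_
          simpa [hiB, hi, hj, hjA] using hFH
        · exact T.map_coord_zero i (by simp [hiB, hi])
    · simp
  have expand : ∀ K : Local s, T (fun _ => F + K) = T (fun _ => K) +
      ∑ A ∈ (Finset.univ : Finset (Finset (Fin n))).erase ∅,
        T (A.piecewise (fun _ => F) (fun _ => K)) := by
    intro K
    have := T.map_add_univ (fun _ => F) (fun _ => K)
    rw [show ((fun _ => F) + fun _ => K : Fin n → Local s) = fun _ => F + K from rfl] at this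
    rw [this, ← Finset.add_sum_erase _ _ (Finset.mem_univ ∅), Finset.piecewise_empty]
  rw [add_assoc F G H, expand (G + H), expand G, Finset.sum_congr rfl fun A hA => key A
    (Finset.nonempty_of_ne_empty (Finset.ne_of_mem_erase hA))]
  abel

/-- Polarization: a symmetric multilinear map is determined by its values on the diagonal. -/
theorem FormalMap.polarization (Z : FormalMap s Y) (n L : ℕ) (F : Fin n → Local s) :
    ∑ B : Finset (Fin n), (-1 : ℤ) ^ B.card • Z.coeff n L (fun _ => ∑ i ∈ Bᶜ, F i) =
      (n.factorial : ℤ) • Z.coeff n L F := by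
  classical
  set T := Z.coeff n L with hT
  have h1 : ∀ B : Finset (Fin n), T (fun _ => ∑ i ∈ Bᶜ, F i) =
      ∑ r : Fin n → Fin n, if B ⊆ (Finset.univ.image r)ᶜ then T (fun i => F (r i)) else 0 := by
    intro B
    rw [T.map_sum_finset (fun _ j => F j) (fun _ => Bᶜ), ← Finset.sum_filter]
    refine Finset.sum_congr (Finset.ext fun r => ?_) fun _ _ => rfl
    simp only [Fintype.mem_piFinset, Finset.mem_compl, Finset.mem_filter, Finset.mem_univ,
      true_and, Finset.subset_iff, Finset.mem_image, not_exists]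
    exact ⟨fun h b hb i hi => h i (hi ▸ hb), fun h i hi => h hi i rfl⟩
  -- the alternating sum over `B` vanishes unless every index is in the image of `r`
  have h2 : ∀ r : Fin n → Fin n, (∑ B : Finset (Fin n), (-1 : ℤ) ^ B.card •
      (if B ⊆ (Finset.univ.image r)ᶜ then T (fun i => F (r i)) else 0)) =
      if Function.Bijective r then T F else 0 := by
    intro r
    have h3 : (∑ B : Finset (Fin n), (-1 : ℤ) ^ B.card •
        (if B ⊆ (Finset.univ.image r)ᶜ then T (fun i => F (r i)) else 0)) =
        (∑ B ∈ ((Finset.univ.image r)ᶜ).powerset, (-1 : ℤ) ^ B.card) • T (fun i => F (r i)) := by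
      rw [Finset.sum_smul]
      simp only [smul_ite, smul_zero]
      rw [← Finset.sum_filter]
      refine Finset.sum_congr (Finset.ext fun B => ?_) fun _ _ => rfl
      simp
    rw [h3, Finset.sum_powerset_neg_one_pow_card]
    have h4 : (Finset.univ.image r)ᶜ = ∅ ↔ Function.Bijective r := by
      rw [Finset.compl_eq_empty_iff, ← Finite.surjective_iff_bijective]
      simp [Finset.eq_univ_iff_forall, Function.Surjective]
    by_cases hr : Function.Bijective r
    · rw [if_pos (h4.2 hr), if_pos hr, one_smul]
      exact Z.symm n L (Equiv.ofBijective r hr) F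
    · rw [if_neg (fun h => hr (h4.1 h)), if_neg hr, zero_smul]
  simp only [h1, Finset.smul_sum]
  rw [Finset.sum_comm]
  simp only [h2]
  rw [← Finset.sum_filter, Finset.sum_const]
  have h5 : (Finset.univ.filter fun r : Fin n → Fin n => Function.Bijective r).card =
      n.factorial := by
    rw [← Fintype.card_subtype,
      ← Fintype.card_congr (Equiv.subtypeEquivRight fun r => Iff.rfl :
        {r : Fin n → Fin n // Function.Bijective r} ≃ _)]
    have e : {r : Fin n → Fin n // Function.Bijective r} ≃ Equiv.Perm (Fin n) :=
      (Equiv.ofBijective (fun σ : Equiv.Perm (Fin n) =>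
        (⟨σ, σ.bijective⟩ : {r : Fin n → Fin n // Function.Bijective r}))
        ⟨fun σ τ h => Equiv.ext fun i => congrFun (congrArg Subtype.val h) i,
          fun r => ⟨Equiv.ofBijective r.1 r.2, rfl⟩⟩).symm
    rw [Fintype.card_congr e, Fintype.card_perm, Fintype.card_fin]
  rw [h5, natCast_zsmul]

/-- A local formal map vanishes off the diagonal: in the polarization formula, the four terms which
differ in whether they contain `F_i` and `F_j` cancel by locality. -/
theorem LocalMap.offDiagonal {Z : FormalMap s (Local s)} (hZ : LocalMap Z) : OffDiagonal Z := by
  classical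
  intro n L F i j hij hd
  have h := Z.polarization n L F
  have h0 : ∑ B : Finset (Fin n), (-1 : ℤ) ^ B.card • Z.coeff n L (fun _ => ∑ i ∈ Bᶜ, F i) =
      0 := by
    set R : Finset (Fin n) := (Finset.univ.erase i).erase j with hR
    have hjR : j ∉ R := Finset.notMem_erase _ _
    have hiR : i ∉ insert j R := by
      rw [hR, Finset.insert_erase (Finset.mem_erase.2 ⟨hij.symm, Finset.mem_univ j⟩)]
      exact Finset.notMem_erase _ _
    have huniv : (Finset.univ : Finset (Finset (Fin n))) = (insert i (insert j R)).powerset := by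
      rw [hR, Finset.insert_erase (Finset.mem_erase.2 ⟨hij.symm, Finset.mem_univ j⟩),
        Finset.insert_erase (Finset.mem_univ i), Finset.powerset_univ]
    rw [huniv, Finset.sum_powerset_insert hiR, Finset.sum_powerset_insert hjR,
      Finset.sum_powerset_insert hjR, ← Finset.sum_add_distrib, ← Finset.sum_add_distrib,
      ← Finset.sum_add_distrib]
    refine Finset.sum_eq_zero fun B hB => ?_
    rw [Finset.mem_powerset] at hB
    have hjB : j ∉ B := fun h => hjR (hB h)
    have hiB : i ∉ B := fun h => hiR (Finset.mem_insert_of_mem (hB h))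
    have hijB : i ∉ insert j B := by
      rw [Finset.mem_insert, not_or]
      exact ⟨hij, hiB⟩
    have c1 : Bᶜ = insert i (insert j (insert i (insert j B))ᶜ) := by
      ext a; simp only [Finset.mem_compl, Finset.mem_insert]
      by_cases h1 : a = i
      · subst h1; simp [hiB]
      · by_cases h2 : a = j
        · subst h2; simp [hjB]
        · simp [h1, h2]
    have c2 : (insert j B)ᶜ = insert i (insert i (insert j B))ᶜ := by
      ext a; simp only [Finset.mem_compl, Finset.mem_insert]
      by_cases h1 : a = i
      · subst h1; simp [hiB, hij]
      · simp [h1]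
    have c3 : (insert i B)ᶜ = insert j (insert i (insert j B))ᶜ := by
      ext a; simp only [Finset.mem_compl, Finset.mem_insert]
      by_cases h1 : a = j
      · subst h1; simp [hjB, hij.symm]
      · simp [h1]
    have n1 : j ∉ (insert i (insert j B))ᶜ := by simp
    have n2 : i ∉ insert j (insert i (insert j B))ᶜ := by simp [hij]
    have n3 : i ∉ (insert i (insert j B))ᶜ := by simp
    rw [Finset.card_insert_of_notMem hijB, Finset.card_insert_of_notMem hjB,
      Finset.card_insert_of_notMem hiB, c1, c2, c3, Finset.sum_insert n2, Finset.sum_insert n1,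
      Finset.sum_insert n3]
    set G := ∑ a ∈ (insert i (insert j B))ᶜ, F a
    have := hZ n L (F i) G (F j) hd
    rw [show F i + (F j + G) = F i + G + F j by abel, this, add_comm (F j) G]
    simp only [pow_succ, mul_smul, neg_smul, one_smul]
    module
  rw [h0] at h
  have h7 : (n.factorial : ℂ) • Z.coeff n L F = 0 := by
    rw [Nat.cast_smul_eq_nsmul, ← natCast_zsmul]
    exact h.symm
  exact (smul_eq_zero.1 h7).resolve_left (by exact_mod_cast n.factorial_ne_zero)

/-! ### The properties which are preserved by composition -/

/-- Field independence, `φ`-locality and covariance, the properties common to the elements of the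
renormalization group and to S-matrices. -/
structure Equivariant (𝒢 : Subgroup (Mink s ≃ᵃ[ℝ] Mink s)) (Z : FormalMap s Y) : Prop where
  field_independent : FieldIndependent Z
  phi_local : PhiLocal Z
  covariant : Covariant 𝒢 Z

/-- Field independence, `φ`-locality, covariance, and vanishing off the diagonal. In contrast to
membership in the renormalization group, these conditions are linear in the formal map. -/
structure Tame (𝒢 : Subgroup (Mink s ≃ᵃ[ℝ] Mink s)) (Z : FormalMap s (Local s)) : Prop
    extends Equivariant 𝒢 Z where
  offDiagonal : OffDiagonal Z

variable {𝒢 : Subgroup (Mink s ≃ᵃ[ℝ] Mink s)}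

theorem RenormGroup.tame {Z : FormalMap s (Local s)} (hZ : RenormGroup 𝒢 Z) : Tame 𝒢 Z :=
  ⟨⟨hZ.field_independent, hZ.phi_local, hZ.covariant⟩, hZ.isLocal.offDiagonal⟩

theorem local_le_microcausal : Local s ≤ Microcausal s := fun _ h => h.1

theorem FieldIndependent.dirDeriv_eq {Z : FormalMap s Y} (hZ : FieldIndependent Z) {n : ℕ} (L : ℕ)
    (F : Fin n → Local s) (ψ : Config s) :
    dirDeriv (Z.coeff n L F).1 ψ =
      (∑ k, Z.coeff n L (Function.update F k (localDeriv (F k) ψ)) : Y).1 := by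
  funext φ
  have := hZ n L F (fun k => localDeriv (F k) ψ) ψ (fun _ _ => rfl) φ
  rw [Submodule.coe_sum, Finset.sum_apply]
  exact this

/-- The values of a formal map of the renormalization group are supported in the intersection of
the supports of its arguments: varying the field outside of the support of `F_i` amounts, by field
independence, to replacing arguments by functionals supported away from `F_i`. -/
theorem Tame.spaceSupport_subset {Z : FormalMap s (Local s)} (hZ : Tame 𝒢 Z) {n : ℕ} (L : ℕ)
    (F : Fin n → Local s) (i : Fin n) :
    spaceSupport (Z.coeff n L F).1 ⊆ spaceSupport (F i).1 := by
  intro x hx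
  by_contra hxi
  obtain ⟨φ, ψ, h1, h2⟩ := hx _ ((isClosed_spaceSupport (F i).1).isOpen_compl.mem_nhds hxi)
  refine h2 ((Z.coeff n L F).2.1.1.eq_of_dirDeriv_eq_zero φ ψ fun φ' => ?_)
  have hd : Disjoint (tsupport (ψ : Mink s → ℝ)) (spaceSupport (F i).1) :=
    Set.disjoint_left.2 h1
  rw [hZ.field_independent.dirDeriv_eq, Finset.sum_eq_zero]
  · rfl
  · intro k _
    rcases eq_or_ne k i with rfl | hk
    · refine MultilinearMap.map_coord_zero _ k ?_
      rw [Function.update_self]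
      exact Subtype.ext (dirDeriv_eq_zero_of_disjoint (F k).2.1.1.continuous hd)
    · refine hZ.offDiagonal n L _ k i hk ?_
      rw [Function.update_self, Function.update_of_ne hk.symm]
      exact hd.mono_left (spaceSupport_dirDeriv_subset_tsupport (F k).2.2.1 ψ)

/-- The derivatives of `F` of order less than `v` vanish at `φ`. -/
def VanishesTo (F : Config s → ℂ) (φ : Config s) (v : ℕ) : Prop :=
  ∀ k < v, ∀ ψ : Fin k → Config s, funcDeriv F k φ ψ = 0

theorem VanishesTo.dirDeriv {F : Config s → ℂ} {φ : Config s} {v : ℕ} (h : VanishesTo F φ v)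
    (ψ : Config s) : VanishesTo (dirDeriv F ψ) φ (v - 1) := by
  intro k hk χ
  rw [funcDeriv_dirDeriv]
  exact h (k + 1) (by omega) _

/-- A functional differential operator of order at most `2L` lowers the order of vanishing by at
most `2L`. -/
theorem Equivariant.vanishesTo (hY : Y ≤ Microcausal s) {Z : FormalMap s Y}
    (hZ : Equivariant 𝒢 Z) {n : ℕ} (L : ℕ) (F : Fin n → Local s) (φ : Config s) (v : Fin n → ℕ)
    (hv : ∀ i, VanishesTo (F i).1 φ (v i)) :
    VanishesTo (Z.coeff n L F).1 φ (∑ i, v i - 2 * L) := by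
  intro k
  induction k generalizing F v with
  | zero =>
    intro hk ψ
    exact hZ.phi_local n L F φ v hv (by omega)
  | succ k ih =>
    intro hk ψ
    rw [funcDeriv_succ_eq, hZ.field_independent.dirDeriv_eq, Submodule.coe_sum,
      (SmoothFunctional.sum Finset.univ fun i _ => (hY (Z.coeff n L _).2).1).2]
    refine Finset.sum_eq_zero fun i _ => ?_
    refine ih _ (Function.update v i (v i - 1)) (fun j => ?_) ?_ _
    · rcases eq_or_ne j i with rfl | hj
      · rw [Function.update_self, Function.update_self]
        exact (hv j).dirDeriv _
      · rw [Function.update_of_ne hj, Function.update_of_ne hj]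
        exact hv j
    · have h1 : ∑ j, v j = v i + ∑ j ∈ Finset.univ.erase i, v j :=
        (Finset.add_sum_erase _ _ (Finset.mem_univ i)).symm
      have h2 : ∑ j, Function.update v i (v i - 1) j =
          (v i - 1) + ∑ j ∈ Finset.univ.erase i, v j := by
        rw [← Finset.add_sum_erase _ _ (Finset.mem_univ i), Function.update_self]
        congr 1
        refine Finset.sum_congr rfl fun j hj => ?_
        rw [Function.update_of_ne (Finset.ne_of_mem_erase hj)]
      omega

/-! ### Stability under composition -/

/-- One term of the composition of formal maps: the orders in `ħ` are `p.1` for the first factor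
and `p.2 I` for the block `I`. -/
def blockTerm (S : FormalMap s Y) (Z : FormalMap s (Local s)) {n : ℕ} (P : OrderedFinpartition n)
    (p : ℕ × (Fin P.length → ℕ)) (F : Fin n → Local s) : Y :=
  S.coeff P.length p.1 (fun I => Z.coeff (P.partSize I) (p.2 I) (fun i => F (P.emb I i)))

theorem partTerm_eq_sum (S : FormalMap s Y) (Z : FormalMap s (Local s)) {n : ℕ}
    (P : OrderedFinpartition n) (L : ℕ) (F : Fin n → Local s) :
    partTerm S Z P L F = ∑ p ∈ hIndex P.length L, blockTerm S Z P p F :=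
  sum_hIndex P.length L (fun a l => S.coeff P.length a
    (fun I => Z.coeff (P.partSize I) (l I) (fun i => F (P.emb I i))))

/-- The pairs of a partition and a distribution of orders in `ħ`. -/
def compIndex (n L : ℕ) : Finset ((P : OrderedFinpartition n) × (ℕ × (Fin P.length → ℕ))) :=
  Finset.univ.sigma fun P => hIndex P.length L

theorem comp_coeff_eq_sum (S : FormalMap s Y) (Z : FormalMap s (Local s)) (n L : ℕ)
    (F : Fin n → Local s) :
    (S.comp Z).coeff n L F = ∑ q ∈ compIndex n L, blockTerm S Z q.1 q.2 F := by
  rw [FormalMap.comp_coeff, compCoeff, compIndex, Finset.sum_sigma]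
  simp only [partTerm_eq_sum]

theorem FieldIndependent.comp (hY : Y ≤ Microcausal s) {S : FormalMap s Y}
    {Z : FormalMap s (Local s)} (hS : FieldIndependent S) (hZ : FieldIndependent Z) :
    FieldIndependent (S.comp Z) := by
  intro n L F F' ψ hF φ
  simp only [comp_coeff_eq_sum, Submodule.coe_sum, Finset.sum_apply]
  rw [(SmoothFunctional.sum _ fun q _ => (hY (blockTerm S Z q.1 q.2 F).2).1).2, Finset.sum_comm]
  refine Finset.sum_congr rfl fun q _ => ?_
  obtain ⟨P, p⟩ := q
  have h1 := hS P.length p.1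
    (fun I => Z.coeff (P.partSize I) (p.2 I) (fun i => F (P.emb I i)))
    (fun I => ∑ i, Z.coeff (P.partSize I) (p.2 I)
      (Function.update (fun i => F (P.emb I i)) i (F' (P.emb I i)))) ψ (fun I φ => by
        rw [hZ (P.partSize I) (p.2 I) (fun i => F (P.emb I i)) (fun i => F' (P.emb I i)) ψ
          (fun k φ => hF _ φ) φ, Submodule.coe_sum, Finset.sum_apply]) φ
  refine h1.trans ?_
  rw [← P.equivSigma.sum_comp, Fintype.sum_sigma]
  refine Finset.sum_congr rfl fun I _ => ?_
  rw [MultilinearMap.map_update_sum, Submodule.coe_sum, Finset.sum_apply]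
  refine Finset.sum_congr rfl fun i _ => ?_
  have h2 : P.equivSigma ⟨I, i⟩ = P.emb I i := rfl
  have h3 : (⟨P.index (P.emb I i), P.invEmbedding (P.emb I i)⟩ : (I : Fin P.length) × Fin
      (P.partSize I)) = ⟨I, i⟩ := P.equivSigma.symm_apply_apply ⟨I, i⟩
  simp only [h2, blockTerm]
  rw [blockFun_update P (fun I x => Z.coeff (P.partSize I) (p.2 I) x) F (P.emb I i)]
  have h4 : ∀ q : (I : Fin P.length) × Fin (P.partSize I), q = ⟨I, i⟩ →
      Function.update (fun I => Z.coeff (P.partSize I) (p.2 I) fun i => F (P.emb I i)) I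
        (Z.coeff (P.partSize I) (p.2 I)
          (Function.update (fun i => F (P.emb I i)) i (F' (P.emb I i)))) =
      Function.update (fun I => Z.coeff (P.partSize I) (p.2 I) fun i => F (P.emb I i)) q.1
        (Z.coeff (P.partSize q.1) (p.2 q.1)
          (Function.update (fun i => F (P.emb q.1 i)) q.2 (F' (P.emb I i)))) := by
    rintro q rfl
    rfl
  exact congrArg (fun x => (S.coeff P.length p.1 x).1 φ) (h4 _ h3)

theorem PhiLocal.comp {S : FormalMap s Y} {Z : FormalMap s (Local s)} (hS : PhiLocal S)
    (hZ : Equivariant 𝒢 Z) : PhiLocal (S.comp Z) := by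
  intro n L F φ v hv hL
  rw [comp_coeff_eq_sum, Submodule.coe_sum, Finset.sum_apply]
  refine Finset.sum_eq_zero fun q hq => ?_
  obtain ⟨P, p⟩ := q
  have hp := mem_hIndex.1 (Finset.mem_sigma.1 hq).2
  refine hS P.length p.1 _ φ
    (fun I => ∑ i, v (P.emb I i) - 2 * p.2 I) (fun I =>
      hZ.vanishesTo local_le_microcausal (p.2 I) (fun i => F (P.emb I i)) φ
        (fun i => v (P.emb I i)) (fun i => hv _)) ?_
  have h1 : ∑ I, ∑ i, v (P.emb I i) = ∑ i, v i := P.sum_sigma_eq_sum v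
  have h2 : ∑ I, ∑ i, v (P.emb I i) ≤
      ∑ I, ((∑ i, v (P.emb I i) - 2 * p.2 I) + 2 * p.2 I) :=
    Finset.sum_le_sum fun I _ => by omega
  rw [Finset.sum_add_distrib, ← Finset.mul_sum] at h2
  simp only at hp
  omega

theorem Equivariant.comp (hY : Y ≤ Microcausal s) {S : FormalMap s Y}
    {Z : FormalMap s (Local s)} (hS : Equivariant 𝒢 S) (hZ : Equivariant 𝒢 Z) :
    Equivariant 𝒢 (S.comp Z) := by
  refine ⟨hS.field_independent.comp hY hZ.field_independent, hS.phi_local.comp hZ, ?_⟩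
  intro g hg n L F F' hF φ
  simp only [comp_coeff_eq_sum, Submodule.coe_sum, Finset.sum_apply]
  refine Finset.sum_congr rfl fun q _ => ?_
  obtain ⟨P, p⟩ := q
  exact hS.covariant g hg P.length p.1 _ _ (fun I φ =>
    hZ.covariant g hg (P.partSize I) (p.2 I) _ _ (fun i φ => hF _ φ) φ) φ

theorem Tame.comp {S Z : FormalMap s (Local s)} (hS : Tame 𝒢 S) (hZ : Tame 𝒢 Z) :
    Tame 𝒢 (S.comp Z) := by
  refine ⟨hS.toEquivariant.comp local_le_microcausal hZ.toEquivariant, ?_⟩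
  intro n L F i j hij hd
  rw [comp_coeff_eq_sum]
  refine Finset.sum_eq_zero fun q _ => ?_
  obtain ⟨P, p⟩ := q
  by_cases h : P.index i = P.index j
  · -- both arguments lie in the same block
    obtain ⟨⟨I, a⟩, rfl⟩ := P.equivSigma.surjective i
    obtain ⟨⟨J, b⟩, rfl⟩ := P.equivSigma.surjective j
    have h1 : (P.equivSigma.symm (P.equivSigma ⟨I, a⟩)).1 =
      (P.equivSigma.symm (P.equivSigma ⟨J, b⟩)).1 := h
    rw [Equiv.symm_apply_apply, Equiv.symm_apply_apply] at h1
    dsimp only at h1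
    subst h1
    refine MultilinearMap.map_coord_zero _ I ?_
    refine hZ.offDiagonal _ _ _ a b ?_ hd
    rintro rfl
    exact hij rfl
  · refine hS.offDiagonal _ _ _ (P.index i) (P.index j) h (hd.mono ?_ ?_)
    · refine (hZ.spaceSupport_subset _ _ (P.invEmbedding i)).trans ?_
      rw [P.emb_invEmbedding]
    · refine (hZ.spaceSupport_subset _ _ (P.invEmbedding j)).trans ?_
      rw [P.emb_invEmbedding]

end

/-! ### Causal factorization of compositions -/

section

variable {s : ℕ} {𝒢 : Subgroup (Mink s ≃ᵃ[ℝ] Mink s)}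

/-- The pairing `⟨F^{(r)}(φ), Δ_+^{⊗ r} G^{(r)}(φ)⟩ / r!`. -/
def starTerm (m : ℝ) (r : ℕ) (F G : Config s → ℂ) (φ : Config s) : ℂ :=
  ((r.factorial : ℂ))⁻¹ *
    ∫ p, wightmanIntegrand (r := r) m (funcDeriv F r φ) (funcDeriv G r φ) p

theorem wightmanIntegrand_zero_left (m : ℝ) (r : ℕ) (G : Config s → ℂ) (φ : Config s) :
    wightmanIntegrand (r := r) m (funcDeriv (0 : Config s → ℂ) r φ) (funcDeriv G r φ) = 0 := by
  funext p
  rw [show funcDeriv (0 : Config s → ℂ) r φ = fun _ => 0 from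
    funext fun v => funcDeriv_zero r φ v]
  simp [wightmanIntegrand, localFourier_zero]

theorem wightmanIntegrand_zero_right (m : ℝ) (r : ℕ) (F : Config s → ℂ) (φ : Config s) :
    wightmanIntegrand (r := r) m (funcDeriv F r φ) (funcDeriv (0 : Config s → ℂ) r φ) = 0 := by
  funext p
  rw [show funcDeriv (0 : Config s → ℂ) r φ = fun _ => 0 from
    funext fun v => funcDeriv_zero r φ v]
  simp [wightmanIntegrand, localFourier_zero]

theorem wightmanIntegrand_add_left (m : ℝ) (r : ℕ) {F F' : Config s → ℂ}
    (hF : SmoothFunctional F) (hF' : SmoothFunctional F') (G : Config s → ℂ) (φ : Config s) :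
    wightmanIntegrand (r := r) m (funcDeriv (F + F') r φ) (funcDeriv G r φ) =
      wightmanIntegrand (r := r) m (funcDeriv F r φ) (funcDeriv G r φ) +
        wightmanIntegrand (r := r) m (funcDeriv F' r φ) (funcDeriv G r φ) := by
  funext p
  rw [show funcDeriv (F + F') r φ = fun v => funcDeriv F r φ v + funcDeriv F' r φ v from
    funext fun v => funcDeriv_add hF hF' r φ v]
  simp only [wightmanIntegrand, localFourier_add, Pi.add_apply]
  ring

theorem wightmanIntegrand_add_right (m : ℝ) (r : ℕ) (F : Config s → ℂ) {G G' : Config s → ℂ}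
    (hG : SmoothFunctional G) (hG' : SmoothFunctional G') (φ : Config s) :
    wightmanIntegrand (r := r) m (funcDeriv F r φ) (funcDeriv (G + G') r φ) =
      wightmanIntegrand (r := r) m (funcDeriv F r φ) (funcDeriv G r φ) +
        wightmanIntegrand (r := r) m (funcDeriv F r φ) (funcDeriv G' r φ) := by
  funext p
  rw [show funcDeriv (G + G') r φ = fun v => funcDeriv G r φ v + funcDeriv G' r φ v from
    funext fun v => funcDeriv_add hG hG' r φ v]
  simp only [wightmanIntegrand, localFourier_add, Pi.add_apply]
  ring

theorem starTerm_zero_left (m : ℝ) (r : ℕ) (G : Config s → ℂ) (φ : Config s) :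
    starTerm m r 0 G φ = 0 := by
  simp [starTerm, wightmanIntegrand_zero_left]

theorem starTerm_zero_right (m : ℝ) (r : ℕ) (F : Config s → ℂ) (φ : Config s) :
    starTerm m r F 0 φ = 0 := by
  simp [starTerm, wightmanIntegrand_zero_right]

theorem IsStarCoeff.add_left {m : ℝ} {A A' B : ℕ → Config s → ℂ} {L : ℕ} {φ : Config s}
    {C C' : ℂ} (hA : ∀ a, SmoothFunctional (A a)) (hA' : ∀ a, SmoothFunctional (A' a))
    (h : IsStarCoeff m A B L φ C) (h' : IsStarCoeff m A' B L φ C') :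
    IsStarCoeff m (fun a => A a + A' a) B L φ (C + C') := by
  refine ⟨fun r a b hr => ?_, ?_⟩
  · rw [wightmanIntegrand_add_left m r (hA a) (hA' a)]
    exact (h.1 r a b hr).add (h'.1 r a b hr)
  · rw [h.2, h'.2, ← Finset.sum_add_distrib]
    refine Finset.sum_congr rfl fun i hi => ?_
    rw [← Finset.sum_add_distrib]
    refine Finset.sum_congr rfl fun j hj => ?_
    rw [Finset.HasAntidiagonal.mem_antidiagonal] at hi hj
    have hL : i.1 + (j.1 + j.2) = L := by rw [hj, hi]
    rw [wightmanIntegrand_add_left m i.1 (hA j.1) (hA' j.1), ← mul_add]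
    congr 1
    exact (MeasureTheory.integral_add (h.1 i.1 j.1 j.2 hL) (h'.1 i.1 j.1 j.2 hL)).symm

theorem IsStarCoeff.add_right {m : ℝ} {A B B' : ℕ → Config s → ℂ} {L : ℕ} {φ : Config s}
    {C C' : ℂ} (hB : ∀ b, SmoothFunctional (B b)) (hB' : ∀ b, SmoothFunctional (B' b))
    (h : IsStarCoeff m A B L φ C) (h' : IsStarCoeff m A B' L φ C') :
    IsStarCoeff m A (fun b => B b + B' b) L φ (C + C') := by
  refine ⟨fun r a b hr => ?_, ?_⟩
  · rw [wightmanIntegrand_add_right m r _ (hB b) (hB' b)]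
    exact (h.1 r a b hr).add (h'.1 r a b hr)
  · rw [h.2, h'.2, ← Finset.sum_add_distrib]
    refine Finset.sum_congr rfl fun i hi => ?_
    rw [← Finset.sum_add_distrib]
    refine Finset.sum_congr rfl fun j hj => ?_
    rw [Finset.HasAntidiagonal.mem_antidiagonal] at hi hj
    have hL : i.1 + (j.1 + j.2) = L := by rw [hj, hi]
    rw [wightmanIntegrand_add_right m i.1 _ (hB j.2) (hB' j.2), ← mul_add]
    congr 1
    exact (MeasureTheory.integral_add (h.1 i.1 j.1 j.2 hL) (h'.1 i.1 j.1 j.2 hL)).symm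

theorem IsStarCoeff.zero_left (m : ℝ) (B : ℕ → Config s → ℂ) (L : ℕ) (φ : Config s) :
    IsStarCoeff m (fun _ => 0) B L φ 0 := by
  refine ⟨fun r a b _ => ?_, ?_⟩
  · rw [wightmanIntegrand_zero_left]
    exact MeasureTheory.integrable_zero _ _ _
  · symm
    refine Finset.sum_eq_zero fun i _ => Finset.sum_eq_zero fun j _ => ?_
    exact starTerm_zero_left m i.1 (B j.2) φ

theorem IsStarCoeff.zero_right (m : ℝ) (A : ℕ → Config s → ℂ) (L : ℕ) (φ : Config s) :
    IsStarCoeff m A (fun _ => 0) L φ 0 := by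
  refine ⟨fun r a b _ => ?_, ?_⟩
  · rw [wightmanIntegrand_zero_right]
    exact MeasureTheory.integrable_zero _ _ _
  · symm
    refine Finset.sum_eq_zero fun i _ => Finset.sum_eq_zero fun j _ => ?_
    exact starTerm_zero_right m i.1 (A j.1) φ

theorem IsStarCoeff.shift_zero_left (m : ℝ) {A B : ℕ → Config s → ℂ} (φ : Config s)
    (h0 : A 0 = 0) : IsStarCoeff m A B 0 φ 0 := by
  refine ⟨fun r a b h => ?_, ?_⟩
  · obtain rfl : a = 0 := by omega
    rw [h0, wightmanIntegrand_zero_left]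
    exact MeasureTheory.integrable_zero _ _ _
  · simp [h0, wightmanIntegrand_zero_left]

theorem IsStarCoeff.shift_zero_right (m : ℝ) {A B : ℕ → Config s → ℂ} (φ : Config s)
    (h0 : B 0 = 0) : IsStarCoeff m A B 0 φ 0 := by
  refine ⟨fun r a b h => ?_, ?_⟩
  · obtain rfl : b = 0 := by omega
    rw [h0, wightmanIntegrand_zero_right]
    exact MeasureTheory.integrable_zero _ _ _
  · simp [h0, wightmanIntegrand_zero_right]

theorem IsStarCoeff.shift_left {m : ℝ} {A A' B : ℕ → Config s → ℂ} {L : ℕ} {φ : Config s}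
    {C : ℂ} (h : IsStarCoeff m A B L φ C) (h0 : A' 0 = 0) (hs : ∀ a, A' (a + 1) = A a) :
    IsStarCoeff m A' B (L + 1) φ C := by
  refine ⟨fun r a b hr => ?_, ?_⟩
  · cases a with
    | zero =>
      rw [h0, wightmanIntegrand_zero_left]
      exact MeasureTheory.integrable_zero _ _ _
    | succ a =>
      rw [hs]
      exact h.1 r a b (by omega)
  · rw [h.2, Finset.Nat.sum_antidiagonal_succ']
    simp only [Finset.Nat.antidiagonal_zero, Finset.sum_singleton, h0,
      Finset.Nat.sum_antidiagonal_succ, hs, wightmanIntegrand_zero_left, Pi.zero_apply,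
      MeasureTheory.integral_zero, mul_zero, zero_add]

theorem IsStarCoeff.shift_right {m : ℝ} {A B B' : ℕ → Config s → ℂ} {L : ℕ} {φ : Config s}
    {C : ℂ} (h : IsStarCoeff m A B L φ C) (h0 : B' 0 = 0) (hs : ∀ b, B' (b + 1) = B b) :
    IsStarCoeff m A B' (L + 1) φ C := by
  refine ⟨fun r a b hr => ?_, ?_⟩
  · cases b with
    | zero =>
      rw [h0, wightmanIntegrand_zero_right]
      exact MeasureTheory.integrable_zero _ _ _
    | succ b =>
      rw [hs]
      exact h.1 r a b (by omega)
  · rw [h.2, Finset.Nat.sum_antidiagonal_succ']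
    simp only [Finset.Nat.antidiagonal_zero, Finset.sum_singleton, h0,
      Finset.Nat.sum_antidiagonal_succ', hs, wightmanIntegrand_zero_right, Pi.zero_apply,
      MeasureTheory.integral_zero, mul_zero, zero_add]

theorem IsStarCoeff.sum_left {m : ℝ} {ι : Type*} (t : Finset ι) {A : ι → ℕ → Microcausal s}
    {B : ℕ → Config s → ℂ} {L : ℕ} {φ : Config s} {C : ι → ℂ}
    (h : ∀ i ∈ t, IsStarCoeff m (fun a => (A i a).1) B L φ (C i)) :
    IsStarCoeff m (fun a => (∑ i ∈ t, A i a : Microcausal s).1) B L φ (∑ i ∈ t, C i) := by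
  classical
  induction t using Finset.induction_on with
  | empty => exact IsStarCoeff.zero_left m B L φ
  | insert i t hi ih =>
    simp only [Finset.sum_insert hi]
    exact (h i (Finset.mem_insert_self i t)).add_left (fun a => (A i a).2.1)
      (fun a => (∑ j ∈ t, A j a : Microcausal s).2.1)
      (ih fun j hj => h j (Finset.mem_insert_of_mem hj))

theorem IsStarCoeff.sum_right {m : ℝ} {ι : Type*} (t : Finset ι) {A : ℕ → Config s → ℂ}
    {B : ι → ℕ → Microcausal s} {L : ℕ} {φ : Config s} {C : ι → ℂ}
    (h : ∀ i ∈ t, IsStarCoeff m A (fun b => (B i b).1) L φ (C i)) :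
    IsStarCoeff m A (fun b => (∑ i ∈ t, B i b : Microcausal s).1) L φ (∑ i ∈ t, C i) := by
  classical
  induction t using Finset.induction_on with
  | empty => exact IsStarCoeff.zero_right m A L φ
  | insert i t hi ih =>
    simp only [Finset.sum_insert hi]
    exact (h i (Finset.mem_insert_self i t)).add_right (fun a => (B i a).2.1)
      (fun a => (∑ j ∈ t, B j a : Microcausal s).2.1)
      (ih fun j hj => h j (Finset.mem_insert_of_mem hj))

theorem Later.disjoint {K K' : Set (Mink s)} (h : Later K K') : Disjoint K K' := by
  refine Set.disjoint_left.2 fun x hx hx' => h x hx x hx' ?_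
  simp [forwardCone]

theorem update_castAdd_castAdd {α : Type*} {k l : ℕ} (z : Fin (k + l) → α) (i : Fin k) (u : α) :
    (fun a => Function.update z (Fin.castAdd l i) u (Fin.castAdd l a)) =
      Function.update (fun a => z (Fin.castAdd l a)) i u :=
  Function.update_comp_eq_of_injective z (Fin.castAdd_injective k l) i u

theorem update_castAdd_natAdd {α : Type*} {k l : ℕ} (z : Fin (k + l) → α) (i : Fin k) (u : α) :
    (fun b => Function.update z (Fin.castAdd l i) u (Fin.natAdd k b)) =
      fun b => z (Fin.natAdd k b) := by
  funext b
  refine Function.update_of_ne (fun h => ?_) _ _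
  have := congrArg Fin.val h
  simp only [Fin.val_natAdd, Fin.val_castAdd] at this
  omega

theorem update_natAdd_natAdd {α : Type*} {k l : ℕ} (z : Fin (k + l) → α) (j : Fin l) (u : α) :
    (fun b => Function.update z (Fin.natAdd k j) u (Fin.natAdd k b)) =
      Function.update (fun b => z (Fin.natAdd k b)) j u :=
  Function.update_comp_eq_of_injective z (Fin.natAdd_injective l k) j u

theorem update_natAdd_castAdd {α : Type*} {k l : ℕ} (z : Fin (k + l) → α) (j : Fin l) (u : α) :
    (fun a => Function.update z (Fin.natAdd k j) u (Fin.castAdd l a)) =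
      fun a => z (Fin.castAdd l a) := by
  funext a
  refine Function.update_of_ne (fun h => ?_) _ _
  have := congrArg Fin.val h
  simp only [Fin.val_natAdd, Fin.val_castAdd] at this
  omega

/-- Causal factorization for arguments which are formal power series in `ħ`. -/
theorem Causal.ext {m : ℝ} {S : FormalMap s (Microcausal s)} (hS : Causal m S) {k l : ℕ}
    (x : Fin k → ℕ → Local s) (y : Fin l → ℕ → Local s)
    (hxy : ∀ i a j b, Later (spaceSupport (x i a).1) (spaceSupport (y j b).1)) (L : ℕ)
    (φ : Config s) :
    IsStarCoeff m (fun a => (S.ext k x a).1) (fun b => (S.ext l y b).1) L φ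
      ((S.ext (k + l) (Fin.append x y) L).1 φ) := by
  have key := hbar_induction
    (Fin.addCases (fun _ : Fin k => {F : Local s | spaceSupport F.1 ⊆ ⋃ i, ⋃ a,
      spaceSupport (x i a).1}) (fun _ : Fin l => {F : Local s | spaceSupport F.1 ⊆ ⋃ j, ⋃ b,
      spaceSupport (y j b).1})) ?_
    (fun L z => IsStarCoeff m (fun a => (S.ext k (fun i => z (Fin.castAdd l i)) a).1)
      (fun b => (S.ext l (fun j => z (Fin.natAdd k j)) b).1) L φ ((S.ext (k + l) z L).1 φ))
    ?_ ?_ ?_ ?_ L (Fin.append x y) ?_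
  · simpa only [Fin.append_left, Fin.append_right] using key
  · refine Fin.addCases (fun i => ?_) (fun j => ?_)
    · rw [Fin.addCases_left]
      exact spaceSupport_zero.trans_subset (empty_subset _)
    · rw [Fin.addCases_right]
      exact spaceSupport_zero.trans_subset (empty_subset _)
  · intro L H hH
    simp only [FormalMap.ext_hConst]
    have h := hS k l (fun i => H (Fin.castAdd l i)) (fun j => H (Fin.natAdd k j)) ?_ L φ
    · rwa [Fin.append_castAdd_natAdd] at h
    · intro i j u hu v hv
      have h1 := hH (Fin.castAdd l i)
      have h2 := hH (Fin.natAdd k j)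
      rw [Fin.addCases_left] at h1
      rw [Fin.addCases_right] at h2
      obtain ⟨i', hi'⟩ := mem_iUnion.1 (h1 hu)
      obtain ⟨a, ha⟩ := mem_iUnion.1 hi'
      obtain ⟨j', hj'⟩ := mem_iUnion.1 (h2 hv)
      obtain ⟨b, hb⟩ := mem_iUnion.1 hj'
      exact hxy i' a j' b u ha v hb
  · intro L z i
    refine Fin.addCases (fun i u v => ?_) (fun j u v => ?_) i
    · simp only [update_castAdd_castAdd, update_castAdd_natAdd, FormalMap.ext_update_add]
      exact IsStarCoeff.add_left (fun a => (S.ext _ _ a).2.1) (fun a => (S.ext _ _ a).2.1)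
    · simp only [update_natAdd_castAdd, update_natAdd_natAdd, FormalMap.ext_update_add]
      exact IsStarCoeff.add_right (fun a => (S.ext _ _ a).2.1) (fun a => (S.ext _ _ a).2.1)
  · intro z i
    refine Fin.addCases (fun i u => ?_) (fun j u => ?_) i
    · simp only [update_castAdd_castAdd, update_castAdd_natAdd, FormalMap.ext_update_hShift]
      exact IsStarCoeff.shift_zero_left m φ rfl
    · simp only [update_natAdd_castAdd, update_natAdd_natAdd, FormalMap.ext_update_hShift]
      exact IsStarCoeff.shift_zero_right m φ rfl
  · intro L z i
    refine Fin.addCases (fun i u => ?_) (fun j u => ?_) i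
    · simp only [update_castAdd_castAdd, update_castAdd_natAdd, FormalMap.ext_update_hShift]
      exact fun h => h.shift_left rfl fun _ => rfl
    · simp only [update_natAdd_castAdd, update_natAdd_natAdd, FormalMap.ext_update_hShift]
      exact fun h => h.shift_right rfl fun _ => rfl
  · refine Fin.addCases (fun i a => ?_) (fun j b => ?_)
    · rw [Fin.addCases_left, Fin.append_left]
      exact subset_iUnion_of_subset i (subset_iUnion_of_subset a subset_rfl)
    · rw [Fin.addCases_right, Fin.append_right]
      exact subset_iUnion_of_subset j (subset_iUnion_of_subset b subset_rfl)

theorem famVal_append {α : Type*} {k l : ℕ} (x : Fin k → α) (y : Fin l → α) :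
    famVal (Fin.append x y) = famVal x + famVal y := by
  rw [famVal, List.ofFn_fin_append, ← Multiset.coe_add]

/-- Causal factorization is stable under composition with maps which vanish off the diagonal:
the partitions with a block that contains arguments from both groups do not contribute. -/
theorem Causal.comp {m : ℝ} {S : FormalMap s (Microcausal s)} (hS : Causal m S)
    {Z : FormalMap s (Local s)} (hZ : Tame 𝒢 Z) : Causal m (S.comp Z) := by
  intro k l F G hFG L φ
  set H : Fin (k + l) → Local s := Fin.append F G with hH
  set Φ : MvPolynomial (Multiset (Fin (k + l))) ℂ →ₗ[ℂ] (ℕ → Microcausal s) :=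
    monLin fun β => S.onMultiset (β.map fun B => Z.onMultiset (B.map fun i => hConst (H i)))
    with hΦ
  have hblock : ∀ {n : ℕ} (b : Fin n → Fin (k + l)),
      Z.onMultiset ((famVal b).map fun i => hConst (H i)) =
        fun L => Z.coeff n L fun i => H (b i) := by
    intro n b
    rw [famVal_map, Z.onMultiset_famVal]
    funext L
    exact Z.ext_hConst (fun i => H (b i)) L
  have hlater : ∀ i j : Fin (k + l), (i : ℕ) < k → ¬ (j : ℕ) < k →
      Later (spaceSupport (H i).1) (spaceSupport (H j).1) := by
    intro i j
    refine Fin.addCases (fun i => ?_) (fun i => ?_) i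
    · refine Fin.addCases (fun j => ?_) (fun j => ?_) j
      · intro _ h; exact absurd j.2 h
      · intro _ _
        rw [hH, Fin.append_left, Fin.append_right]
        exact hFG i j
    · intro h; simp at h
  have hcomp : ∀ {n : ℕ} (b : Fin n → Fin (k + l)) (L : ℕ),
      (S.comp Z).coeff n L (fun i => H (b i)) = Φ (partPoly (famVal b)) L := by
    intro n b L
    rw [FormalMap.comp_coeff, compCoeff_eq_hcomp, hcomp_eq_monLin,
      ← famVal_map (fun i => hConst (H i)) b, partPoly_map]
    have : (monLin fun β => S.onMultiset (β.map Z.onMultiset)) ∘ₗ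
        (MvPolynomial.rename (Multiset.map fun i => hConst (H i))).toLinearMap = Φ := by
      refine monLin_ext fun γ => ?_
      rw [hΦ, monLin_mon, LinearMap.comp_apply, AlgHom.toLinearMap_apply, rename_mon, monLin_mon,
        Multiset.map_map]
      rfl
    rw [← this]
    rfl
  -- mixed blocks do not contribute, hence the sum over partitions factorizes
  have hfac : (S.comp Z).coeff (k + l) L H = ∑ P : OrderedFinpartition k,
      ∑ Q : OrderedFinpartition l, S.ext (P.length + Q.length)
        (Fin.append (fun I L => Z.coeff (P.partSize I) L fun i => F (P.emb I i))
          (fun J L => Z.coeff (Q.partSize J) L fun j => G (Q.emb J j))) L := by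
    have h1 : famVal (fun i : Fin (k + l) => i) =
        famVal (Fin.castAdd l : Fin k → _) + famVal (Fin.natAdd k : Fin l → _) := by
      rw [← famVal_append]
      congr 1
      exact (Fin.append_castAdd_natAdd (f := fun i => i)).symm
    have h2 := hcomp (fun i : Fin (k + l) => i) L
    rw [h1, map_partPoly_add (p := fun i : Fin (k + l) => (i : ℕ) < k) Φ] at h2
    · rw [h2, partPoly_famVal, partPoly_famVal, Finset.sum_mul_sum, map_sum, Finset.sum_apply]
      refine Finset.sum_congr rfl fun P _ => ?_
      rw [map_sum, Finset.sum_apply]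
      refine Finset.sum_congr rfl fun Q _ => ?_
      rw [← mon_add, ← famVal_append, hΦ, monLin_mon, famVal_map, S.onMultiset_famVal]
      refine congrArg (fun z => S.ext (P.length + Q.length) z L) (funext ?_)
      refine Fin.addCases (fun I => ?_) (fun J => ?_)
      · rw [Fin.append_left, Fin.append_left, blockVal, hblock]
        simp only [hH, Fin.append_left]
      · rw [Fin.append_right, Fin.append_right, blockVal, hblock]
        simp only [hH, Fin.append_right]
    · rintro B β ⟨i, hi, hip⟩ ⟨j, hj, hjp⟩
      rw [hΦ, monLin_mon, Multiset.map_cons]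
      have hB : Z.onMultiset (B.map fun i => hConst (H i)) = 0 := by
        obtain ⟨n, b, rfl⟩ := famVal_surj B
        rw [hblock]
        simp only [famVal, Multiset.mem_coe, List.mem_ofFn] at hi hj
        obtain ⟨i', rfl⟩ := hi
        obtain ⟨j', rfl⟩ := hj
        funext L
        refine hZ.offDiagonal n L _ i' j' ?_ (hlater _ _ hip hjp).disjoint
        rintro rfl
        exact hjp hip
      rw [hB]
      exact map_zero (S.consLin _)
    · intro i hi
      simp only [famVal, Multiset.mem_coe, List.mem_ofFn] at hi
      obtain ⟨i, rfl⟩ := hi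
      exact i.2
    · intro i hi
      simp only [famVal, Multiset.mem_coe, List.mem_ofFn] at hi
      obtain ⟨i, rfl⟩ := hi
      simp
  have hone : ∀ {n : ℕ} (E : Fin n → Local s) (L : ℕ), (S.comp Z).coeff n L E =
      ∑ P : OrderedFinpartition n, S.ext P.length
        (fun I L => Z.coeff (P.partSize I) L fun i => E (P.emb I i)) L := by
    intro n E L
    rw [FormalMap.comp_coeff, compCoeff]
    refine Finset.sum_congr rfl fun P _ => ?_
    rw [partTerm_eq_sum]
    rfl
  rw [hfac]
  simp only [hone, Submodule.coe_sum, Finset.sum_apply]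
  simp only [← Submodule.coe_sum]
  refine IsStarCoeff.sum_left _ fun P _ => IsStarCoeff.sum_right _ fun Q _ => ?_
  refine hS.ext _ _ (fun I a J b u hu v hv => ?_) L φ
  exact hFG _ _ u (hZ.spaceSupport_subset a _ ⟨0, P.partSize_pos I⟩ hu) v
    (hZ.spaceSupport_subset b _ ⟨0, Q.partSize_pos J⟩ hv)

end

/-! ### Principal parts and regular values -/

section

variable (Λ₀ : ℂ)

/-- The polynomials in `1/(Λ - Λ₀)` without constant term. -/
def polarFunctions : Submodule ℂ (ℂ → ℂ) where
  carrier := {p | ∃ q : Polynomial ℂ, q.coeff 0 = 0 ∧ ∀ Λ, p Λ = q.eval (Λ - Λ₀)⁻¹}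
  add_mem' := by
    rintro f g ⟨p, hp, hf⟩ ⟨q, hq, hg⟩
    exact ⟨p + q, by simp [hp, hq], fun Λ => by simp [hf, hg]⟩
  zero_mem' := ⟨0, by simp, fun Λ => by simp⟩
  smul_mem' := by
    rintro c f ⟨p, hp, hf⟩
    exact ⟨Polynomial.C c * p, by simp [hp], fun Λ => by simp [hf]⟩

/-- The functions which agree with an analytic function in a punctured neighbourhood of `Λ₀`. -/
def regularFunctions : Submodule ℂ (ℂ → ℂ) where
  carrier := {f | ∃ g, AnalyticAt ℂ g Λ₀ ∧ f =ᶠ[𝓝[≠] Λ₀] g}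
  add_mem' := by
    rintro f f' ⟨g, hg, hf⟩ ⟨g', hg', hf'⟩
    exact ⟨g + g', hg.add hg', hf.add hf'⟩
  zero_mem' := ⟨0, analyticAt_const, EventuallyEq.rfl⟩
  smul_mem' := by
    rintro c f ⟨g, hg, hf⟩
    exact ⟨c • g, analyticAt_const.smul hg, hf.const_smul c⟩

variable {Λ₀}

theorem meromorphicAt_of_mem_polarFunctions {f : ℂ → ℂ} (hf : f ∈ polarFunctions Λ₀) :
    MeromorphicAt f Λ₀ := by
  obtain ⟨q, -, hf⟩ := hf
  obtain rfl : f = fun Λ => q.eval (Λ - Λ₀)⁻¹ := funext hf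
  simp only [Polynomial.eval_eq_sum_range]
  have h : MeromorphicAt (fun Λ : ℂ => (Λ - Λ₀)⁻¹) Λ₀ :=
    ((MeromorphicAt.id Λ₀).sub (MeromorphicAt.const Λ₀ Λ₀)).inv
  exact MeromorphicAt.fun_sum fun j _ => (MeromorphicAt.const _ _).mul (h.pow j)

theorem mem_regularFunctions_of_tendsto {f : ℂ → ℂ} (hf : MeromorphicAt f Λ₀) {a : ℂ}
    (ha : Tendsto f (𝓝[≠] Λ₀) (𝓝 a)) : f ∈ regularFunctions Λ₀ :=
  hf.meromorphicOrderAt_nonneg_iff.1 ((tendsto_nhds_iff_meromorphicOrderAt_nonneg hf).1 ⟨a, ha⟩)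

/-- A nonzero polynomial without constant term in `1/(Λ - Λ₀)` is unbounded close to `Λ₀`. -/
theorem disjoint_regular_polar : Disjoint (regularFunctions Λ₀) (polarFunctions Λ₀) := by
  rw [Submodule.disjoint_def]
  rintro f ⟨g, hg, hfg⟩ ⟨q, hq, hf⟩
  have h1 : ¬ 0 < q.degree := by
    intro h
    have h2 : Tendsto (fun Λ : ℂ => ‖(Λ - Λ₀)⁻¹‖) (𝓝[≠] Λ₀) atTop := by
      have h3 : Tendsto (fun Λ : ℂ => Λ - Λ₀) (𝓝[≠] Λ₀) (𝓝[≠] 0) := by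
        refine tendsto_nhdsWithin_iff.2 ⟨?_, ?_⟩
        · have : ContinuousAt (fun Λ : ℂ => Λ - Λ₀) Λ₀ := by fun_prop
          have := this.tendsto.mono_left (nhdsWithin_le_nhds (s := {Λ₀}ᶜ))
          rwa [sub_self] at this
        · filter_upwards [self_mem_nhdsWithin] with Λ hΛ
          exact sub_ne_zero.2 hΛ
      exact tendsto_norm_cobounded_atTop.comp (tendsto_inv₀_nhdsNE_zero.comp h3)
    have h4 := q.tendsto_norm_atTop h h2
    have h5 : Tendsto (fun Λ => ‖q.eval (Λ - Λ₀)⁻¹‖) (𝓝[≠] Λ₀) (𝓝 ‖g Λ₀‖) := by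
      refine (hg.continuousAt.tendsto.mono_left nhdsWithin_le_nhds).norm.congr' ?_
      filter_upwards [hfg] with Λ hΛ
      rw [← hΛ, hf]
    exact not_tendsto_nhds_of_tendsto_atTop h4 _ h5
  have h6 := Polynomial.eq_C_of_degree_le_zero (not_lt.1 h1)
  funext Λ
  rw [hf, h6, hq]
  simp

/-- A meromorphic function is the sum of its principal part and of a regular function. -/
theorem mem_polar_sup_regular {f : ℂ → ℂ} (hf : MeromorphicAt f Λ₀) :
    f ∈ polarFunctions Λ₀ ⊔ regularFunctions Λ₀ := by
  obtain ⟨n, hn⟩ := hf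
  have key : ∀ (n : ℕ) (f g : ℂ → ℂ), AnalyticAt ℂ g Λ₀ →
      (f =ᶠ[𝓝[≠] Λ₀] fun Λ => ((Λ - Λ₀)⁻¹) ^ n * g Λ) →
      f ∈ polarFunctions Λ₀ ⊔ regularFunctions Λ₀ := by
    intro n
    induction n with
    | zero =>
      intro f g hg hfg
      refine Submodule.mem_sup_right ⟨g, hg, ?_⟩
      filter_upwards [hfg] with Λ hΛ
      rw [hΛ, pow_zero, one_mul]
    | succ n ih =>
      -- `g = g(Λ₀) + (Λ - Λ₀) h` with an analytic function `h`
      intro f g hg hfg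
      obtain ⟨p, hp⟩ := hg
      have hd : AnalyticAt ℂ (dslope g Λ₀) Λ₀ := ⟨_, hp.has_fpower_series_dslope_fslope⟩
      have hpol : (fun Λ => g Λ₀ * ((Λ - Λ₀)⁻¹) ^ (n + 1)) ∈ polarFunctions Λ₀ :=
        ⟨Polynomial.C (g Λ₀) * Polynomial.X ^ (n + 1), by simp, fun Λ => by simp⟩
      have h1 := ih (f - fun Λ => g Λ₀ * ((Λ - Λ₀)⁻¹) ^ (n + 1)) (dslope g Λ₀) hd ?_
      · simpa using add_mem (Submodule.mem_sup_left hpol) h1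
      · filter_upwards [hfg, self_mem_nhdsWithin] with Λ hΛ hne
        have h2 := sub_smul_dslope g Λ₀ Λ
        have h3 : Λ - Λ₀ ≠ 0 := sub_ne_zero.2 hne
        rw [Pi.sub_apply, hΛ, ← mul_comm (g Λ), ← sub_mul, ← h2, smul_eq_mul, pow_succ]
        field_simp
  refine key n f _ hn ?_
  filter_upwards [self_mem_nhdsWithin] with Λ hne
  have h3 : Λ - Λ₀ ≠ 0 := sub_ne_zero.2 hne
  rw [smul_eq_mul, ← mul_assoc, ← mul_pow, inv_mul_cancel₀ h3, one_pow, one_mul]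

variable (Λ₀)

/-- The projection onto the polar functions along a complement which contains the regular
functions. -/
theorem exists_principalPart : ∃ T : (ℂ → ℂ) →ₗ[ℂ] (ℂ → ℂ),
    (∀ f, MeromorphicAt f Λ₀ → T f ∈ polarFunctions Λ₀ ∧ f - T f ∈ regularFunctions Λ₀) ∧
    ∀ f ∈ regularFunctions Λ₀, T f = 0 := by
  obtain ⟨R, hR, hc⟩ := (disjoint_regular_polar (Λ₀ := Λ₀)).exists_isCompl
  have h0 : ∀ f ∈ regularFunctions Λ₀, (polarFunctions Λ₀).projection R hc.symm f = 0 :=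
    fun f hf => (Submodule.projection_apply_eq_zero_iff hc.symm).2 (hR hf)
  refine ⟨(polarFunctions Λ₀).projection R hc.symm, fun f hf => ?_, h0⟩
  obtain ⟨p, hp, g, hg, rfl⟩ := Submodule.mem_sup.1 (mem_polar_sup_regular hf)
  have h1 : (polarFunctions Λ₀).projection R hc.symm (p + g) = p := by
    rw [map_add, h0 g hg, add_zero]
    exact (Submodule.projection_eq_self_iff hc.symm p).2 hp
  rw [h1]
  exact ⟨hp, by simpa using hg⟩

/-- The principal part at `Λ₀` of a meromorphic function, extended linearly to all functions. The
extension involves a choice, but the values at meromorphic functions do not depend on it. -/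
def principalPart : (ℂ → ℂ) →ₗ[ℂ] (ℂ → ℂ) := (exists_principalPart Λ₀).choose

/-- Limits at `Λ₀` extend to a linear functional on all functions, by means of a complement of the
constants which contains the functions with limit zero. -/
theorem exists_limit : ∃ T : (ℂ → ℂ) →ₗ[ℂ] ℂ,
    ∀ f a, Tendsto f (𝓝[≠] Λ₀) (𝓝 a) → T f = a := by
  let N : Submodule ℂ (ℂ → ℂ) :=
    { carrier := {f | Tendsto f (𝓝[≠] Λ₀) (𝓝 0)}
      add_mem' := fun {f g} hf hg => by
        have h : Tendsto (fun Λ => f Λ + g Λ) (𝓝[≠] Λ₀) (𝓝 (0 + 0)) := Tendsto.add hf hg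
        rwa [add_zero] at h
      zero_mem' := tendsto_const_nhds
      smul_mem' := fun c f hf => by
        have h : Tendsto (fun Λ => c • f Λ) (𝓝[≠] Λ₀) (𝓝 (c • 0)) := Tendsto.const_smul hf c
        rwa [smul_zero] at h }
  have hd : Disjoint N (Submodule.span ℂ {(1 : ℂ → ℂ)}) := by
    rw [Submodule.disjoint_def]
    intro f hf hf'
    obtain ⟨c, rfl⟩ := Submodule.mem_span_singleton.1 hf'
    have h1 : Tendsto (fun _ : ℂ => c) (𝓝[≠] Λ₀) (𝓝 0) := by
      refine Tendsto.congr (fun Λ => ?_) hf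
      simp
    rw [tendsto_nhds_unique h1 tendsto_const_nhds |>.symm, zero_smul]
  obtain ⟨R, hR, hc⟩ := hd.exists_isCompl
  refine ⟨LinearMap.proj Λ₀ ∘ₗ (Submodule.span ℂ {(1 : ℂ → ℂ)}).projection R hc.symm,
    fun f a hf => ?_⟩
  have h1 : f - a • (1 : ℂ → ℂ) ∈ N := by
    have : Tendsto (fun Λ => f Λ - a) (𝓝[≠] Λ₀) (𝓝 (a - a)) := hf.sub tendsto_const_nhds
    rw [sub_self] at this
    refine this.congr fun Λ => ?_
    simp
  have h2 := (Submodule.projection_apply_eq_zero_iff hc.symm).2 (hR h1)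
  rw [map_sub, sub_eq_zero, (Submodule.projection_eq_self_iff hc.symm _).2
    (Submodule.smul_mem _ a (Submodule.mem_span_singleton_self _))] at h2
  rw [LinearMap.comp_apply, h2]
  simp

/-- The limit of a function at `Λ₀`, extended linearly to all functions. The extension involves a
choice, but the values at functions which have a limit do not depend on it. -/
def limitAt : (ℂ → ℂ) →ₗ[ℂ] ℂ := (exists_limit Λ₀).choose

variable {Λ₀}

theorem limitAt_eq {f : ℂ → ℂ} {a : ℂ} (h : Tendsto f (𝓝[≠] Λ₀) (𝓝 a)) : limitAt Λ₀ f = a :=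
  (exists_limit Λ₀).choose_spec f a h

theorem principalPart_mem {f : ℂ → ℂ} (hf : MeromorphicAt f Λ₀) :
    principalPart Λ₀ f ∈ polarFunctions Λ₀ :=
  ((exists_principalPart Λ₀).choose_spec.1 f hf).1

theorem sub_principalPart_mem {f : ℂ → ℂ} (hf : MeromorphicAt f Λ₀) :
    f - principalPart Λ₀ f ∈ regularFunctions Λ₀ :=
  ((exists_principalPart Λ₀).choose_spec.1 f hf).2

theorem principalPart_eq_zero {f : ℂ → ℂ} (hf : f =ᶠ[𝓝[≠] Λ₀] 0) : principalPart Λ₀ f = 0 :=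
  (exists_principalPart Λ₀).choose_spec.2 f ⟨0, analyticAt_const, hf⟩

theorem isPrincipalPart_of_mem {f p : ℂ → ℂ} (hp : p ∈ polarFunctions Λ₀)
    (hf : f - p ∈ regularFunctions Λ₀) : IsPrincipalPart Λ₀ f p := by
  constructor
  · obtain ⟨q, hq, hp⟩ := hp
    refine ⟨q.natDegree, fun j => q.coeff (j + 1), fun Λ _ => ?_⟩
    rw [hp, Polynomial.eval_eq_sum_range, Finset.sum_range_succ', hq, zero_mul, add_zero,
      Finset.sum_range]
  · obtain ⟨g, hg, h⟩ := hf
    refine ⟨g, hg, h.mono fun Λ hΛ => ?_⟩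
    rw [← hΛ, Pi.sub_apply]
    ring

/-- A linear functional on functions of `Λ` which depends only on the values close to `Λ₀`, at
points other than `Λ₀`. -/
def GermFunctional (Λ₀ : ℂ) (ℓ : (ℂ → ℂ) →ₗ[ℂ] ℂ) : Prop :=
  ∀ f : ℂ → ℂ, f =ᶠ[𝓝[≠] Λ₀] 0 → ℓ f = 0

theorem GermFunctional.congr {ℓ : (ℂ → ℂ) →ₗ[ℂ] ℂ} (hℓ : GermFunctional Λ₀ ℓ) {f g : ℂ → ℂ}
    (h : f =ᶠ[𝓝[≠] Λ₀] g) : ℓ f = ℓ g := by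
  rw [← sub_eq_zero, ← map_sub]
  exact hℓ _ (h.mono fun Λ hΛ => by simp [hΛ])

variable (Λ₀) in
/-- The principal part, evaluated at `Λ`. -/
def principalPartAt (Λ : ℂ) : (ℂ → ℂ) →ₗ[ℂ] ℂ := LinearMap.proj Λ ∘ₗ principalPart Λ₀

variable (Λ₀) in
/-- The value at `Λ₀` of the regular part. -/
def regularValue : (ℂ → ℂ) →ₗ[ℂ] ℂ := limitAt Λ₀ ∘ₗ (LinearMap.id - principalPart Λ₀)

theorem germFunctional_principalPartAt (Λ : ℂ) : GermFunctional Λ₀ (principalPartAt Λ₀ Λ) := by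
  intro f hf
  rw [principalPartAt, LinearMap.comp_apply, principalPart_eq_zero hf, map_zero]

theorem germFunctional_regularValue : GermFunctional Λ₀ (regularValue Λ₀) := by
  intro f hf
  rw [regularValue, LinearMap.comp_apply, LinearMap.sub_apply, principalPart_eq_zero hf,
    LinearMap.id_apply, sub_zero]
  exact limitAt_eq (tendsto_const_nhds.congr' hf.symm)

end

/-! ### Families of local functionals -/

section

variable {s : ℕ} {Y : Submodule ℂ (Config s → ℂ)} {𝒢 : Subgroup (Mink s ≃ᵃ[ℝ] Mink s)} {Λ₀ : ℂ}

variable (Λ₀) in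
/-- The algebra of functions which are meromorphic at `Λ₀`. -/
def meromorphicAlg : Subalgebra ℂ (ℂ → ℂ) where
  carrier := {f | MeromorphicAt f Λ₀}
  mul_mem' hf hg := MeromorphicAt.mul hf hg
  add_mem' hf hg := MeromorphicAt.add hf hg
  algebraMap_mem' c := MeromorphicAt.const c Λ₀

variable (Λ₀) in
/-- The algebra of functions which are analytic at `Λ₀`. -/
def analyticAlg : Subalgebra ℂ (ℂ → ℂ) where
  carrier := {f | AnalyticAt ℂ f Λ₀}
  mul_mem' hf hg := AnalyticAt.mul hf hg
  add_mem' hf hg := AnalyticAt.add hf hg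
  algebraMap_mem' c := analyticAt_const (v := c)

/-- Close to `φ₀`, and eventually with respect to the filter `l` in the parameter, the family `H`
is a finite combination of fixed local functionals with coefficients in `𝒦`. Meromorphic and
regular families are the cases of meromorphic coefficients and a punctured neighbourhood, and of
analytic coefficients and a full neighbourhood. -/
def ExpandsAt (𝒦 : Subalgebra ℂ (ℂ → ℂ)) (l : Filter ℂ) (H : ℂ → Local s) (φ₀ : Config s) :
    Prop :=
  ∃ W ∈ 𝓝 φ₀, ∃ (r : ℕ) (c : Fin r → ℂ → ℂ) (G : Fin r → Local s), (∀ i, c i ∈ 𝒦) ∧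
    ∀ᶠ Λ in l, ∀ φ ∈ W, (H Λ).1 φ = ∑ i, c i Λ * (G i).1 φ

theorem meromorphicFamilyAt_iff {H : ℂ → Local s} : MeromorphicFamilyAt H Λ₀ ↔
    ∀ φ₀, ExpandsAt (meromorphicAlg Λ₀) (𝓝[≠] Λ₀) H φ₀ := Iff.rfl

theorem regularFamilyAt_iff {H : ℂ → Local s} : RegularFamilyAt H Λ₀ ↔
    ∀ φ₀, ExpandsAt (analyticAlg Λ₀) (𝓝 Λ₀) H φ₀ := Iff.rfl

theorem RegularFamilyAt.meromorphic {H : ℂ → Local s} (h : RegularFamilyAt H Λ₀) :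
    MeromorphicFamilyAt H Λ₀ := by
  intro φ₀
  obtain ⟨W, hW, r, c, G, hc, h⟩ := h φ₀
  exact ⟨W, hW, r, c, G, fun i => (hc i).meromorphicAt, h.filter_mono nhdsWithin_le_nhds⟩

theorem MeromorphicFamilyAt.meromorphicAt {H : ℂ → Local s} (h : MeromorphicFamilyAt H Λ₀)
    (φ : Config s) : MeromorphicAt (fun Λ => (H Λ).1 φ) Λ₀ := by
  obtain ⟨W, hW, r, c, G, hc, h⟩ := h φ
  refine MeromorphicAt.congr (f := fun Λ => ∑ i, c i Λ * (G i).1 φ)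
    (MeromorphicAt.fun_sum fun i _ => (hc i).mul (MeromorphicAt.const _ _)) ?_
  exact h.mono fun Λ hΛ => (hΛ φ (mem_of_mem_nhds hW)).symm

section ExpandsAt

variable {𝒦 : Subalgebra ℂ (ℂ → ℂ)} {l : Filter ℂ} {φ₀ : Config s}

theorem ExpandsAt.of_fintype {ι : Type*} [Fintype ι] {H : ℂ → Local s} {W : Set (Config s)}
    (hW : W ∈ 𝓝 φ₀) (c : ι → ℂ → ℂ) (G : ι → Local s) (hc : ∀ i, c i ∈ 𝒦)
    (h : ∀ᶠ Λ in l, ∀ φ ∈ W, (H Λ).1 φ = ∑ i, c i Λ * (G i).1 φ) : ExpandsAt 𝒦 l H φ₀ := by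
  refine ⟨W, hW, Fintype.card ι, fun j => c ((Fintype.equivFin ι).symm j),
    fun j => G ((Fintype.equivFin ι).symm j), fun j => hc _, h.mono fun Λ hΛ φ hφ => ?_⟩
  rw [hΛ φ hφ]
  exact ((Fintype.equivFin ι).symm.sum_comp fun i => c i Λ * (G i).1 φ).symm

theorem ExpandsAt.const (G : Local s) : ExpandsAt 𝒦 l (fun _ => G) φ₀ :=
  ExpandsAt.of_fintype (ι := Unit) univ_mem (fun _ => 1) (fun _ => G) (fun _ => 𝒦.one_mem)
    (Eventually.of_forall fun Λ φ _ => by simp)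

theorem ExpandsAt.add {H H' : ℂ → Local s} (h : ExpandsAt 𝒦 l H φ₀) (h' : ExpandsAt 𝒦 l H' φ₀) :
    ExpandsAt 𝒦 l (fun Λ => H Λ + H' Λ) φ₀ := by
  obtain ⟨W, hW, r, c, G, hc, h⟩ := h
  obtain ⟨W', hW', r', c', G', hc', h'⟩ := h'
  refine ExpandsAt.of_fintype (inter_mem hW hW') (Sum.elim c c') (Sum.elim G G') ?_ ?_
  · rintro (i | i)
    exacts [hc i, hc' i]
  · filter_upwards [h, h'] with Λ h1 h2 φ hφ
    rw [Fintype.sum_sum_type]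
    exact congrArg₂ (· + ·) (h1 φ hφ.1) (h2 φ hφ.2)

theorem ExpandsAt.smul {H : ℂ → Local s} {f : ℂ → ℂ} (hf : f ∈ 𝒦) (h : ExpandsAt 𝒦 l H φ₀) :
    ExpandsAt 𝒦 l (fun Λ => f Λ • H Λ) φ₀ := by
  obtain ⟨W, hW, r, c, G, hc, h⟩ := h
  refine ⟨W, hW, r, fun i => f * c i, G, fun i => 𝒦.mul_mem hf (hc i), h.mono fun Λ h φ hφ => ?_⟩
  show f Λ * (H Λ).1 φ = _
  rw [h φ hφ, Finset.mul_sum]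
  exact Finset.sum_congr rfl fun i _ => (mul_assoc _ _ _).symm

theorem ExpandsAt.sum {ι : Type*} (t : Finset ι) {H : ι → ℂ → Local s}
    (h : ∀ i ∈ t, ExpandsAt 𝒦 l (H i) φ₀) : ExpandsAt 𝒦 l (fun Λ => ∑ i ∈ t, H i Λ) φ₀ := by
  classical
  induction t using Finset.induction_on with
  | empty => simpa using ExpandsAt.const 0
  | insert a t ha ih =>
    simp only [Finset.sum_insert ha]
    exact (h a (Finset.mem_insert_self a t)).add
      (ih fun i hi => h i (Finset.mem_insert_of_mem hi))

theorem ExpandsAt.sub {H H' : ℂ → Local s} (h : ExpandsAt 𝒦 l H φ₀) (h' : ExpandsAt 𝒦 l H' φ₀) :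
    ExpandsAt 𝒦 l (fun Λ => H Λ - H' Λ) φ₀ := by
  have h1 : (fun _ : ℂ => (-1 : ℂ)) ∈ 𝒦 := by
    simpa [Pi.algebraMap_def] using! 𝒦.algebraMap_mem (-1)
  have h2 : (fun Λ => H Λ - H' Λ) = fun Λ => H Λ + (-1 : ℂ) • H' Λ :=
    funext fun Λ => by module
  rw [h2]
  exact h.add (h'.smul h1)

theorem ExpandsAt.congr {H H' : ℂ → Local s} (h : ExpandsAt 𝒦 l H φ₀) {W : Set (Config s)}
    (hW : W ∈ 𝓝 φ₀) (hH : ∀ᶠ Λ in l, ∀ φ ∈ W, (H' Λ).1 φ = (H Λ).1 φ) :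
    ExpandsAt 𝒦 l H' φ₀ := by
  obtain ⟨W', hW', r, c, G, hc, h⟩ := h
  refine ⟨W ∩ W', inter_mem hW hW', r, c, G, hc, ?_⟩
  filter_upwards [h, hH] with Λ h1 h2 φ hφ
  rw [h2 φ hφ.1, h1 φ hφ.2]

/-- The value at `φ` of a `φ`-local map depends only on the germs at `φ` of its arguments. -/
theorem PhiLocal.congr_nhds {T : FormalMap s Y} (hT : PhiLocal T) {k : ℕ} (L : ℕ)
    {F F' : Fin k → Local s} {φ : Config s} (h : ∀ i, (F i).1 =ᶠ[𝓝 φ] (F' i).1) :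
    (T.coeff k L F).1 φ = (T.coeff k L F').1 φ := by
  classical
  suffices key : ∀ t : Finset (Fin k), (T.coeff k L (t.piecewise F F')).1 φ =
      (T.coeff k L F').1 φ by simpa using key Finset.univ
  intro t
  induction t using Finset.induction_on with
  | empty => simp
  | insert i t hi ih =>
    rw [← ih, Finset.piecewise_insert]
    have h1 : t.piecewise F F' = Function.update (t.piecewise F F') i (F' i) := by
      rw [← Finset.piecewise_eq_of_notMem t F F' hi, Function.update_eq_self]
    rw [← sub_eq_zero]
    conv_lhs => rw [h1, Function.update_idem]
    have h2 := (T.coeff k L).map_update_sub (t.piecewise F F') i (F i) (F' i)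
    have h3 := congrFun (congrArg Subtype.val h2) φ
    refine h3.symm.trans ?_
    -- the difference of the arguments vanishes to any order at `φ`; order `2L + 1` suffices
    refine hT k L _ φ (Pi.single i (2 * L + 1)) (fun j a ha ψ => ?_) (by simp)
    rcases eq_or_ne j i with rfl | hj
    · rw [Function.update_self]
      have h4 : (F j - F' j).1 =ᶠ[𝓝 φ] (0 : Config s → ℂ) := by
        filter_upwards [h j] with φ' hφ'
        show (F j).1 φ' - (F' j).1 φ' = 0
        rw [hφ', sub_self]
      rw [funcDeriv_congr_nhds a h4, funcDeriv_zero]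
    · simp [hj] at ha

/-- Expansion of a `φ`-local map at families of arguments. The neighbourhood, the coefficients and
the local functionals depend only on the arguments, not on the map `T`. -/
theorem exists_expansion {k : ℕ} {X : Fin k → ℂ → Local s} (hX : ∀ I, ExpandsAt 𝒦 l (X I) φ₀) :
    ∃ W ∈ 𝓝 φ₀, ∃ (r : Fin k → ℕ) (c : ((I : Fin k) → Fin (r I)) → ℂ → ℂ)
      (G : ((I : Fin k) → Fin (r I)) → Fin k → Local s), (∀ q, c q ∈ 𝒦) ∧
      ∀ᶠ Λ in l, ∀ T : FormalMap s Y, PhiLocal T → ∀ L, ∀ φ ∈ W,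
        (T.coeff k L (fun I => X I Λ)).1 φ = ∑ q, c q Λ * (T.coeff k L (G q)).1 φ := by
  choose W hW r c G hc h using hX
  refine ⟨interior (⋂ I, W I), interior_mem_nhds.2 (iInter_mem.2 hW), r,
    fun q Λ => ∏ I, c I (q I) Λ, fun q I => G I (q I), fun q => ?_, ?_⟩
  · have : (fun Λ => ∏ I, c I (q I) Λ) = ∏ I, c I (q I) := by
      funext Λ
      rw [Finset.prod_apply]
    show (fun Λ => ∏ I, c I (q I) Λ) ∈ 𝒦
    rw [this]
    exact 𝒦.prod_mem fun I _ => hc I (q I)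
  · filter_upwards [eventually_all.2 h] with Λ hΛ T hT L φ hφ
    have h1 : (T.coeff k L (fun I => X I Λ)).1 φ =
        (T.coeff k L (fun I => ∑ i, c I i Λ • G I i)).1 φ := by
      refine hT.congr_nhds L fun I => ?_
      filter_upwards [isOpen_interior.mem_nhds hφ] with φ' hφ'
      rw [hΛ I φ' (mem_iInter.1 (interior_subset hφ') I), Submodule.coe_sum, Finset.sum_apply]
      rfl
    rw [h1, MultilinearMap.map_sum, Submodule.coe_sum, Finset.sum_apply]
    refine Finset.sum_congr rfl fun q _ => ?_
    rw [MultilinearMap.map_smul_univ]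
    rfl

theorem ExpandsAt.apply {T : ℂ → FormalMap s (Local s)} (hT : ∀ᶠ Λ in l, PhiLocal (T Λ))
    {k L : ℕ} (hTF : ∀ F, ExpandsAt 𝒦 l (fun Λ => (T Λ).coeff k L F) φ₀)
    {X : Fin k → ℂ → Local s} (hX : ∀ I, ExpandsAt 𝒦 l (X I) φ₀) :
    ExpandsAt 𝒦 l (fun Λ => (T Λ).coeff k L (fun I => X I Λ)) φ₀ := by
  obtain ⟨W, hW, r, c, G, hc, h⟩ := exists_expansion (Y := Local s) hX
  refine (ExpandsAt.sum Finset.univ fun q _ => (hTF (G q)).smul (hc q)).congr hW ?_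
  filter_upwards [h, hT] with Λ h1 h2 φ hφ
  rw [h1 (T Λ) h2 L φ hφ, Submodule.coe_sum, Finset.sum_apply]
  rfl

theorem ExpandsAt.partTerm {S Z : ℂ → FormalMap s (Local s)} (hS : ∀ᶠ Λ in l, PhiLocal (S Λ))
    (hSF : ∀ k L F, ExpandsAt 𝒦 l (fun Λ => (S Λ).coeff k L F) φ₀)
    (hZF : ∀ k L F, ExpandsAt 𝒦 l (fun Λ => (Z Λ).coeff k L F) φ₀) {n : ℕ}
    (P : OrderedFinpartition n) (L : ℕ) (F : Fin n → Local s) :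
    ExpandsAt 𝒦 l (fun Λ => partTerm (S Λ) (Z Λ) P L F) φ₀ := by
  simp only [partTerm_eq_sum]
  exact ExpandsAt.sum _ fun p _ => ExpandsAt.apply hS (hSF P.length p.1) fun I => hZF _ _ _

/-- Compositions of meromorphic (regular) families of `φ`-local maps are meromorphic (regular). -/
theorem ExpandsAt.comp {S Z : ℂ → FormalMap s (Local s)} (hS : ∀ᶠ Λ in l, PhiLocal (S Λ))
    (hSF : ∀ k L F, ExpandsAt 𝒦 l (fun Λ => (S Λ).coeff k L F) φ₀)
    (hZF : ∀ k L F, ExpandsAt 𝒦 l (fun Λ => (Z Λ).coeff k L F) φ₀) (n L : ℕ)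
    (F : Fin n → Local s) :
    ExpandsAt 𝒦 l (fun Λ => ((S Λ).comp (Z Λ)).coeff n L F) φ₀ :=
  ExpandsAt.sum Finset.univ fun P _ => ExpandsAt.partTerm hS hSF hZF P L F

end ExpandsAt

/-- The composition of a `φ`-local family which is meromorphic at fixed arguments and fixed field
configuration with a meromorphic family. -/
theorem meromorphicAt_comp {S : ℂ → FormalMap s Y} {Z : ℂ → FormalMap s (Local s)}
    (hS : ∀ᶠ Λ in 𝓝[≠] Λ₀, PhiLocal (S Λ))
    (hSF : ∀ (k L : ℕ) (F : Fin k → Local s) (φ : Config s),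
      MeromorphicAt (fun Λ => ((S Λ).coeff k L F).1 φ) Λ₀)
    (hZF : ∀ (k L : ℕ) (F : Fin k → Local s),
      MeromorphicFamilyAt (fun Λ => (Z Λ).coeff k L F) Λ₀) (n L : ℕ)
    (F : Fin n → Local s) (φ : Config s) :
    MeromorphicAt (fun Λ => (((S Λ).comp (Z Λ)).coeff n L F).1 φ) Λ₀ := by
  simp only [comp_coeff_eq_sum, Submodule.coe_sum, Finset.sum_apply]
  refine MeromorphicAt.fun_sum fun p _ => ?_
  obtain ⟨W, hW, r, c, G, hc, h⟩ := exists_expansion (Y := Y) (φ₀ := φ)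
    fun I : Fin p.1.length => meromorphicFamilyAt_iff.1
      (hZF (p.1.partSize I) (p.2.2 I) (fun i => F (p.1.emb I i))) φ
  refine MeromorphicAt.congr (f := fun Λ => ∑ q, c q Λ *
    ((S Λ).coeff p.1.length p.2.1 (G q)).1 φ)
    (MeromorphicAt.fun_sum fun q _ => (hc q).mul (hSF _ _ _ _)) ?_
  filter_upwards [h, hS] with Λ h1 h2
  exact (h1 (S Λ) h2 p.2.1 φ (mem_of_mem_nhds hW)).symm

/-- The composition of a `φ`-local family which converges at fixed arguments and fixed field
configuration with a regular family. -/
theorem tendsto_comp {S : ℂ → FormalMap s Y} {S₀ : FormalMap s Y}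
    {Z : ℂ → FormalMap s (Local s)}
    (hS : ∀ᶠ Λ in 𝓝[≠] Λ₀, PhiLocal (S Λ)) (hS₀ : PhiLocal S₀)
    (hSF : ∀ (k L : ℕ) (F : Fin k → Local s) (φ : Config s),
      Tendsto (fun Λ => ((S Λ).coeff k L F).1 φ) (𝓝[≠] Λ₀) (𝓝 ((S₀.coeff k L F).1 φ)))
    (hZF : ∀ (k L : ℕ) (F : Fin k → Local s),
      RegularFamilyAt (fun Λ => (Z Λ).coeff k L F) Λ₀) (n L : ℕ)
    (F : Fin n → Local s) (φ : Config s) :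
    Tendsto (fun Λ => (((S Λ).comp (Z Λ)).coeff n L F).1 φ) (𝓝[≠] Λ₀)
      (𝓝 (((S₀.comp (Z Λ₀)).coeff n L F).1 φ)) := by
  simp only [comp_coeff_eq_sum, Submodule.coe_sum, Finset.sum_apply]
  refine tendsto_finsetSum _ fun p _ => ?_
  obtain ⟨W, hW, r, c, G, hc, h⟩ := exists_expansion (Y := Y) (φ₀ := φ)
    fun I : Fin p.1.length => regularFamilyAt_iff.1
      (hZF (p.1.partSize I) (p.2.2 I) (fun i => F (p.1.emb I i))) φ
  have h0 := h.self_of_nhds S₀ hS₀ p.2.1 φ (mem_of_mem_nhds hW)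
  rw [show (blockTerm S₀ (Z Λ₀) p.1 p.2 F).1 φ = _ from h0]
  refine Tendsto.congr' (f₁ := fun Λ => ∑ q, c q Λ *
    ((S Λ).coeff p.1.length p.2.1 (G q)).1 φ) ?_ ?_
  · filter_upwards [h.filter_mono nhdsWithin_le_nhds, hS] with Λ h1 h2
    exact (h1 (S Λ) h2 p.2.1 φ (mem_of_mem_nhds hW)).symm
  · refine tendsto_finsetSum _ fun q _ => Tendsto.mul ?_ (hSF _ _ _ _)
    exact (AnalyticAt.continuousAt (hc q)).tendsto.mono_left nhdsWithin_le_nhds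

/-! ### Principal parts of families of formal maps -/

section Germ

variable {ℓ : (ℂ → ℂ) →ₗ[ℂ] ℂ} (hℓ : GermFunctional Λ₀ ℓ)

theorem GermFunctional.apply_expansion (hℓ : GermFunctional Λ₀ ℓ) {H : ℂ → Local s}
    {W : Set (Config s)} {r : ℕ} {c : Fin r → ℂ → ℂ} {G : Fin r → Local s}
    (h : ∀ᶠ Λ in 𝓝[≠] Λ₀, ∀ φ ∈ W, (H Λ).1 φ = ∑ i, c i Λ * (G i).1 φ) {φ : Config s}
    (hφ : φ ∈ W) : ℓ (fun Λ => (H Λ).1 φ) = ∑ i, ℓ (c i) * (G i).1 φ := by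
  rw [hℓ.congr (g := ∑ i, (G i).1 φ • c i), map_sum]
  · refine Finset.sum_congr rfl fun i _ => ?_
    rw [map_smul, smul_eq_mul, mul_comm]
  · filter_upwards [h] with Λ hΛ
    rw [hΛ φ hφ, Finset.sum_apply]
    exact Finset.sum_congr rfl fun i _ => mul_comm _ _

/-- A germ functional applied to a meromorphic family of local functionals gives a local
functional. -/
def GermFunctional.onLocal {H : ℂ → Local s} (hH : MeromorphicFamilyAt H Λ₀) : Local s :=
  ⟨fun φ => ℓ fun Λ => (H Λ).1 φ, by
    refine mem_local_of_locally (fun φ ψ χ hφχ => ?_) fun φ₀ => ?_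
    · rw [← map_sub, ← map_add]
      exact congrArg ℓ (funext fun Λ => (H Λ).2.2.1 φ ψ χ hφχ)
    · obtain ⟨W, hW, r, c, G, hc, h⟩ := hH φ₀
      refine ⟨(∑ i, ℓ (c i) • G i : Local s).1, (∑ i, ℓ (c i) • G i : Local s).2, ?_⟩
      filter_upwards [hW] with φ hφ
      rw [hℓ.apply_expansion h hφ, Submodule.coe_sum, Finset.sum_apply]
      rfl⟩

theorem GermFunctional.onLocal_apply {H : ℂ → Local s} (hH : MeromorphicFamilyAt H Λ₀)
    (φ : Config s) : (hℓ.onLocal hH).1 φ = ℓ fun Λ => (H Λ).1 φ := rfl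

/-- Germ functionals commute with functional derivatives. -/
theorem GermFunctional.funcDeriv_onLocal {H : ℂ → Local s} (hH : MeromorphicFamilyAt H Λ₀)
    (n : ℕ) (φ : Config s) (ψ : Fin n → Config s) :
    funcDeriv (hℓ.onLocal hH).1 n φ ψ = ℓ fun Λ => funcDeriv (H Λ).1 n φ ψ := by
  obtain ⟨W, hW, r, c, G, hc, h⟩ := hH φ
  have key : ∀ a : Fin r → ℂ, funcDeriv (∑ i, a i • (G i).1) n φ ψ =
      ∑ i, a i * funcDeriv (G i).1 n φ ψ := by
    intro a
    rw [(SmoothFunctional.sum Finset.univ fun i _ => (G i).2.1.1.smul (a i)).2]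
    exact Finset.sum_congr rfl fun i _ => funcDeriv_smul (G i).2.1.1 _ _ _ _
  have h1 : (hℓ.onLocal hH).1 =ᶠ[𝓝 φ] ∑ i, ℓ (c i) • (G i).1 := by
    filter_upwards [hW] with φ' hφ'
    rw [hℓ.onLocal_apply, hℓ.apply_expansion h hφ', Finset.sum_apply]
    rfl
  rw [funcDeriv_congr_nhds n h1, key, hℓ.congr (g := ∑ i, funcDeriv (G i).1 n φ ψ • c i), map_sum]
  · refine Finset.sum_congr rfl fun i _ => ?_
    rw [map_smul, smul_eq_mul, mul_comm]
  · filter_upwards [h] with Λ hΛ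
    have h2 : (H Λ).1 =ᶠ[𝓝 φ] ∑ i, c i Λ • (G i).1 := by
      filter_upwards [hW] with φ' hφ'
      rw [hΛ φ' hφ', Finset.sum_apply]
      rfl
    rw [funcDeriv_congr_nhds n h2, key, Finset.sum_apply]
    exact Finset.sum_congr rfl fun i _ => mul_comm _ _

variable {C : ℂ → FormalMap s (Local s)}
  (hC : ∀ (n L : ℕ) (F : Fin n → Local s), MeromorphicFamilyAt (fun Λ => (C Λ).coeff n L F) Λ₀)

/-- A germ functional applied to a meromorphic family of formal maps. -/
def GermFunctional.onMap : FormalMap s (Local s) where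
  coeff n L :=
    { toFun := fun F => hℓ.onLocal (hC n L F)
      map_update_add' := by
        intro inst F i u v
        refine Subtype.ext (funext fun φ => ?_)
        refine Eq.trans ?_ (map_add ℓ _ _)
        refine congrArg ℓ (funext fun Λ => ?_)
        exact congrArg (fun G : Local s => G.1 φ) (((C Λ).coeff n L).map_update_add F i u v)
      map_update_smul' := by
        intro inst F i c u
        refine Subtype.ext (funext fun φ => ?_)
        refine Eq.trans ?_ (map_smul ℓ c _)
        refine congrArg ℓ (funext fun Λ => ?_)
        exact congrArg (fun G : Local s => G.1 φ) (((C Λ).coeff n L).map_update_smul F i c u) }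
  symm n L σ F := by
    refine Subtype.ext (funext fun φ => congrArg ℓ (funext fun Λ => ?_))
    exact congrArg (fun G : Local s => G.1 φ) ((C Λ).symm n L σ F)

theorem GermFunctional.onMap_apply (n L : ℕ) (F : Fin n → Local s) (φ : Config s) :
    ((hℓ.onMap hC).coeff n L F).1 φ = ℓ fun Λ => ((C Λ).coeff n L F).1 φ := rfl

theorem GermFunctional.onMap_eq_zero {n L : ℕ} {F : Fin n → Local s}
    (h : ∀ᶠ Λ in 𝓝[≠] Λ₀, (C Λ).coeff n L F = 0) : (hℓ.onMap hC).coeff n L F = 0 := by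
  refine Subtype.ext (funext fun φ => hℓ _ ?_)
  filter_upwards [h] with Λ hΛ
  rw [hΛ]
  rfl

/-- All conditions of tameness are linear in the formal map, hence they are preserved by germ
functionals. -/
theorem GermFunctional.tame_onMap (h : ∀ᶠ Λ in 𝓝[≠] Λ₀, Tame 𝒢 (C Λ)) :
    Tame 𝒢 (hℓ.onMap hC) := by
  refine ⟨⟨?_, ?_, ?_⟩, ?_⟩
  · intro n L F F' ψ hF φ
    show funcDeriv (hℓ.onLocal (hC n L F)).1 1 φ (fun _ => ψ) = _
    rw [hℓ.funcDeriv_onLocal]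
    simp only [hℓ.onMap_apply]
    rw [← map_sum]
    refine hℓ.congr ?_
    filter_upwards [h] with Λ hΛ
    rw [hΛ.field_independent n L F F' ψ hF φ, Finset.sum_apply]
  · intro n L F φ v hv hL
    refine hℓ _ ?_
    filter_upwards [h] with Λ hΛ
    exact hΛ.phi_local n L F φ v hv hL
  · intro g hg n L F F' hF φ
    refine hℓ.congr ?_
    filter_upwards [h] with Λ hΛ
    exact hΛ.covariant g hg n L F F' hF φ
  · intro n L F i j hij hd
    refine hℓ.onMap_eq_zero hC ?_
    filter_upwards [h] with Λ hΛ
    exact hΛ.offDiagonal n L F i j hij hd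

end Germ

end

/-! ### The renormalization group as a group of formal maps -/

section

variable {s : ℕ} {Y : Submodule ℂ (Config s → ℂ)} {𝒢 : Subgroup (Mink s ≃ᵃ[ℝ] Mink s)} {Λ₀ : ℂ}

theorem FormalMap.eq_of_coeff {Z W : FormalMap s Y}
    (h : ∀ n L F, Z.coeff n L F = W.coeff n L F) : Z = W := by
  rcases Z with ⟨z, hz⟩
  rcases W with ⟨w, hw⟩
  obtain rfl : z = w := funext fun n => funext fun L => MultilinearMap.ext (h n L)
  rfl

theorem isIdentity_iff {Z : FormalMap s (Local s)} :
    IsIdentity (fun n L F => Z.coeff n L F) ↔ Z = FormalMap.one s :=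
  ⟨fun h => FormalMap.eq_of_coeff h, fun h => by subst h; exact FormalMap.one_coeff⟩

theorem RenormGroup.of_tame {Z : FormalMap s (Local s)} (hT : Tame 𝒢 Z)
    (h0 : ∀ L F, Z.coeff 0 L F = 0) (h1 : FirstIsId Z)
    (h2 : ∀ n, 2 ≤ n → ∀ F, Z.coeff n 0 F = 0) : RenormGroup 𝒢 Z :=
  ⟨h0, h1, h2, hT.offDiagonal.localMap, hT.field_independent, hT.phi_local, hT.covariant⟩

theorem Tame.one : Tame 𝒢 (FormalMap.one s) := by
  refine ⟨⟨?_, ?_, ?_⟩, ?_⟩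
  · intro n L F F' ψ hF φ
    simp only [FormalMap.one_coeff]
    split_ifs with h
    · obtain ⟨rfl, -⟩ := h
      simp only [Fin.zero_eta, Fin.isValue, Finset.univ_unique, Fin.default_eq_zero,
        Finset.sum_singleton, Function.update_self]
      exact (hF 0 φ).symm
    · exact (funcDeriv_zero 1 φ _).trans Finset.sum_const_zero.symm
  · intro n L F φ v hv hL
    rw [FormalMap.one_coeff]
    split_ifs with h
    · obtain ⟨rfl, rfl⟩ := h
      simp only [Finset.univ_unique, Fin.default_eq_zero, Finset.sum_singleton] at hL
      exact hv 0 0 (by omega) Fin.elim0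
    · rfl
  · intro g _ n L F F' hF φ
    simp only [FormalMap.one_coeff]
    split_ifs with h
    · exact hF _ φ
    · rfl
  · intro n L F i j hij _
    refine FormalMap.one_coeff_of_ne ?_ L F
    rintro rfl
    exact hij (Subsingleton.elim i j)

theorem RenormGroup.one : RenormGroup 𝒢 (FormalMap.one s) :=
  RenormGroup.of_tame Tame.one (fun L F => FormalMap.one_coeff_of_ne (by omega) L F)
    FormalMap.one_firstIsId fun _ hn F => FormalMap.one_coeff_of_ne (by omega) 0 F

theorem RenormGroup.comp {Z W : FormalMap s (Local s)} (hZ : RenormGroup 𝒢 Z)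
    (hW : RenormGroup 𝒢 W) : RenormGroup 𝒢 (Z.comp W) := by
  refine RenormGroup.of_tame (hZ.tame.comp hW.tame) (fun L F => ?_) (fun L F φ => ?_)
    fun n hn F => ?_
  · rw [FormalMap.comp_coeff, compCoeff_zero, hZ.map_zero]
  · rw [FormalMap.comp_coeff, compCoeff_one Z hW.first_order, hZ.first_order]
  · rw [FormalMap.comp_coeff, compCoeff_eq_single_add Z W (by omega : 0 < n),
      partTerm_singleBlock' hZ.first_order, hW.tangent_id n hn, zero_add]
    refine Finset.sum_eq_zero fun P hP => ?_
    rw [partTerm_eq_sum]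
    refine Finset.sum_eq_zero fun p hp => ?_
    have h1 : p.1 = 0 := by have := mem_hIndex.1 hp; omega
    rw [blockTerm, h1]
    exact hZ.tangent_id _ (Finset.mem_filter.1 hP).2 _

/-- The difference of formal maps. -/
def FormalMap.sub (Z W : FormalMap s Y) : FormalMap s Y where
  coeff n L := Z.coeff n L - W.coeff n L
  symm n L σ F := by
    rw [_root_.sub_apply, _root_.sub_apply, Z.symm, W.symm]

theorem FormalMap.sub_coeff (Z W : FormalMap s Y) (n L : ℕ) (F : Fin n → Local s) :
    (Z.sub W).coeff n L F = Z.coeff n L F - W.coeff n L F := rfl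

theorem Tame.sub {Z W : FormalMap s (Local s)} (hZ : Tame 𝒢 Z) (hW : Tame 𝒢 W) :
    Tame 𝒢 (Z.sub W) := by
  refine ⟨⟨?_, ?_, ?_⟩, ?_⟩
  · intro n L F F' ψ hF φ
    have h1 : (((Z.sub W).coeff n L F : Local s) : Config s → ℂ) =
        (Z.coeff n L F).1 + (-1 : ℂ) • (W.coeff n L F).1 := by
      funext φ
      show (Z.coeff n L F).1 φ - (W.coeff n L F).1 φ =
        (Z.coeff n L F).1 φ + (-1) * (W.coeff n L F).1 φ
      ring
    rw [h1, funcDeriv_add (Z.coeff n L F).2.1.1 ((W.coeff n L F).2.1.1.smul _),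
      funcDeriv_smul (W.coeff n L F).2.1.1, hZ.field_independent n L F F' ψ hF φ,
      hW.field_independent n L F F' ψ hF φ, neg_one_mul, ← sub_eq_add_neg,
      ← Finset.sum_sub_distrib]
    rfl
  · intro n L F φ v hv hL
    show (Z.coeff n L F).1 φ - (W.coeff n L F).1 φ = 0
    rw [hZ.phi_local n L F φ v hv hL, hW.phi_local n L F φ v hv hL, sub_zero]
  · intro g hg n L F F' hF φ
    show (Z.coeff n L F').1 φ - (W.coeff n L F').1 φ = _
    rw [hZ.covariant g hg n L F F' hF φ, hW.covariant g hg n L F F' hF φ]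
    rfl
  · intro n L F i j hij hd
    rw [FormalMap.sub_coeff, hZ.offDiagonal n L F i j hij hd, hW.offDiagonal n L F i j hij hd,
      sub_zero]

/-- The formal map `Z`, with its term of degree `n` replaced by that of `W`. -/
def FormalMap.splice (n : ℕ) (Z W : FormalMap s Y) : FormalMap s Y where
  coeff k L := if k = n then W.coeff k L else Z.coeff k L
  symm k L σ F := by
    split_ifs
    exacts [W.symm k L σ F, Z.symm k L σ F]

theorem FormalMap.splice_coeff_self (n : ℕ) (Z W : FormalMap s Y) (L : ℕ) :
    (FormalMap.splice n Z W).coeff n L = W.coeff n L := if_pos rfl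

theorem FormalMap.splice_coeff_of_ne {n k : ℕ} (h : k ≠ n) (Z W : FormalMap s Y) (L : ℕ) :
    (FormalMap.splice n Z W).coeff k L = Z.coeff k L := if_neg h

theorem Tame.splice {Z W : FormalMap s (Local s)} (hZ : Tame 𝒢 Z) (hW : Tame 𝒢 W) (n : ℕ) :
    Tame 𝒢 (FormalMap.splice n Z W) := by
  refine ⟨⟨?_, ?_, ?_⟩, ?_⟩
  · intro k L F F' ψ hF φ
    by_cases h : k = n
    · subst h
      simp only [FormalMap.splice_coeff_self]
      exact hW.field_independent k L F F' ψ hF φ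
    · simp only [FormalMap.splice_coeff_of_ne h]
      exact hZ.field_independent k L F F' ψ hF φ
  · intro k L F φ v hv hL
    by_cases h : k = n
    · subst h
      rw [FormalMap.splice_coeff_self]
      exact hW.phi_local k L F φ v hv hL
    · rw [FormalMap.splice_coeff_of_ne h]
      exact hZ.phi_local k L F φ v hv hL
  · intro g hg k L F F' hF φ
    by_cases h : k = n
    · subst h
      simp only [FormalMap.splice_coeff_self]
      exact hW.covariant g hg k L F F' hF φ
    · simp only [FormalMap.splice_coeff_of_ne h]
      exact hZ.covariant g hg k L F F' hF φ
  · intro k L F i j hij hd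
    by_cases h : k = n
    · subst h
      rw [FormalMap.splice_coeff_self]
      exact hW.offDiagonal k L F i j hij hd
    · rw [FormalMap.splice_coeff_of_ne h]
      exact hZ.offDiagonal k L F i j hij hd

theorem RenormGroup.splice {Z W : FormalMap s (Local s)} (hZ : RenormGroup 𝒢 Z)
    (hW : Tame 𝒢 W) {n : ℕ} (hn : 2 ≤ n) (hW0 : ∀ F, W.coeff n 0 F = 0) :
    RenormGroup 𝒢 (FormalMap.splice n Z W) := by
  refine RenormGroup.of_tame (hZ.tame.splice hW n) ?_ ?_ ?_
  · intro L F
    rw [FormalMap.splice_coeff_of_ne (by omega)]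
    exact hZ.map_zero L F
  · intro L F φ
    rw [FormalMap.splice_coeff_of_ne (by omega)]
    exact hZ.first_order L F φ
  · intro k hk F
    by_cases h : k = n
    · subst h
      rw [FormalMap.splice_coeff_self]
      exact hW0 F
    · rw [FormalMap.splice_coeff_of_ne h]
      exact hZ.tangent_id k hk F

/-- The formal map whose term of degree `n` is that of `A n`. -/
def FormalMap.diagonal (A : ℕ → FormalMap s Y) : FormalMap s Y where
  coeff n L := (A n).coeff n L
  symm n L σ F := (A n).symm n L σ F

theorem RenormGroup.diagonal {A : ℕ → FormalMap s (Local s)} (hA : ∀ n, RenormGroup 𝒢 (A n)) :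
    RenormGroup 𝒢 (FormalMap.diagonal A) where
  map_zero := (hA 0).map_zero
  first_order := (hA 1).first_order
  tangent_id n := (hA n).tangent_id n
  isLocal n := (hA n).isLocal n
  field_independent n := (hA n).field_independent n
  phi_local n := (hA n).phi_local n
  covariant g hg n := (hA n).covariant g hg n

end

/-! ### Minimal subtraction -/

section

variable {s : ℕ} {Y : Submodule ℂ (Config s → ℂ)} {𝒢 : Subgroup (Mink s ≃ᵃ[ℝ] Mink s)} {Λ₀ : ℂ}

theorem partTerm_congr {S S' : FormalMap s Y} {Z Z' : FormalMap s (Local s)} {n : ℕ}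
    (P : OrderedFinpartition n) (hS : ∀ L, S.coeff P.length L = S'.coeff P.length L)
    (hZ : ∀ I L, Z.coeff (P.partSize I) L = Z'.coeff (P.partSize I) L) (L : ℕ)
    (F : Fin n → Local s) : partTerm S Z P L F = partTerm S' Z' P L F := by
  simp only [partTerm, hS, hZ]

/-- The principal part of a meromorphic family is meromorphic. -/
theorem meromorphicFamilyAt_of_principalPart {H R : ℂ → Local s} (hH : MeromorphicFamilyAt H Λ₀)
    (hR : ∀ Λ φ, (R Λ).1 φ = principalPartAt Λ₀ Λ fun Λ' => (H Λ').1 φ) :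
    MeromorphicFamilyAt R Λ₀ := by
  intro φ₀
  obtain ⟨W, hW, r, c, G, hc, h⟩ := hH φ₀
  refine ⟨W, hW, r, fun i => principalPart Λ₀ (c i), G,
    fun i => meromorphicAt_of_mem_polarFunctions (principalPart_mem (hc i)),
    Eventually.of_forall fun Λ φ hφ => ?_⟩
  rw [hR, (germFunctional_principalPartAt Λ).apply_expansion h hφ]
  rfl

/-- The regular part of a meromorphic family, extended to `Λ₀` by its limit, is regular. -/
theorem regularFamilyAt_of_regularPart {H R : ℂ → Local s} (hH : MeromorphicFamilyAt H Λ₀)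
    (hR : ∀ Λ, Λ ≠ Λ₀ → ∀ φ,
      (R Λ).1 φ = (H Λ).1 φ - principalPartAt Λ₀ Λ fun Λ' => (H Λ').1 φ)
    (hR₀ : ∀ φ, (R Λ₀).1 φ = regularValue Λ₀ fun Λ' => (H Λ').1 φ) :
    RegularFamilyAt R Λ₀ := by
  intro φ₀
  obtain ⟨W, hW, r, c, G, hc, h⟩ := hH φ₀
  choose g hg hcg using fun i => sub_principalPart_mem (hc i)
  refine ⟨W, hW, r, g, G, hg, ?_⟩
  have h1 := eventually_nhdsWithin_iff.1 ((eventually_all.2 hcg).and h)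
  filter_upwards [h1] with Λ hΛ φ hφ
  by_cases hne : Λ = Λ₀
  · subst hne
    rw [hR₀, germFunctional_regularValue.apply_expansion h hφ]
    refine Finset.sum_congr rfl fun i _ => ?_
    congr 1
    refine limitAt_eq ?_
    exact ((hg i).continuousAt.tendsto.mono_left nhdsWithin_le_nhds).congr' (hcg i).symm
  · obtain ⟨h2, h3⟩ := hΛ hne
    rw [hR Λ hne, (germFunctional_principalPartAt Λ).apply_expansion h hφ, h3 φ hφ,
      ← Finset.sum_sub_distrib]
    refine Finset.sum_congr rfl fun i _ => ?_
    rw [← h2 i, ← sub_mul]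
    rfl

/-- Two families of maps which approximate the factors of the Birkhoff decomposition, up to terms
of degree at least `N`. -/
structure BirkhoffStage (𝒢 : Subgroup (Mink s ≃ᵃ[ℝ] Mink s)) (U : Set ℂ) (Λ₀ : ℂ) (N : ℕ)
    (A B : ℂ → FormalMap s (Local s)) : Prop where
  left : ∀ Λ ∈ U, Λ ≠ Λ₀ → RenormGroup 𝒢 (A Λ)
  right : ∀ Λ ∈ U, RenormGroup 𝒢 (B Λ)
  left_meromorphic : ∀ (n L : ℕ) (F : Fin n → Local s),
    MeromorphicFamilyAt (fun Λ => (A Λ).coeff n L F) Λ₀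
  right_regular : ∀ (n L : ℕ) (F : Fin n → Local s),
    RegularFamilyAt (fun Λ => (B Λ).coeff n L F) Λ₀
  left_zero : ∀ Λ n, N ≤ n → ∀ (L : ℕ) (F : Fin n → Local s), (A Λ).coeff n L F = 0
  right_zero : ∀ Λ n, N ≤ n → ∀ (L : ℕ) (F : Fin n → Local s), (B Λ).coeff n L F = 0

theorem eventually_mem_and_ne {U : Set ℂ} (hU : IsOpen U) (hΛ₀ : Λ₀ ∈ U) :
    ∀ᶠ Λ in 𝓝[≠] Λ₀, Λ ∈ U ∧ Λ ≠ Λ₀ := by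
  filter_upwards [mem_nhdsWithin_of_mem_nhds (hU.mem_nhds hΛ₀), self_mem_nhdsWithin] with Λ h1 h2
  exact ⟨h1, h2⟩

theorem regularFamilyAt_const (G : Local s) : RegularFamilyAt (fun _ => G) Λ₀ :=
  regularFamilyAt_iff.2 fun _ => ExpandsAt.const G

theorem birkhoffStage_one (U : Set ℂ) : BirkhoffStage 𝒢 U Λ₀ 2 (fun _ => FormalMap.one s)
    (fun _ => FormalMap.one s) where
  left _ _ _ := RenormGroup.one
  right _ _ := RenormGroup.one
  left_meromorphic _ _ _ := (regularFamilyAt_const _).meromorphic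
  right_regular _ _ _ := regularFamilyAt_const _
  left_zero _ _ hn L F := FormalMap.one_coeff_of_ne (by omega) L F
  right_zero _ _ hn L F := FormalMap.one_coeff_of_ne (by omega) L F

/-- The inductive step: in degree `N` the difference of `Z` and the composition of the factors
constructed so far is split into its principal part and its regular part. -/
theorem BirkhoffStage.exists_next {U : Set ℂ} (hU : IsOpen U) (hΛ₀ : Λ₀ ∈ U)
    {Z : ℂ → FormalMap s (Local s)} (hZ : ∀ Λ ∈ U, Λ ≠ Λ₀ → RenormGroup 𝒢 (Z Λ))
    (hZmero : ∀ (n L : ℕ) (F : Fin n → Local s),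
      MeromorphicFamilyAt (fun Λ => (Z Λ).coeff n L F) Λ₀)
    {N : ℕ} (hN : 2 ≤ N) {A B : ℂ → FormalMap s (Local s)} (h : BirkhoffStage 𝒢 U Λ₀ N A B) :
    ∃ A' B' : ℂ → FormalMap s (Local s), BirkhoffStage 𝒢 U Λ₀ (N + 1) A' B' ∧
      (∀ Λ, ∀ k ≠ N, ∀ L, (A' Λ).coeff k L = (A Λ).coeff k L ∧
        (B' Λ).coeff k L = (B Λ).coeff k L) ∧
      (∀ L (F : Fin N → Local s) φ Λ, ((A' Λ).coeff N L F).1 φ = principalPart Λ₀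
        (fun Λ' => ((Z Λ').coeff N L F).1 φ - (compCoeff (A Λ') (B Λ') N L F).1 φ) Λ) ∧
      ∀ Λ ≠ Λ₀, ∀ L (F : Fin N → Local s),
        (A' Λ).coeff N L F + (B' Λ).coeff N L F =
          (Z Λ).coeff N L F - compCoeff (A Λ) (B Λ) N L F := by
  classical
  set C : ℂ → FormalMap s (Local s) := fun Λ => (Z Λ).sub ((A Λ).comp (B Λ)) with hCdef
  have hev := eventually_mem_and_ne hU hΛ₀
  have hC : ∀ (n L : ℕ) (F : Fin n → Local s),
      MeromorphicFamilyAt (fun Λ => (C Λ).coeff n L F) Λ₀ := by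
    intro n L F
    refine meromorphicFamilyAt_iff.2 fun φ₀ => ?_
    refine ExpandsAt.sub (hZmero n L F φ₀) (ExpandsAt.comp ?_ ?_ ?_ n L F)
    · exact hev.mono fun Λ hΛ => (h.left Λ hΛ.1 hΛ.2).phi_local
    · exact fun k L F => h.left_meromorphic k L F φ₀
    · exact fun k L F => (h.right_regular k L F).meromorphic φ₀
  have hCtame : ∀ Λ ∈ U, Λ ≠ Λ₀ → Tame 𝒢 (C Λ) := fun Λ hΛ hne =>
    (hZ Λ hΛ hne).tame.sub ((h.left Λ hΛ hne).comp (h.right Λ hΛ)).tame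
  have hC0 : ∀ Λ ∈ U, Λ ≠ Λ₀ → ∀ F : Fin N → Local s, (C Λ).coeff N 0 F = 0 := by
    intro Λ hΛ hne F
    rw [hCdef, FormalMap.sub_coeff, (hZ Λ hΛ hne).tangent_id N hN,
      ((h.left Λ hΛ hne).comp (h.right Λ hΛ)).tangent_id N hN, sub_zero]
  have hCtame' : ∀ᶠ Λ in 𝓝[≠] Λ₀, Tame 𝒢 (C Λ) := hev.mono fun Λ hΛ => hCtame Λ hΛ.1 hΛ.2
  have hC0' : ∀ F : Fin N → Local s, ∀ᶠ Λ in 𝓝[≠] Λ₀, (C Λ).coeff N 0 F = 0 :=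
    fun F => hev.mono fun Λ hΛ => hC0 Λ hΛ.1 hΛ.2 F
  -- the principal part `P` of `C`, and its regular part `D`, extended to `Λ₀` by its limit `Q`
  set P : ℂ → FormalMap s (Local s) := fun Λ =>
    (germFunctional_principalPartAt (Λ₀ := Λ₀) Λ).onMap hC with hPdef
  have hPtame : ∀ Λ, Tame 𝒢 (P Λ) := fun Λ => GermFunctional.tame_onMap _ hC hCtame'
  have hP0 : ∀ Λ (F : Fin N → Local s), (P Λ).coeff N 0 F = 0 := fun Λ F =>
    GermFunctional.onMap_eq_zero _ hC (hC0' F)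
  set Q : FormalMap s (Local s) := (germFunctional_regularValue (Λ₀ := Λ₀)).onMap hC with hQdef
  set D : ℂ → FormalMap s (Local s) := fun Λ => if Λ = Λ₀ then Q else (C Λ).sub (P Λ) with hDdef
  have hDne : ∀ Λ, Λ ≠ Λ₀ → D Λ = (C Λ).sub (P Λ) := fun Λ hne => if_neg hne
  have hDeq : D Λ₀ = Q := if_pos rfl
  have hDtame : ∀ Λ ∈ U, Tame 𝒢 (D Λ) := by
    intro Λ hΛ
    by_cases hne : Λ = Λ₀
    · rw [hne, hDeq]
      exact GermFunctional.tame_onMap _ hC hCtame'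
    · rw [hDne Λ hne]
      exact (hCtame Λ hΛ hne).sub (hPtame Λ)
  have hD0 : ∀ Λ ∈ U, ∀ F : Fin N → Local s, (D Λ).coeff N 0 F = 0 := by
    intro Λ hΛ F
    by_cases hne : Λ = Λ₀
    · rw [hne, hDeq]
      exact GermFunctional.onMap_eq_zero _ hC (hC0' F)
    · rw [hDne Λ hne, FormalMap.sub_coeff, hC0 Λ hΛ hne, hP0, sub_zero]
  refine ⟨fun Λ => FormalMap.splice N (A Λ) (P Λ), fun Λ => FormalMap.splice N (B Λ) (D Λ),
    ⟨?_, ?_, ?_, ?_, ?_, ?_⟩, ?_, ?_, ?_⟩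
  · exact fun Λ hΛ hne => (h.left Λ hΛ hne).splice (hPtame Λ) hN (hP0 Λ)
  · exact fun Λ hΛ => (h.right Λ hΛ).splice (hDtame Λ hΛ) hN (hD0 Λ hΛ)
  · intro n L F
    by_cases hn : n = N
    · subst hn
      simp only [FormalMap.splice_coeff_self]
      exact meromorphicFamilyAt_of_principalPart (hC n L F) fun _ _ => rfl
    · simp only [FormalMap.splice_coeff_of_ne hn]
      exact h.left_meromorphic n L F
  · intro n L F
    by_cases hn : n = N
    · subst hn
      simp only [FormalMap.splice_coeff_self]
      refine regularFamilyAt_of_regularPart (hC n L F) (fun Λ hne φ => ?_) fun φ => ?_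
      · rw [hDne Λ hne]
        rfl
      · rw [hDeq]
        rfl
    · simp only [FormalMap.splice_coeff_of_ne hn]
      exact h.right_regular n L F
  · intro Λ n hn L F
    rw [FormalMap.splice_coeff_of_ne (by omega)]
    exact h.left_zero Λ n (by omega) L F
  · intro Λ n hn L F
    rw [FormalMap.splice_coeff_of_ne (by omega)]
    exact h.right_zero Λ n (by omega) L F
  · exact fun Λ k hk L =>
      ⟨FormalMap.splice_coeff_of_ne hk _ _ L, FormalMap.splice_coeff_of_ne hk _ _ L⟩
  · intro L F φ Λ
    rw [FormalMap.splice_coeff_self]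
    rfl
  · intro Λ hne L F
    rw [FormalMap.splice_coeff_self, FormalMap.splice_coeff_self, hDne Λ hne,
      FormalMap.sub_coeff, add_sub_cancel]
    rfl

/-- If the terms of degree at least `n` of both factors vanish, only the partitions different from
the extreme ones contribute to the term of degree `n` of the composition. -/
theorem compCoeff_eq_sum_middle {A B : FormalMap s (Local s)} {n : ℕ} (hn : 2 ≤ n)
    (hA : ∀ L (F : Fin n → Local s), A.coeff n L F = 0)
    (hB : ∀ L (F : Fin n → Local s), B.coeff n L F = 0) (L : ℕ) (F : Fin n → Local s) :
    compCoeff A B n L F =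
      ∑ P : OrderedFinpartition n with 1 < P.length ∧ P.length < n, partTerm A B P L F := by
  rw [compCoeff_eq_single_add_atomic A B hn,
    partTerm_eq_zero_of_right A B (singleBlock (by omega)) (0 : Fin 1) hB,
    partTerm_eq_zero_of_left A B (OrderedFinpartition.atomic n) hA, zero_add, zero_add]

/-- The existence of the Birkhoff decomposition by minimal subtraction. -/
theorem exists_birkhoff {U : Set ℂ} (hU : IsOpen U) (hΛ₀ : Λ₀ ∈ U)
    {Z : ℂ → FormalMap s (Local s)} (hZ : ∀ Λ ∈ U, Λ ≠ Λ₀ → RenormGroup 𝒢 (Z Λ))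
    (hZmero : ∀ (n L : ℕ) (F : Fin n → Local s),
      MeromorphicFamilyAt (fun Λ => (Z Λ).coeff n L F) Λ₀) :
    ∃ A B : ℂ → FormalMap s (Local s),
      (∀ Λ ∈ U, Λ ≠ Λ₀ → RenormGroup 𝒢 (A Λ) ∧ Z Λ = (A Λ).comp (B Λ)) ∧
      (∀ Λ ∈ U, RenormGroup 𝒢 (B Λ)) ∧
      (∀ (n L : ℕ) (F : Fin n → Local s), RegularFamilyAt (fun Λ => (B Λ).coeff n L F) Λ₀) ∧
      (∀ (n L : ℕ) (F : Fin n → Local s), MeromorphicFamilyAt (fun Λ => (A Λ).coeff n L F) Λ₀) ∧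
      ∀ n : ℕ, 2 ≤ n → ∀ (L : ℕ) (F : Fin n → Local s) (φ : Config s),
        (fun Λ => ((A Λ).coeff n L F).1 φ) = principalPart Λ₀ (fun Λ => ((Z Λ).coeff n L F).1 φ -
          ∑ P : OrderedFinpartition n with 1 < P.length ∧ P.length < n,
            (partTerm (A Λ) (B Λ) P L F).1 φ) := by
  have step : ∀ (j : ℕ) (p : {p : (ℂ → FormalMap s (Local s)) × (ℂ → FormalMap s (Local s)) //
      BirkhoffStage 𝒢 U Λ₀ (j + 2) p.1 p.2}), ∃ q : {p : (ℂ → FormalMap s (Local s)) ×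
      (ℂ → FormalMap s (Local s)) // BirkhoffStage 𝒢 U Λ₀ (j + 1 + 2) p.1 p.2},
      (∀ Λ, ∀ k ≠ j + 2, ∀ L, (q.1.1 Λ).coeff k L = (p.1.1 Λ).coeff k L ∧
        (q.1.2 Λ).coeff k L = (p.1.2 Λ).coeff k L) ∧
      (∀ L (F : Fin (j + 2) → Local s) φ Λ, ((q.1.1 Λ).coeff (j + 2) L F).1 φ = principalPart Λ₀
        (fun Λ' => ((Z Λ').coeff (j + 2) L F).1 φ -
          (compCoeff (p.1.1 Λ') (p.1.2 Λ') (j + 2) L F).1 φ) Λ) ∧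
      ∀ Λ ≠ Λ₀, ∀ L (F : Fin (j + 2) → Local s),
        (q.1.1 Λ).coeff (j + 2) L F + (q.1.2 Λ).coeff (j + 2) L F =
          (Z Λ).coeff (j + 2) L F - compCoeff (p.1.1 Λ) (p.1.2 Λ) (j + 2) L F := by
    rintro j ⟨⟨A, B⟩, h⟩
    obtain ⟨A', B', h', h1, h2, h3⟩ := h.exists_next hU hΛ₀ hZ hZmero (by omega)
    exact ⟨⟨⟨A', B'⟩, h'⟩, h1, h2, h3⟩
  choose next hnext using step
  let seq : (j : ℕ) → {p : (ℂ → FormalMap s (Local s)) × (ℂ → FormalMap s (Local s)) //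
      BirkhoffStage 𝒢 U Λ₀ (j + 2) p.1 p.2} := fun j =>
    Nat.rec ⟨⟨fun _ => FormalMap.one s, fun _ => FormalMap.one s⟩, birkhoffStage_one U⟩ next j
  have hseq : ∀ j, seq (j + 1) = next j (seq j) := fun _ => rfl
  -- the term of degree `k` does not change any more from the stage `k - 1` on
  have hstable : ∀ m j k, j ≤ m → k < j + 2 → ∀ Λ L,
      ((seq m).1.1 Λ).coeff k L = ((seq j).1.1 Λ).coeff k L ∧
      ((seq m).1.2 Λ).coeff k L = ((seq j).1.2 Λ).coeff k L := by
    intro m j k hm hk Λ L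
    induction m, hm using Nat.le_induction with
    | base => exact ⟨rfl, rfl⟩
    | succ m hm ih =>
      have h := (hnext m (seq m)).1 Λ k (by omega) L
      rw [← hseq] at h
      exact ⟨h.1.trans ih.1, h.2.trans ih.2⟩
  set A : ℂ → FormalMap s (Local s) := fun Λ => FormalMap.diagonal fun j => (seq j).1.1 Λ with hA
  set B : ℂ → FormalMap s (Local s) := fun Λ => FormalMap.diagonal fun j => (seq j).1.2 Λ with hB
  have hlim : ∀ j k, k < j + 2 → ∀ Λ L, (A Λ).coeff k L = ((seq j).1.1 Λ).coeff k L ∧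
      (B Λ).coeff k L = ((seq j).1.2 Λ).coeff k L := by
    intro j k hk Λ L
    have h1 := hstable (j + k) k k (by omega) (by omega) Λ L
    have h2 := hstable (j + k) j k (by omega) hk Λ L
    exact ⟨h1.1.symm.trans h2.1, h1.2.symm.trans h2.2⟩
  have hmid : ∀ (j L : ℕ) (F : Fin (j + 2) → Local s) Λ,
      compCoeff ((seq j).1.1 Λ) ((seq j).1.2 Λ) (j + 2) L F =
      ∑ P : OrderedFinpartition (j + 2) with 1 < P.length ∧ P.length < j + 2,
        partTerm (A Λ) (B Λ) P L F := by
    intro j L F Λ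
    rw [compCoeff_eq_sum_middle (by omega) ((seq j).2.left_zero Λ _ le_rfl)
      ((seq j).2.right_zero Λ _ le_rfl)]
    refine Finset.sum_congr rfl fun P hP => ?_
    have hP' := (Finset.mem_filter.1 hP).2
    exact partTerm_congr P (fun L => (hlim j _ hP'.2 Λ L).1.symm)
      (fun I L => (hlim j _ (partSize_lt P hP'.1 I) Λ L).2.symm) L F
  have hleft : ∀ Λ ∈ U, Λ ≠ Λ₀ → RenormGroup 𝒢 (A Λ) := fun Λ hΛ hne =>
    RenormGroup.diagonal fun j => (seq j).2.left Λ hΛ hne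
  have hright : ∀ Λ ∈ U, RenormGroup 𝒢 (B Λ) := fun Λ hΛ =>
    RenormGroup.diagonal fun j => (seq j).2.right Λ hΛ
  refine ⟨A, B, fun Λ hΛ hne => ⟨hleft Λ hΛ hne, ?_⟩, hright,
    fun n L F => (seq n).2.right_regular n L F, fun n L F => (seq n).2.left_meromorphic n L F, ?_⟩
  · refine FormalMap.eq_of_coeff fun n L F => ?_
    rw [FormalMap.comp_coeff]
    rcases Nat.lt_or_ge n 2 with hn | hn
    · interval_cases n
      · rw [compCoeff_zero, (hZ Λ hΛ hne).map_zero, (hleft Λ hΛ hne).map_zero]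
      · rw [compCoeff_one _ (hright Λ hΛ).first_order, (hZ Λ hΛ hne).first_order.coeff_eq,
          (hleft Λ hΛ hne).first_order.coeff_eq]
    · obtain ⟨j, rfl⟩ := Nat.exists_eq_add_of_le' hn
      have h := (hnext j (seq j)).2.2 Λ hne L F
      rw [← hseq, ← (hlim (j + 1) (j + 2) (by omega) Λ L).1,
        ← (hlim (j + 1) (j + 2) (by omega) Λ L).2, hmid] at h
      rw [compCoeff_eq_single_add_atomic _ _ hn, partTerm_singleBlock' (hleft Λ hΛ hne).first_order,
        partTerm_atomic _ (hright Λ hΛ).first_order, ← add_assoc, add_comm ((B Λ).coeff _ _ _), h,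
        sub_add_cancel]
  · intro n hn L F φ
    obtain ⟨j, rfl⟩ := Nat.exists_eq_add_of_le' hn
    funext Λ
    rw [(hlim (j + 1) (j + 2) (by omega) Λ L).1, hseq, (hnext j (seq j)).2.1 L F φ Λ]
    simp only [hmid, Submodule.coe_sum, Finset.sum_apply]

/-! ### Inverses -/

/-- A family of maps which approximates a left inverse of `Z`, up to terms of degree at
least `N`. -/
structure InverseStage (𝒢 : Subgroup (Mink s ≃ᵃ[ℝ] Mink s)) (U : Set ℂ) (Λ₀ : ℂ) (N : ℕ)
    (A : ℂ → FormalMap s (Local s)) : Prop where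
  renormGroup : ∀ Λ ∈ U, RenormGroup 𝒢 (A Λ)
  regular : ∀ (n L : ℕ) (F : Fin n → Local s), RegularFamilyAt (fun Λ => (A Λ).coeff n L F) Λ₀
  zero : ∀ Λ n, N ≤ n → ∀ (L : ℕ) (F : Fin n → Local s), (A Λ).coeff n L F = 0

/-- Left inverses are found by induction on the degree: the term of degree `n` has to cancel those
terms of the composition which contain terms of lower degree of the left factor. -/
theorem exists_left_inverse {U : Set ℂ} (hU : IsOpen U) (hΛ₀ : Λ₀ ∈ U)
    {Z : ℂ → FormalMap s (Local s)} (hZ : ∀ Λ ∈ U, RenormGroup 𝒢 (Z Λ))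
    (hZreg : ∀ (n L : ℕ) (F : Fin n → Local s),
      RegularFamilyAt (fun Λ => (Z Λ).coeff n L F) Λ₀) :
    ∃ A : ℂ → FormalMap s (Local s), (∀ Λ ∈ U, RenormGroup 𝒢 (A Λ)) ∧
      (∀ (n L : ℕ) (F : Fin n → Local s), RegularFamilyAt (fun Λ => (A Λ).coeff n L F) Λ₀) ∧
      ∀ Λ ∈ U, (A Λ).comp (Z Λ) = FormalMap.one s := by
  have step : ∀ (j : ℕ) (p : {A : ℂ → FormalMap s (Local s) // InverseStage 𝒢 U Λ₀ (j + 2) A}),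
      ∃ q : {A : ℂ → FormalMap s (Local s) // InverseStage 𝒢 U Λ₀ (j + 1 + 2) A},
      (∀ Λ, ∀ k ≠ j + 2, ∀ L, (q.1 Λ).coeff k L = (p.1 Λ).coeff k L) ∧
      ∀ Λ L (F : Fin (j + 2) → Local s),
        (q.1 Λ).coeff (j + 2) L F = -compCoeff (p.1 Λ) (Z Λ) (j + 2) L F := by
    rintro j ⟨A, h⟩
    -- in degrees different from `1`, the subtrahend `one` vanishes
    set D : ℂ → FormalMap s (Local s) := fun Λ =>
      (FormalMap.one s).sub ((A Λ).comp (Z Λ)) with hD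
    have hD1 : ∀ Λ L (F : Fin (j + 2) → Local s),
        (D Λ).coeff (j + 2) L F = -compCoeff (A Λ) (Z Λ) (j + 2) L F := by
      intro Λ L F
      rw [hD, FormalMap.sub_coeff, FormalMap.one_coeff_of_ne (by omega), zero_sub]
      rfl
    refine ⟨⟨fun Λ => FormalMap.splice (j + 2) (A Λ) (D Λ), ?_, ?_, ?_⟩, ?_, ?_⟩
    · intro Λ hΛ
      have hc := (h.renormGroup Λ hΛ).comp (hZ Λ hΛ)
      refine (h.renormGroup Λ hΛ).splice (Tame.one.sub hc.tame) (by omega) fun F => ?_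
      rw [hD1, ← FormalMap.comp_coeff, hc.tangent_id _ (by omega), neg_zero]
    · intro n L F
      by_cases hn : n = j + 2
      · subst hn
        simp only [FormalMap.splice_coeff_self]
        refine regularFamilyAt_iff.2 fun φ₀ => ?_
        refine ExpandsAt.sub (ExpandsAt.const _) (ExpandsAt.comp ?_ ?_ ?_ _ L F)
        · filter_upwards [hU.mem_nhds hΛ₀] with Λ hΛ
          exact (h.renormGroup Λ hΛ).phi_local
        · exact fun k L F => h.regular k L F φ₀
        · exact fun k L F => hZreg k L F φ₀
      · simp only [FormalMap.splice_coeff_of_ne hn]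
        exact h.regular n L F
    · intro Λ n hn L F
      rw [FormalMap.splice_coeff_of_ne (by omega)]
      exact h.zero Λ n (by omega) L F
    · exact fun Λ k hk L => FormalMap.splice_coeff_of_ne hk _ _ L
    · intro Λ L F
      rw [FormalMap.splice_coeff_self]
      exact hD1 Λ L F
  choose next hnext using step
  let seq : (j : ℕ) → {A : ℂ → FormalMap s (Local s) // InverseStage 𝒢 U Λ₀ (j + 2) A} := fun j =>
    Nat.rec ⟨fun _ => FormalMap.one s, fun _ _ => RenormGroup.one,
      fun _ _ _ => regularFamilyAt_const _,
      fun _ _ _ L F => FormalMap.one_coeff_of_ne (by omega) L F⟩ next j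
  have hseq : ∀ j, seq (j + 1) = next j (seq j) := fun _ => rfl
  have hstable : ∀ m j k, j ≤ m → k < j + 2 → ∀ Λ L,
      ((seq m).1 Λ).coeff k L = ((seq j).1 Λ).coeff k L := by
    intro m j k hm hk Λ L
    induction m, hm using Nat.le_induction with
    | base => rfl
    | succ m hm ih =>
      have h := (hnext m (seq m)).1 Λ k (by omega) L
      rw [← hseq] at h
      exact h.trans ih
  set A : ℂ → FormalMap s (Local s) := fun Λ => FormalMap.diagonal fun j => (seq j).1 Λ with hA
  have hlim : ∀ j k, k < j + 2 → ∀ Λ L, (A Λ).coeff k L = ((seq j).1 Λ).coeff k L := by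
    intro j k hk Λ L
    have h1 := hstable (j + k) k k (by omega) (by omega) Λ L
    have h2 := hstable (j + k) j k (by omega) hk Λ L
    exact h1.symm.trans h2
  have hRG : ∀ Λ ∈ U, RenormGroup 𝒢 (A Λ) := fun Λ hΛ =>
    RenormGroup.diagonal fun j => (seq j).2.renormGroup Λ hΛ
  refine ⟨A, hRG, fun n L F => (seq n).2.regular n L F, fun Λ hΛ => ?_⟩
  refine FormalMap.eq_of_coeff fun n L F => ?_
  rw [FormalMap.comp_coeff]
  rcases Nat.lt_or_ge n 2 with hn | hn
  · interval_cases n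
    · rw [compCoeff_zero, (hRG Λ hΛ).map_zero, FormalMap.one_coeff_of_ne (by omega)]
    · rw [compCoeff_one _ (hZ Λ hΛ).first_order, (hRG Λ hΛ).first_order.coeff_eq,
        FormalMap.one_firstIsId.coeff_eq]
  · obtain ⟨j, rfl⟩ := Nat.exists_eq_add_of_le' hn
    have h := (hnext j (seq j)).2 Λ L F
    have hz := (seq j).2.zero Λ (j + 2) le_rfl
    rw [← hseq, ← hlim (j + 1) (j + 2) (by omega) Λ L, compCoeff_eq_single_add_atomic _ _ hn,
      partTerm_singleBlock' ((seq j).2.renormGroup Λ hΛ).first_order,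
      partTerm_eq_zero_of_left _ _ (OrderedFinpartition.atomic (j + 2)) hz, zero_add] at h
    have hmid : ∑ P : OrderedFinpartition (j + 2) with 1 < P.length ∧ P.length < j + 2,
        partTerm (A Λ) (Z Λ) P L F = ∑ P : OrderedFinpartition (j + 2) with
          1 < P.length ∧ P.length < j + 2, partTerm ((seq j).1 Λ) (Z Λ) P L F :=
      Finset.sum_congr rfl fun P hP => partTerm_congr P
        (fun L => hlim j _ (Finset.mem_filter.1 hP).2.2 Λ L) (fun _ _ => rfl) L F
    rw [compCoeff_eq_single_add_atomic _ _ hn, partTerm_singleBlock' (hRG Λ hΛ).first_order,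
      partTerm_atomic _ (hZ Λ hΛ).first_order, h, hmid, FormalMap.one_coeff_of_ne (by omega)]
    abel

/-- Regular families in the renormalization group have inverses, which are regular as well. -/
theorem exists_inverse {U : Set ℂ} (hU : IsOpen U) (hΛ₀ : Λ₀ ∈ U)
    {Z : ℂ → FormalMap s (Local s)} (hZ : ∀ Λ ∈ U, RenormGroup 𝒢 (Z Λ))
    (hZreg : ∀ (n L : ℕ) (F : Fin n → Local s),
      RegularFamilyAt (fun Λ => (Z Λ).coeff n L F) Λ₀) :
    ∃ A : ℂ → FormalMap s (Local s), (∀ Λ ∈ U, RenormGroup 𝒢 (A Λ)) ∧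
      (∀ (n L : ℕ) (F : Fin n → Local s), RegularFamilyAt (fun Λ => (A Λ).coeff n L F) Λ₀) ∧
      ∀ Λ ∈ U, (A Λ).comp (Z Λ) = FormalMap.one s ∧ (Z Λ).comp (A Λ) = FormalMap.one s := by
  -- a left inverse `V` of the left inverse `A` of `Z` coincides with `Z`
  obtain ⟨A, hA, hAreg, hAZ⟩ := exists_left_inverse hU hΛ₀ hZ hZreg
  obtain ⟨V, hV, -, hVA⟩ := exists_left_inverse hU hΛ₀ hA hAreg
  refine ⟨A, hA, hAreg, fun Λ hΛ => ⟨hAZ Λ hΛ, ?_⟩⟩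
  have h : V Λ = Z Λ := by
    refine FormalMap.eq_of_coeff fun n L F => ?_
    rw [← FormalMap.comp_one (V Λ), ← hAZ Λ hΛ, ← FormalMap.comp_assoc, hVA Λ hΛ,
      FormalMap.one_comp (hZ Λ hΛ).map_zero]
  rw [← h]
  exact hVA Λ hΛ

end

/-! ### Renormalized S-matrices -/

section

variable {s : ℕ} {𝒢 : Subgroup (Mink s ≃ᵃ[ℝ] Mink s)} {Λ₀ : ℂ}

/-- The renormalization group acts on the S-matrices which satisfy the Epstein-Glaser axioms. -/
theorem EpsteinGlaser.comp {m : ℝ} {S : FormalMap s (Microcausal s)} (hS : EpsteinGlaser m 𝒢 S)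
    {Z : FormalMap s (Local s)} (hZ : RenormGroup 𝒢 Z) : EpsteinGlaser m 𝒢 (S.comp Z) := by
  have h : Equivariant 𝒢 (S.comp Z) :=
    Equivariant.comp le_rfl ⟨hS.field_independent, hS.phi_local, hS.covariant⟩
      hZ.tame.toEquivariant
  refine ⟨⟨fun L F φ => ?_, fun L F φ => ?_⟩, hS.causal.comp hZ.tame, h.phi_local,
    h.field_independent, h.covariant⟩
  · rw [FormalMap.comp_coeff, compCoeff_zero]
    exact hS.starting_element.1 L F φ
  · rw [FormalMap.comp_coeff, compCoeff_one S hZ.first_order]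
    exact hS.starting_element.2 L F φ

theorem FormalMap.comp_comp {Y : Submodule ℂ (Config s → ℂ)} (S : FormalMap s Y)
    (Z W : FormalMap s (Local s)) : (S.comp Z).comp W = S.comp (Z.comp W) :=
  FormalMap.eq_of_coeff (S.comp_assoc Z W)

/-- If the composition of the regularized S-matrix with the first factor has a limit, the first
factor is the negative of the principal part of the remaining terms. -/
theorem isPrincipalPart_neg {S : ℂ → FormalMap s (Microcausal s)}
    {A : ℂ → FormalMap s (Local s)} (hS : ∀ᶠ Λ in 𝓝[≠] Λ₀, FirstIsId (S Λ)) {n : ℕ} (hn : 2 ≤ n)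
    (L : ℕ) (F : Fin n → Local s) (φ : Config s)
    (hA : (fun Λ => ((A Λ).coeff n L F).1 φ) ∈ polarFunctions Λ₀)
    (hmero : MeromorphicAt (fun Λ => (((S Λ).comp (A Λ)).coeff n L F).1 φ) Λ₀) {a : ℂ}
    (ha : Tendsto (fun Λ => (((S Λ).comp (A Λ)).coeff n L F).1 φ) (𝓝[≠] Λ₀) (𝓝 a)) :
    IsPrincipalPart Λ₀ (fun Λ => ∑ P : OrderedFinpartition n with 1 < P.length,
      (partTerm (S Λ) (A Λ) P L F).1 φ) (fun Λ => -((A Λ).coeff n L F).1 φ) := by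
  refine isPrincipalPart_of_mem (neg_mem hA) ?_
  obtain ⟨g, hg, h⟩ := mem_regularFunctions_of_tendsto hmero ha
  refine ⟨g, hg, ?_⟩
  filter_upwards [h, hS] with Λ h1 h2
  rw [← h1, FormalMap.comp_coeff, compCoeff_eq_single_add _ _ (by omega : 0 < n),
    Submodule.coe_add, Pi.add_apply, partTerm_singleBlock h2, Submodule.coe_sum, Finset.sum_apply,
    Pi.sub_apply, sub_neg_eq_add, add_comm]

end

end PAQFT

end

theorem mainTheorem8 {s : ℕ} (hs : 1 ≤ s) (m : ℝ) (hm : 0 ≤ m) (hm' : m = 0 → 2 ≤ s)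
    (𝒢 : Subgroup (PAQFT.Mink s ≃ᵃ[ℝ] PAQFT.Mink s))
    (h𝒢 : ∀ g ∈ 𝒢, PAQFT.IsPoincare g)
    (h𝒢' : ∀ a : PAQFT.Mink s, AffineEquiv.constVAdd ℝ (PAQFT.Mink s) a ∈ 𝒢)
    (U : Set ℂ) (hU : IsOpen U) (Λ₀ : ℂ) (hΛ₀ : Λ₀ ∈ U)
    (Z : ℂ → PAQFT.FormalMap s (PAQFT.Local s))
    (hZ : ∀ Λ ∈ U, Λ ≠ Λ₀ → PAQFT.RenormGroup 𝒢 (Z Λ))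
    (hZmero : ∀ (n L : ℕ) (F : Fin n → PAQFT.Local s),
      PAQFT.MeromorphicFamilyAt (fun Λ => (Z Λ).coeff n L F) Λ₀) :
    ∃ ZMS Zf Zfinv : ℂ → PAQFT.FormalMap s (PAQFT.Local s),
      -- the decomposition inside the renormalization group
      (∀ Λ ∈ U, Λ ≠ Λ₀ → PAQFT.RenormGroup 𝒢 (ZMS Λ) ∧ PAQFT.IsComp (Z Λ) (ZMS Λ) (Zf Λ)) ∧
      (∀ Λ ∈ U, PAQFT.RenormGroup 𝒢 (Zf Λ)) ∧
      -- the second factor is regular at the limit point, the first one is meromorphic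
      (∀ (n L : ℕ) (F : Fin n → PAQFT.Local s),
        PAQFT.RegularFamilyAt (fun Λ => (Zf Λ).coeff n L F) Λ₀ ∧
        PAQFT.MeromorphicFamilyAt (fun Λ => (ZMS Λ).coeff n L F) Λ₀) ∧
      -- the first factor is built inductively from principal parts
      (∀ n : ℕ, 2 ≤ n → ∀ (L : ℕ) (F : Fin n → PAQFT.Local s) (φ : PAQFT.Config s),
        PAQFT.IsPrincipalPart Λ₀
          (fun Λ => ((Z Λ).coeff n L F).1 φ -
            ∑ P : OrderedFinpartition n with 1 < P.length ∧ P.length < n,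
              (PAQFT.partTerm (ZMS Λ) (Zf Λ) P L F).1 φ)
          (fun Λ => ((ZMS Λ).coeff n L F).1 φ)) ∧
      -- the second factor is invertible in the renormalization group
      (∀ Λ ∈ U, PAQFT.RenormGroup 𝒢 (Zfinv Λ) ∧ PAQFT.IsInverse (Zfinv Λ) (Zf Λ)) ∧
      -- consequences for regularized S-matrices whose counter terms are the given family
      ∀ (S : PAQFT.FormalMap s (PAQFT.Microcausal s))
        (Sreg : ℂ → PAQFT.FormalMap s (PAQFT.Microcausal s)),
        PAQFT.EpsteinGlaser m 𝒢 S →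
        (∀ Λ ∈ U, Λ ≠ Λ₀ → PAQFT.StartingElement (Sreg Λ) ∧ PAQFT.PhiLocal (Sreg Λ)) →
        (∀ (n L : ℕ) (F : Fin n → PAQFT.Local s) (φ : PAQFT.Config s),
          MeromorphicAt (fun Λ => ((Sreg Λ).coeff n L F).1 φ) Λ₀) →
        (∀ (n L : ℕ) (F : Fin n → PAQFT.Local s) (φ : PAQFT.Config s),
          Filter.Tendsto (fun Λ => (PAQFT.compCoeff (Sreg Λ) (Z Λ) n L F).1 φ)
            (nhdsWithin Λ₀ {Λ₀}ᶜ) (nhds ((S.coeff n L F).1 φ))) →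
        -- the minimally subtracted S-matrix, before and after the limit
        (∃ (SMSreg : ℂ → PAQFT.FormalMap s (PAQFT.Microcausal s))
          (SMS : PAQFT.FormalMap s (PAQFT.Microcausal s)),
          (∀ Λ ∈ U, Λ ≠ Λ₀ → PAQFT.IsComp (SMSreg Λ) (Sreg Λ) (ZMS Λ) ∧
            ∃ SZ : PAQFT.FormalMap s (PAQFT.Microcausal s),
              PAQFT.IsComp SZ (Sreg Λ) (Z Λ) ∧ PAQFT.IsComp (SMSreg Λ) SZ (Zfinv Λ)) ∧
          (∀ (n L : ℕ) (F : Fin n → PAQFT.Local s) (φ : PAQFT.Config s),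
            Filter.Tendsto (fun Λ => ((SMSreg Λ).coeff n L F).1 φ)
              (nhdsWithin Λ₀ {Λ₀}ᶜ) (nhds ((SMS.coeff n L F).1 φ))) ∧
          PAQFT.IsComp SMS S (Zfinv Λ₀) ∧
          PAQFT.EpsteinGlaser m 𝒢 SMS) ∧
        -- the recursion for the first factor
        (∀ Λ ∈ U, Λ ≠ Λ₀ → PAQFT.FirstIsId (ZMS Λ)) ∧
        (∀ n : ℕ, 2 ≤ n → ∀ (L : ℕ) (F : Fin n → PAQFT.Local s) (φ : PAQFT.Config s),
          PAQFT.IsPrincipalPart Λ₀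
            (fun Λ => ∑ P : OrderedFinpartition n with 1 < P.length,
              (PAQFT.partTerm (Sreg Λ) (ZMS Λ) P L F).1 φ)
            (fun Λ => -((ZMS Λ).coeff n L F).1 φ)) := by
  obtain ⟨A, B, hA, hB, hBreg, hAmero, hpp⟩ := PAQFT.exists_birkhoff hU hΛ₀ hZ hZmero
  obtain ⟨W, hW, hWreg, hWB⟩ := PAQFT.exists_inverse hU hΛ₀ hB hBreg
  have hev := PAQFT.eventually_mem_and_ne hU hΛ₀
  have hZcomp : ∀ (n L : ℕ) (F : Fin n → PAQFT.Local s) (φ : PAQFT.Config s),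
      MeromorphicAt (fun Λ => ((Z Λ).coeff n L F).1 φ -
        ∑ P : OrderedFinpartition n with 1 < P.length ∧ P.length < n,
          (PAQFT.partTerm (A Λ) (B Λ) P L F).1 φ) Λ₀ := by
    intro n L F φ
    refine ((hZmero n L F).meromorphicAt φ).sub (MeromorphicAt.fun_sum fun P _ => ?_)
    refine PAQFT.MeromorphicFamilyAt.meromorphicAt
      (PAQFT.meromorphicFamilyAt_iff.2 fun φ₀ => ?_) φ
    refine PAQFT.ExpandsAt.partTerm ?_ ?_ ?_ P L F
    · exact hev.mono fun Λ hΛ => (hA Λ hΛ.1 hΛ.2).1.phi_local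
    · exact fun k L F => hAmero k L F φ₀
    · exact fun k L F => (hBreg k L F).meromorphic φ₀
  refine ⟨A, B, W, fun Λ hΛ hne => ⟨(hA Λ hΛ hne).1, fun n L F => ?_⟩, hB,
    fun n L F => ⟨hBreg n L F, hAmero n L F⟩, ?_,
    fun Λ hΛ => ⟨hW Λ hΛ, ?_, ?_⟩, ?_⟩
  · rw [(hA Λ hΛ hne).2, PAQFT.FormalMap.comp_coeff]
  · intro n hn L F φ
    rw [hpp n hn L F φ]
    exact PAQFT.isPrincipalPart_of_mem (PAQFT.principalPart_mem (hZcomp n L F φ))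
      (PAQFT.sub_principalPart_mem (hZcomp n L F φ))
  · exact PAQFT.isIdentity_iff.2 (hWB Λ hΛ).1
  · exact PAQFT.isIdentity_iff.2 (hWB Λ hΛ).2
  · intro S Sreg hS hSreg hSmero hlim
    have hSZ : ∀ᶠ Λ in nhdsWithin Λ₀ {Λ₀}ᶜ, PAQFT.PhiLocal ((Sreg Λ).comp (Z Λ)) :=
      hev.mono fun Λ hΛ => (hSreg Λ hΛ.1 hΛ.2).2.comp (hZ Λ hΛ.1 hΛ.2).tame.toEquivariant
    -- `S ∘ Z_MS = (S ∘ Z) ∘ Z_f⁻¹`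
    have hfac : ∀ Λ ∈ U, Λ ≠ Λ₀ →
        (Sreg Λ).comp (A Λ) = ((Sreg Λ).comp (Z Λ)).comp (W Λ) := by
      intro Λ hΛ hne
      rw [PAQFT.FormalMap.comp_comp, (hA Λ hΛ hne).2, PAQFT.FormalMap.comp_comp, (hWB Λ hΛ).2]
      exact congrArg _ (PAQFT.FormalMap.eq_of_coeff fun n L F =>
        (PAQFT.FormalMap.comp_one (A Λ) n L F).symm)
    have hconv : ∀ (n L : ℕ) (F : Fin n → PAQFT.Local s) (φ : PAQFT.Config s),
        Filter.Tendsto (fun Λ => (((Sreg Λ).comp (A Λ)).coeff n L F).1 φ)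
          (nhdsWithin Λ₀ {Λ₀}ᶜ) (nhds (((S.comp (W Λ₀)).coeff n L F).1 φ)) := by
      intro n L F φ
      refine (PAQFT.tendsto_comp hSZ hS.phi_local hlim hWreg n L F φ).congr' ?_
      filter_upwards [hev] with Λ hΛ
      rw [hfac Λ hΛ.1 hΛ.2]
    refine ⟨⟨fun Λ => (Sreg Λ).comp (A Λ), S.comp (W Λ₀), fun Λ hΛ hne =>
      ⟨fun _ _ _ => rfl, (Sreg Λ).comp (Z Λ), fun _ _ _ => rfl, fun n L F => ?_⟩, hconv,
      fun _ _ _ => rfl, hS.comp (hW Λ₀ hΛ₀)⟩, fun Λ hΛ hne => (hA Λ hΛ hne).1.first_order, ?_⟩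
    · show ((Sreg Λ).comp (A Λ)).coeff n L F = _
      rw [hfac Λ hΛ hne]
      rfl
    · intro n hn L F φ
      refine PAQFT.isPrincipalPart_neg (hev.mono fun Λ hΛ => (hSreg Λ hΛ.1 hΛ.2).1.2) hn L F φ ?_
        (PAQFT.meromorphicAt_comp (hev.mono fun Λ hΛ => (hSreg Λ hΛ.1 hΛ.2).2) hSmero hAmero
          n L F φ) (hconv n L F φ)
      rw [hpp n hn L F φ]
      exact PAQFT.principalPart_mem (hZcomp n L F φ)
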